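/- Let $n\ge 2$, $d\ge 1$, $D\ge 1$ be integers. A \emph{nearest-neighbour Hamiltonian} on a chain of $n$ particles of dimension $d$ is $H=\sum_{j=1}^{n-1}H_{j,j+1}$, where each local term $H_{j,j+1}$ is a Hermitian operator acting on the particles $j$ and $j+1$ (and as the identity elsewhere). A \emph{matrix product state (MPS) of bond dimension $D$} is a vector $|\psi\rangle=\sum_{i_1,\dots,i_n}C_{i_1\cdots i_n}|i_1\rangle\cdots|i_n\rangle$ of $(\mathbb C^d)^{\otimes n}$ given by complex tensors $\Gamma^{[j]}$ and real diagonal tensors $\lambda^{[j]}_\alpha\ge 0$ through $$C_{i_1\cdots i_n}=\sum_{\alpha_2,\dots,\alpha_n=1}^{D}\Gamma^{[1]i_1}_{\alpha_2}\lambda^{[2]}_{\alpha_2}\Gamma^{[2]i_2}_{\alpha_2\alpha_3}\lambda^{[3]}_{\alpha_3}\cdots\lambda^{[n]}_{\alpha_n}\Gamma^{[n]i_n}_{\alpha_n}.$$ \textbf{Theorem.} There are a single algorithm, in the model of a real random-access machine (unit cost for the exact real operations $+,-,\times,\div,\sqrt{\cdot}$ and comparisons, for the operations $+,-,\times$ and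 comparisons on natural numbers, and for memory accesses), and a polynomial $p$ in three variables, with the following property. Given any $n\ge2$, $d\ge 1$, $D\ge 1$, any real $\epsilon>0$, and any nearest-neighbour Hamiltonian $H$ on $n$ particles of dimension $d$ (by the matrix entries of its local terms), the algorithm outputs the tensors of an MPS $|\Omega\rangle$ of bond dimension $D$ with $\langle\Omega|\Omega\rangle=1$ such that, for every $J$ with $\|H_{j,j+1}\|\le J$ (operator norm) for all $j$, and every MPS $|\psi\rangle$ of bond dimension $D$ with $\langle\psi|\psi\rangle=1$, if $nD^2\ge 12$, then $$\langle\Omega|H|\Omega\rangle\le\langle\psi|H|\psi\rangle+2JD^2n^2\epsilon .$$ The running time of the algorithm is at most $n\cdot p(d,D,N)$, where $N=\left(\frac{144\,dD}{\epsilon}\right)^{D+2dD^2}$. -/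

import Mathlib

/-! ## A real random-access machine

Programs are while-programs over finitely many registers and finitely many unbounded arrays,
holding natural numbers (used for counting and addressing) or real numbers.  Register and array
names are fixed in the program; array indices are computed.  Every arithmetic operation, square
root, comparison, and every access to a register or to an array cell has unit cost.  The only
constants are natural numbers, and there is no rounding, no integer division, and no bit access.
(Division by zero and square roots of negative numbers return `0`.) -/

namespace RealRAM

/-- Expressions of natural-number type (`sub` is truncated). -/
inductive NExp : Type
  | const (k : ℕ)
  | var (x : ℕ)
  | get (a : ℕ) (i : NExp)
  | add (e f : NExp)
  | sub (e f : NExp)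
  | mul (e f : NExp)

/-- Expressions of real-number type. -/
inductive RExp : Type
  | var (x : ℕ)
  | get (a : ℕ) (i : NExp)
  | ofNat (e : NExp)
  | add (e f : RExp)
  | sub (e f : RExp)
  | mul (e f : RExp)
  | div (e f : RExp)
  | sqrt (e : RExp)

/-- Tests used for branching. -/
inductive Test : Type
  | natLe (e f : NExp)
  | realLe (e f : RExp)
  | not (b : Test)

/-- Programs. -/
inductive Prog : Type
  | skip
  | setNat (x : ℕ) (e : NExp)
  | setReal (x : ℕ) (e : RExp)
  | putNat (a : ℕ) (i e : NExp)
  | putReal (a : ℕ) (i : NExp) (e : RExp)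
  | seq (p q : Prog)
  | ite (b : Test) (p q : Prog)
  | while (b : Test) (p : Prog)

/-- Memory contents: registers and arrays of both types. -/
structure State : Type where
  nvar : ℕ → ℕ
  rvar : ℕ → ℝ
  narr : ℕ → ℕ → ℕ
  rarr : ℕ → ℕ → ℝ

/-- Value of a natural-number expression. -/
def NExp.eval (s : State) : NExp → ℕ
  | .const k => k
  | .var x => s.nvar x
  | .get a i => s.narr a (i.eval s)
  | .add e f => e.eval s + f.eval s
  | .sub e f => e.eval s - f.eval s
  | .mul e f => e.eval s * f.eval s

/-- Cost of evaluating a natural-number expression. -/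
def NExp.cost : NExp → ℕ
  | .const _ => 1
  | .var _ => 1
  | .get _ i => i.cost + 1
  | .add e f => e.cost + f.cost + 1
  | .sub e f => e.cost + f.cost + 1
  | .mul e f => e.cost + f.cost + 1

/-- Value of a real expression. -/
noncomputable def RExp.eval (s : State) : RExp → ℝ
  | .var x => s.rvar x
  | .get a i => s.rarr a (i.eval s)
  | .ofNat e => (e.eval s : ℝ)
  | .add e f => e.eval s + f.eval s
  | .sub e f => e.eval s - f.eval s
  | .mul e f => e.eval s * f.eval s
  | .div e f => e.eval s / f.eval s
  | .sqrt e => Real.sqrt (e.eval s)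

/-- Cost of evaluating a real expression. -/
def RExp.cost : RExp → ℕ
  | .var _ => 1
  | .get _ i => i.cost + 1
  | .ofNat e => e.cost + 1
  | .add e f => e.cost + f.cost + 1
  | .sub e f => e.cost + f.cost + 1
  | .mul e f => e.cost + f.cost + 1
  | .div e f => e.cost + f.cost + 1
  | .sqrt e => e.cost + 1

/-- Truth of a test. -/
def Test.Holds (s : State) : Test → Prop
  | .natLe e f => e.eval s ≤ f.eval s
  | .realLe e f => e.eval s ≤ f.eval s
  | .not b => ¬ b.Holds s

/-- Cost of a test. -/
def Test.cost : Test → ℕ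
  | .natLe e f => e.cost + f.cost + 1
  | .realLe e f => e.cost + f.cost + 1
  | .not b => b.cost + 1

/-- `Exec p s s' t`: the program `p`, started in memory `s`, halts in memory `s'` after `t`
steps. -/
inductive Exec : Prog → State → State → ℕ → Prop
  | skip (s : State) : Exec .skip s s 1
  | setNat (x : ℕ) (e : NExp) (s : State) :
      Exec (.setNat x e) s { s with nvar := Function.update s.nvar x (e.eval s) } (e.cost + 1)
  | setReal (x : ℕ) (e : RExp) (s : State) :
      Exec (.setReal x e) s { s with rvar := Function.update s.rvar x (e.eval s) } (e.cost + 1)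
  | putNat (a : ℕ) (i e : NExp) (s : State) :
      Exec (.putNat a i e) s
        { s with narr := Function.update s.narr a
                  (Function.update (s.narr a) (i.eval s) (e.eval s)) }
        (i.cost + e.cost + 1)
  | putReal (a : ℕ) (i : NExp) (e : RExp) (s : State) :
      Exec (.putReal a i e) s
        { s with rarr := Function.update s.rarr a
                  (Function.update (s.rarr a) (i.eval s) (e.eval s)) }
        (i.cost + e.cost + 1)
  | seq {p q : Prog} {s s₁ s₂ : State} {t₁ t₂ : ℕ}
      (hp : Exec p s s₁ t₁) (hq : Exec q s₁ s₂ t₂) : Exec (.seq p q) s s₂ (t₁ + t₂)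
  | iteTrue {b : Test} {p q : Prog} {s s' : State} {t : ℕ}
      (hb : b.Holds s) (hp : Exec p s s' t) : Exec (.ite b p q) s s' (b.cost + t + 1)
  | iteFalse {b : Test} {p q : Prog} {s s' : State} {t : ℕ}
      (hb : ¬ b.Holds s) (hq : Exec q s s' t) : Exec (.ite b p q) s s' (b.cost + t + 1)
  | whileTrue {b : Test} {p : Prog} {s s₁ s₂ : State} {t₁ t₂ : ℕ}
      (hb : b.Holds s) (hp : Exec p s s₁ t₁) (hw : Exec (.while b p) s₁ s₂ t₂) :
      Exec (.while b p) s s₂ (b.cost + t₁ + t₂ + 1)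
  | whileFalse {b : Test} {p : Prog} {s : State}
      (hb : ¬ b.Holds s) : Exec (.while b p) s s (b.cost + 1)

end RealRAM

/-! ## Spin chains and matrix product states

A chain has `n = m + 2` particles, hence `m + 1` bonds; bond `j` joins the sites `j.castSucc`
and `j.succ`. -/

/-- A (not necessarily normalized) pure state of `m + 2` particles of dimension `d`, given by its
coefficients in the product basis. -/
abbrev ChainState (m d : ℕ) : Type := (Fin (m + 2) → Fin d) → ℂ

/-- The local terms of a nearest-neighbour Hamiltonian: one Hermitian operator on two
`d`-dimensional particles for each bond. -/
structure NNHamiltonian (m d : ℕ) : Type where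
  term : Fin (m + 1) → Matrix (Fin d × Fin d) (Fin d × Fin d) ℂ
  isHermitian : ∀ j, (term j).IsHermitian

namespace NNHamiltonian

variable {m d : ℕ}

/-- The term of bond `j`, acting as the identity on all other particles. -/
def termOnChain (H : NNHamiltonian m d) (j : Fin (m + 1)) :
    Matrix (Fin (m + 2) → Fin d) (Fin (m + 2) → Fin d) ℂ :=
  Matrix.of fun x y =>
    if ∀ k, k ≠ j.castSucc → k ≠ j.succ → x k = y k then
      H.term j (x j.castSucc, x j.succ) (y j.castSucc, y j.succ)
    else 0

/-- The Hamiltonian `H = ∑ⱼ H_{j,j+1}` of the whole chain. -/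
def toMatrix (H : NNHamiltonian m d) :
    Matrix (Fin (m + 2) → Fin d) (Fin (m + 2) → Fin d) ℂ :=
  ∑ j, H.termOnChain j

/-- The energy `⟨ψ|H|ψ⟩` (a real number, as `H` is Hermitian). -/
def energy (H : NNHamiltonian m d) (ψ : ChainState m d) : ℝ :=
  (star ψ ⬝ᵥ (H.toMatrix.mulVec ψ)).re

/-- `J` bounds the operator norm of every local term. -/
def TermsBoundedBy (H : NNHamiltonian m d) (J : ℝ) : Prop :=
  ∀ j, ‖Matrix.toEuclideanCLM (n := Fin d × Fin d) (𝕜 := ℂ) (H.term j)‖ ≤ J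

end NNHamiltonian

/-- Matrix product states of `m + 2` particles of dimension `d` with bond dimension `D`, as tensor
networks: rank-2 tensors at the two ends, rank-3 tensors at the other sites, and a nonnegative
diagonal tensor on every bond. -/
structure MPS (m d D : ℕ) : Type where
  first : Fin d → Fin D → ℂ
  bulk : Fin m → Fin d → Fin D → Fin D → ℂ
  last : Fin d → Fin D → ℂ
  lam : Fin (m + 1) → Fin D → ℝ
  lam_nonneg : ∀ k α, 0 ≤ lam k α

namespace MPS

variable {m d D : ℕ}

/-- The state of a matrix product state: its coefficients are obtained by contracting the network,
i.e. by summing over all values of the bond indices. -/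
noncomputable def toState (A : MPS m d D) : ChainState m d := fun i =>
  ∑ α : Fin (m + 1) → Fin D,
    A.first (i 0) (α 0) *
      (∏ k : Fin (m + 1), (A.lam k (α k) : ℂ)) *
      (∏ j : Fin m, A.bulk j (i j.succ.castSucc) (α j.castSucc) (α j.succ)) *
      A.last (i (Fin.last (m + 1))) (α (Fin.last m))

/-- The state is a unit vector. -/
def Normalized (A : MPS m d D) : Prop := star A.toState ⬝ᵥ A.toState = 1

end MPS

/-! ## Input and output conventions (all arrays are stored in row-major order) -/

/-- The memory `s` holds the input: the number of particles, `d` and `D` in the first three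
natural-number registers, `ε` in the first real register, and the real and imaginary parts of the
matrix entries of the local terms in the real arrays `0` and `1`.  The rest of the memory is
arbitrary. -/
def RealRAM.State.HoldsInput (s : RealRAM.State) {m d : ℕ} (D : ℕ) (ε : ℝ)
    (H : NNHamiltonian m d) : Prop :=
  s.nvar 0 = m + 2 ∧ s.nvar 1 = d ∧ s.nvar 2 = D ∧ s.rvar 0 = ε ∧
  ∀ (j : Fin (m + 1)) (a b a' b' : Fin d),
    s.rarr 0 ((((j * d + a) * d + b) * d + a') * d + b') = (H.term j (a, b) (a', b')).re ∧
    s.rarr 1 ((((j * d + a) * d + b) * d + a') * d + b') = (H.term j (a, b) (a', b')).im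

/-- The memory `s` holds the matrix product state `A` as output: the real and imaginary parts of
its tensors in the real arrays `2, …, 7`, and its diagonal tensors in the real array `8`. -/
def RealRAM.State.HoldsOutput (s : RealRAM.State) {m d D : ℕ} (A : MPS m d D) : Prop :=
  (∀ (i : Fin d) (α : Fin D),
    s.rarr 2 (i * D + α) = (A.first i α).re ∧ s.rarr 3 (i * D + α) = (A.first i α).im) ∧
  (∀ (j : Fin m) (i : Fin d) (α β : Fin D),
    s.rarr 4 (((j * d + i) * D + α) * D + β) = (A.bulk j i α β).re ∧
    s.rarr 5 (((j * d + i) * D + α) * D + β) = (A.bulk j i α β).im) ∧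
  (∀ (i : Fin d) (α : Fin D),
    s.rarr 6 (i * D + α) = (A.last i α).re ∧ s.rarr 7 (i * D + α) = (A.last i α).im) ∧
  (∀ (k : Fin (m + 1)) (α : Fin D), s.rarr 8 (k * D + α) = A.lam k α)

/-- The quantity `N = (144 d D / ε) ^ (D + 2 d D²)`. -/
noncomputable def netSize (d D : ℕ) (ε : ℝ) : ℝ :=
  (144 * d * D / ε) ^ (D + 2 * d * D ^ 2)

/-! ## Program logic for the real random-access machine -/

/-! In left-canonical form a matrix product state consists of isometric tensors, `∑ᵢ (A i)ᴴ * A i =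
1`, and of density matrices on the bonds, where `ρ k = ∑ᵢ A i * ρ (k + 1) * (A i)ᴴ` for the tensor
`A` of site `k`. The reduced state of the sites `j` and `j + 1` is then a function of the two
tensors and of `ρ (j + 2)`, and so is the energy of their bond (`weight`). Let layer `k` carry the
pair consisting of the tensor of the `k`-th site and the density matrix to its right. Then a
normalized state is a path through the layers, and both the constraints and the energy couple
consecutive layers only. Over a finite set of pairs the minimization is a shortest-path problem,
which dynamic programming solves in time linear in the number of sites.

Three facts turn this into an approximation algorithm. Every normalized state has exact data of this
kind: Gram–Schmidt swept along the chain makes the tensors isometric (`exists_canonical`,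
`exists_exact`). Exact data can be rounded to a grid with step `1 / M` at the price of violating the
constraints by at most `η` (`Exact.exists_path`); hence the search admits all steps whose squared
violations add up to at most `η ^ 2`. Conversely, such approximate data describe an actual state
whose squared norm is close to `1` and whose bond energies are close to the predicted ones
(`Approx.abs_norm_sub_one_le`, `Approx.abs_weight_sub_le`). The errors do not grow exponentially
along the chain because they are measured by domination of sesquilinear forms (`Dom`): an
environment that contains a local term is dominated by `J` times the environment without it, and
transport to the next site preserves this with the same `J`. So each bond energy is off by `O(n η)`
and the total by `O(n² η)`, the source of the factor `n ^ 2`. With `η = ε / (80 d⁴ D⁷)`, 75 of the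
80 parts pay for the predictions and 5 for the normalization (`Path.energy_le`).

If `n D² ε ≥ 1`, the bound holds for every normalized output, as all energies lie between `-(n - 1)
J` and `(n - 1) J` (`energy_le_of_coarse`). In particular no search is needed for `ε ≥ 1`, where a
product state is returned.

For `ε < 1` the net has at most `N ^ 20` points (`netPoints_le`), and the program takes `O(n (S + 1)
^ 12)` steps for a net of `S` points: ten nested loops to evaluate a step, and two more for the
pairs of points.

Programs are verified by triples with a time bound (`Runs`). What a program leaves alone is read off
from its syntax (`Frame`). The main rules are those for counting loops (`Runs.forLt`), for nested
summations (`Runs.sumLoop`) and for loops that fill arrays (`Runs.forWrites`); `Tables.optimal` is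
the correctness of the dynamic programming. -/

namespace RealRAM

namespace State

/-- Assign a natural-number register. -/
def setN (s : State) (x v : ℕ) : State := { s with nvar := Function.update s.nvar x v }

/-- Assign a real register. -/
def setR (s : State) (x : ℕ) (v : ℝ) : State := { s with rvar := Function.update s.rvar x v }

/-- Write to an array of natural numbers. -/
def putN (s : State) (a i v : ℕ) : State :=
  { s with narr := Function.update s.narr a (Function.update (s.narr a) i v) }

/-- Write to an array of real numbers. -/
def putR (s : State) (a i : ℕ) (v : ℝ) : State :=
  { s with rarr := Function.update s.rarr a (Function.update (s.rarr a) i v) }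

section
variable (s : State) (x y a a' i j v : ℕ) (r : ℝ)

@[simp] lemma setN_nvar : (s.setN x v).nvar y = if y = x then v else s.nvar y := by
  simp [setN, Function.update_apply]
@[simp] lemma setN_rvar : (s.setN x v).rvar = s.rvar := rfl
@[simp] lemma setN_narr : (s.setN x v).narr = s.narr := rfl
@[simp] lemma setN_rarr : (s.setN x v).rarr = s.rarr := rfl
@[simp] lemma setR_nvar : (s.setR x r).nvar = s.nvar := rfl
@[simp] lemma setR_rvar : (s.setR x r).rvar y = if y = x then r else s.rvar y := by
  simp [setR, Function.update_apply]
@[simp] lemma setR_narr : (s.setR x r).narr = s.narr := rfl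
@[simp] lemma setR_rarr : (s.setR x r).rarr = s.rarr := rfl
@[simp] lemma putN_nvar : (s.putN a i v).nvar = s.nvar := rfl
@[simp] lemma putN_rvar : (s.putN a i v).rvar = s.rvar := rfl
@[simp] lemma putN_narr : (s.putN a i v).narr a' j =
    if a' = a then (if j = i then v else s.narr a j) else s.narr a' j := by
  by_cases h : a' = a
  · subst h; simp [putN, Function.update_apply]
  · simp [putN, h]
@[simp] lemma putN_rarr : (s.putN a i v).rarr = s.rarr := rfl
@[simp] lemma putR_nvar : (s.putR a i r).nvar = s.nvar := rfl
@[simp] lemma putR_rvar : (s.putR a i r).rvar = s.rvar := rfl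
@[simp] lemma putR_narr : (s.putR a i r).narr = s.narr := rfl
@[simp] lemma putR_rarr : (s.putR a i r).rarr a' j =
    if a' = a then (if j = i then r else s.rarr a j) else s.rarr a' j := by
  by_cases h : a' = a
  · subst h; simp [putR, Function.update_apply]
  · simp [putR, h]

end

end State

/-- The program may assign the natural-number register `x`. -/
def Prog.modN : Prog → ℕ → Bool
  | .setNat y _, x => Nat.beq x y
  | .seq p q, x => p.modN x || q.modN x
  | .ite _ p q, x => p.modN x || q.modN x
  | .while _ p, x => p.modN x
  | _, _ => false

/-- The program may assign the real register `x`. -/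
def Prog.modR : Prog → ℕ → Bool
  | .setReal y _, x => Nat.beq x y
  | .seq p q, x => p.modR x || q.modR x
  | .ite _ p q, x => p.modR x || q.modR x
  | .while _ p, x => p.modR x
  | _, _ => false

/-- The program may write to the natural-number array `x`. -/
def Prog.modNA : Prog → ℕ → Bool
  | .putNat y _ _, x => Nat.beq x y
  | .seq p q, x => p.modNA x || q.modNA x
  | .ite _ p q, x => p.modNA x || q.modNA x
  | .while _ p, x => p.modNA x
  | _, _ => false

/-- The program may write to the real array `x`. -/
def Prog.modRA : Prog → ℕ → Bool
  | .putReal y _ _, x => Nat.beq x y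
  | .seq p q, x => p.modRA x || q.modRA x
  | .ite _ p q, x => p.modRA x || q.modRA x
  | .while _ p, x => p.modRA x
  | _, _ => false

/-- The states agree on all registers and arrays that the program does not mention as a target. -/
structure Frame (P : Prog) (s s' : State) : Prop where
  nvar : ∀ x, P.modN x = false → s'.nvar x = s.nvar x
  rvar : ∀ x, P.modR x = false → s'.rvar x = s.rvar x
  narr : ∀ x, P.modNA x = false → s'.narr x = s.narr x
  rarr : ∀ x, P.modRA x = false → s'.rarr x = s.rarr x

lemma Frame.refl (P : Prog) (s : State) : Frame P s s :=
  ⟨fun _ _ => rfl, fun _ _ => rfl, fun _ _ => rfl, fun _ _ => rfl⟩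

lemma Frame.trans {P : Prog} {s s₁ s₂ : State} (h : Frame P s s₁) (h' : Frame P s₁ s₂) :
    Frame P s s₂ :=
  ⟨fun x hx => (h'.nvar x hx).trans (h.nvar x hx), fun x hx => (h'.rvar x hx).trans (h.rvar x hx),
    fun x hx => (h'.narr x hx).trans (h.narr x hx), fun x hx => (h'.rarr x hx).trans (h.rarr x hx)⟩

lemma Frame.mono {P Q : Prog} {s s' : State} (h : Frame P s s')
    (hN : ∀ x, Q.modN x = false → P.modN x = false) (hR : ∀ x, Q.modR x = false → P.modR x = false)
    (hNA : ∀ x, Q.modNA x = false → P.modNA x = false)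
    (hRA : ∀ x, Q.modRA x = false → P.modRA x = false) : Frame Q s s' :=
  ⟨fun x hx => h.nvar x (hN x hx), fun x hx => h.rvar x (hR x hx),
    fun x hx => h.narr x (hNA x hx), fun x hx => h.rarr x (hRA x hx)⟩

lemma Frame.seq_left {P Q : Prog} {s s' : State} (h : Frame P s s') : Frame (.seq P Q) s s' :=
  h.mono (by simp [Prog.modN]; tauto) (by simp [Prog.modR]; tauto) (by simp [Prog.modNA]; tauto)
    (by simp [Prog.modRA]; tauto)

lemma Frame.seq_right {P Q : Prog} {s s' : State} (h : Frame Q s s') : Frame (.seq P Q) s s' :=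
  h.mono (by simp [Prog.modN]) (by simp [Prog.modR]) (by simp [Prog.modNA]) (by simp [Prog.modRA])

lemma Frame.ite_left {b : Test} {P Q : Prog} {s s' : State} (h : Frame P s s') :
    Frame (.ite b P Q) s s' :=
  h.mono (by simp [Prog.modN]; tauto) (by simp [Prog.modR]; tauto) (by simp [Prog.modNA]; tauto)
    (by simp [Prog.modRA]; tauto)

lemma Frame.ite_right {b : Test} {P Q : Prog} {s s' : State} (h : Frame Q s s') :
    Frame (.ite b P Q) s s' :=
  h.mono (by simp [Prog.modN]) (by simp [Prog.modR]) (by simp [Prog.modNA]) (by simp [Prog.modRA])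

lemma Frame.while_body {b : Test} {P : Prog} {s s' : State} (h : Frame P s s') :
    Frame (.while b P) s s' := ⟨h.nvar, h.rvar, h.narr, h.rarr⟩

lemma Frame.setNat (x : ℕ) (e : NExp) (s : State) (v : ℕ) : Frame (.setNat x e) s (s.setN x v) :=
  ⟨fun y hy => by
    have : y ≠ x := by rintro rfl; simp [Prog.modN] at hy
    simp [this], fun _ _ => rfl, fun _ _ => rfl, fun _ _ => rfl⟩

/-- The sets of possible targets are computed by Boolean functions, so for a concrete program the
preservation of any register or array follows by `rfl`. -/
lemma Exec.frame {P : Prog} {s s' : State} {t : ℕ} (h : Exec P s s' t) : Frame P s s' := by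
  induction h with
  | skip s => exact Frame.refl _ _
  | setNat x e s => exact Frame.setNat x e s _
  | setReal x e s =>
    refine ⟨fun _ _ => rfl, fun y hy => ?_, fun _ _ => rfl, fun _ _ => rfl⟩
    have : y ≠ x := by rintro rfl; simp [Prog.modR] at hy
    simp [this]
  | putNat a i e s =>
    refine ⟨fun _ _ => rfl, fun _ _ => rfl, fun y hy => ?_, fun _ _ => rfl⟩
    have : y ≠ a := by rintro rfl; simp [Prog.modNA] at hy
    simp [this]
  | putReal a i e s =>
    refine ⟨fun _ _ => rfl, fun _ _ => rfl, fun _ _ => rfl, fun y hy => ?_⟩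
    have : y ≠ a := by rintro rfl; simp [Prog.modRA] at hy
    simp [this]
  | seq _ _ ih₁ ih₂ => exact ih₁.seq_left.trans ih₂.seq_right
  | iteTrue _ _ ih => exact ih.ite_left
  | iteFalse _ _ ih => exact ih.ite_right
  | whileTrue _ _ _ ih₁ ih₂ => exact ih₁.while_body.trans ih₂
  | whileFalse _ => exact Frame.refl _ _

/-- Started in `s`, the program halts within `T` steps in a state satisfying `Q`. -/
def Runs (P : Prog) (s : State) (T : ℕ) (Q : State → Prop) : Prop :=
  ∃ s' t, Exec P s s' t ∧ t ≤ T ∧ Q s'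

namespace Runs

/-- The frame is available when a postcondition is weakened, so that postconditions need to mention
only what a program computes. -/
lemma mono {P : Prog} {s : State} {T T' : ℕ} {Q Q' : State → Prop} (h : Runs P s T Q)
    (hT : T ≤ T') (hQ : ∀ s', Frame P s s' → Q s' → Q' s') : Runs P s T' Q' := by
  obtain ⟨s', t, he, ht, hq⟩ := h
  exact ⟨s', t, he, ht.trans hT, hQ s' he.frame hq⟩

lemma skip {s : State} {Q : State → Prop} (h : Q s) : Runs .skip s 1 Q :=
  ⟨_, _, Exec.skip s, le_rfl, h⟩

lemma setNat {x : ℕ} {e : NExp} {s : State} {Q : State → Prop} (h : Q (s.setN x (e.eval s))) :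
    Runs (.setNat x e) s (e.cost + 1) Q := ⟨_, _, Exec.setNat x e s, le_rfl, h⟩

lemma setReal {x : ℕ} {e : RExp} {s : State} {Q : State → Prop} (h : Q (s.setR x (e.eval s))) :
    Runs (.setReal x e) s (e.cost + 1) Q := ⟨_, _, Exec.setReal x e s, le_rfl, h⟩

lemma putNat {a : ℕ} {i e : NExp} {s : State} {Q : State → Prop}
    (h : Q (s.putN a (i.eval s) (e.eval s))) :
    Runs (.putNat a i e) s (i.cost + e.cost + 1) Q := ⟨_, _, Exec.putNat a i e s, le_rfl, h⟩

lemma putReal {a : ℕ} {i : NExp} {e : RExp} {s : State} {Q : State → Prop}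
    (h : Q (s.putR a (i.eval s) (e.eval s))) :
    Runs (.putReal a i e) s (i.cost + e.cost + 1) Q := ⟨_, _, Exec.putReal a i e s, le_rfl, h⟩

lemma seq {P Q : Prog} {s : State} {T₁ T₂ : ℕ} {R : State → Prop} {R₁ : State → Prop}
    (h : Runs P s T₁ R₁) (h' : ∀ s₁, Frame P s s₁ → R₁ s₁ → Runs Q s₁ T₂ R) :
    Runs (.seq P Q) s (T₁ + T₂) R := by
  obtain ⟨s₁, t₁, he, ht, hr⟩ := h
  obtain ⟨s₂, t₂, he', ht', hr'⟩ := h' s₁ he.frame hr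
  exact ⟨s₂, _, he.seq he', add_le_add ht ht', hr'⟩

lemma ite {b : Test} {P Q : Prog} {s : State} {T : ℕ} {R : State → Prop}
    (h₁ : b.Holds s → Runs P s T R) (h₂ : ¬ b.Holds s → Runs Q s T R) :
    Runs (.ite b P Q) s (b.cost + T + 1) R := by
  by_cases hb : b.Holds s
  · obtain ⟨s', t, he, ht, hr⟩ := h₁ hb
    exact ⟨s', _, Exec.iteTrue hb he, by omega, hr⟩
  · obtain ⟨s', t, he, ht, hr⟩ := h₂ hb
    exact ⟨s', _, Exec.iteFalse hb he, by omega, hr⟩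

/-- The invariant is indexed by the number of completed rounds and decides the test: it holds before
round `c` and fails at `c`. The induction is on the number of rounds left. -/
lemma whileLoop {b : Test} {P : Prog} (c T : ℕ) (I : ℕ → State → Prop)
    (hstep : ∀ k < c, ∀ s, I k s → b.Holds s ∧ Runs P s T (I (k + 1)))
    (hend : ∀ s, I c s → ¬ b.Holds s) {s : State} (h : I 0 s) :
    Runs (.while b P) s (c * (T + b.cost + 1) + (b.cost + 1)) (I c) := by
  have key : ∀ l k, k + l = c → ∀ s, I k s →
      Runs (.while b P) s (l * (T + b.cost + 1) + (b.cost + 1)) (I c) := by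
    intro l
    induction l with
    | zero =>
      intro k hk s hs
      obtain rfl : k = c := by omega
      exact ⟨s, _, Exec.whileFalse (hend s hs), by omega, hs⟩
    | succ l ih =>
      intro k hk s hs
      obtain ⟨hb, s₁, t₁, he, ht, hi⟩ := hstep k (by omega) s hs
      obtain ⟨s₂, t₂, he₂, ht₂, hi₂⟩ := ih (k + 1) (by omega) s₁ hi
      refine ⟨s₂, _, Exec.whileTrue hb he he₂, ?_, hi₂⟩
      rw [Nat.succ_mul]
      omega
  exact key c 0 (by simp) s h

end Runs

/-- `for x < b do P` -/
def forLt (x : ℕ) (b : NExp) (P : Prog) : Prog :=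
  .seq (.setNat x (.const 0))
    (.while (.not (.natLe b (.var x))) (.seq P (.setNat x (.add (.var x) (.const 1)))))

/-- The bound is evaluated anew in every round, hence it must have the value `c` in all states that
the loop can reach. One round costs the body, 4 for the increment, `b.cost + 3` for the test and 1
for the branch. -/
lemma Runs.forLt {x : ℕ} {b : NExp} {P : Prog} {s : State} (c T : ℕ) (I : ℕ → State → Prop)
    (hx : P.modN x = false)
    (hb : ∀ s', Frame (forLt x b P) s s' → b.eval s' = c)
    (h0 : I 0 (s.setN x 0))
    (hstep : ∀ k < c, ∀ s', Frame (RealRAM.forLt x b P) s s' → s'.nvar x = k → I k s' →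
      Runs P s' T (fun s'' => I (k + 1) (s''.setN x (k + 1)))) :
    Runs (RealRAM.forLt x b P) s ((c + 1) * (T + b.cost + 8)) (I c) := by
  have h := Runs.seq (P := .setNat x (.const 0))
    (Q := .while (.not (.natLe b (.var x))) (.seq P (.setNat x (.add (.var x) (.const 1)))))
    (s := s) (T₁ := 2) (R₁ := fun s' => s' = s.setN x 0) (R := fun s' => I c s')
    (T₂ := c * ((T + 4) + (b.cost + 3) + 1) + ((b.cost + 3) + 1))
    (Runs.setNat (by simp [NExp.eval])) (by
      rintro s₁ hF rfl
      have hw := Runs.whileLoop (b := .not (.natLe b (.var x)))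
        (P := .seq P (.setNat x (.add (.var x) (.const 1)))) c (T + 4)
        (fun k s' => s'.nvar x = k ∧ Frame (RealRAM.forLt x b P) s s' ∧ I k s')
        (by
          rintro k hk s' ⟨h1, h2, h3⟩
          refine ⟨?_, ?_⟩
          · simp [Test.Holds, NExp.eval, h1, hb s' h2, hk]
          · refine Runs.seq (R₁ := fun s'' => s''.nvar x = k ∧
              Frame (RealRAM.forLt x b P) s s'' ∧ I (k + 1) (s''.setN x (k + 1))) ?_ ?_
            · refine (hstep k hk s' h2 h1 h3).mono le_rfl fun s'' hF' hI =>
                ⟨by rw [hF'.nvar x hx, h1], h2.trans ?_, hI⟩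
              exact (hF'.seq_left.while_body).seq_right
            · rintro s'' - ⟨h1', h2', h3'⟩
              refine Runs.setNat (e := .add (.var x) (.const 1)) ?_
              simp only [NExp.eval, h1']
              refine ⟨by simp, h2'.trans ?_, h3'⟩
              exact (Frame.setNat x _ _ _).seq_left)
        (by
          rintro s' ⟨h1, h2, h3⟩
          simp [Test.Holds, NExp.eval, h1, hb s' h2])
        (s := s.setN x 0) ⟨by simp, hF.seq_left, h0⟩
      exact hw.mono (by simp [Test.cost, NExp.cost]) (fun s' _ h => h.2.2))
  refine h.mono ?_ (fun _ _ h => h)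
  have : (c + 1) * (T + b.cost + 8) = c * (T + b.cost + 8) + (T + b.cost + 8) := by ring
  rw [this]
  have : c * (T + 4 + (b.cost + 3) + 1) = c * (T + b.cost + 8) := by ring
  omega

/-! ### Accumulation loops -/

/-- The expression reads the natural-number register `x`. -/
def NExp.reads : NExp → ℕ → Bool
  | .const _, _ => false
  | .var y, x => Nat.beq x y
  | .get _ i, x => i.reads x
  | .add e f, x => e.reads x || f.reads x
  | .sub e f, x => e.reads x || f.reads x
  | .mul e f, x => e.reads x || f.reads x

/-- The expression reads the real register `x`. -/
def RExp.reads : RExp → ℕ → Bool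
  | .var y, x => Nat.beq x y
  | .get _ _, _ => false
  | .ofNat _, _ => false
  | .add e f, x => e.reads x || f.reads x
  | .sub e f, x => e.reads x || f.reads x
  | .mul e f, x => e.reads x || f.reads x
  | .div e f, x => e.reads x || f.reads x
  | .sqrt e, x => e.reads x

lemma NExp.eval_congr {s s' : State} (e : NExp) (h : ∀ x, e.reads x = true → s'.nvar x = s.nvar x)
    (ha : s'.narr = s.narr) : e.eval s' = e.eval s := by
  induction e with
  | const k => rfl
  | var y => exact h y (by simp [NExp.reads])
  | get a i ih => simp only [NExp.eval]; rw [ih h, ha]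
  | add e f he hf | sub e f he hf | mul e f he hf =>
    simp only [NExp.eval]
    rw [he fun x hx => h x (by simp [NExp.reads, hx]), hf fun x hx => h x (by simp [NExp.reads, hx])]

lemma RExp.eval_congr {s s' : State} (e : RExp) (h : ∀ x, e.reads x = true → s'.rvar x = s.rvar x)
    (hn : s'.nvar = s.nvar) (ha : s'.narr = s.narr) (hr : s'.rarr = s.rarr) :
    e.eval s' = e.eval s := by
  have hN : ∀ i : NExp, i.eval s' = i.eval s := fun i => i.eval_congr (fun x _ => by rw [hn]) ha
  induction e with
  | var y => exact h y (by simp [RExp.reads])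
  | get a i => simp only [RExp.eval, hN, hr]
  | ofNat e => simp only [RExp.eval, hN]
  | sqrt e ih => simp only [RExp.eval]; rw [ih h]
  | add e f he hf | sub e f he hf | mul e f he hf | div e f he hf =>
    simp only [RExp.eval]
    rw [he fun x hx => h x (by simp [RExp.reads, hx]), hf fun x hx => h x (by simp [RExp.reads, hx])]

/-- Nested loops adding the values of an expression to a real register. -/
def sumLoop (acc : ℕ) : List (ℕ × NExp) → RExp → Prog
  | [], e => .setReal acc (.add (.var acc) e)
  | (x, b) :: L, e => forLt x b (sumLoop acc L e)

/-- The sum computed by `sumLoop`. -/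
noncomputable def sumVal (s : State) : List (ℕ × NExp) → RExp → ℝ
  | [], e => e.eval s
  | (x, b) :: L, e => ∑ k ∈ Finset.range (b.eval s), sumVal (s.setN x k) L e

/-- The loop variable is one of those of the list. -/
def binds : List (ℕ × NExp) → ℕ → Bool
  | [], _ => false
  | (y, _) :: L, x => Nat.beq x y || binds L x

/-- The bounds do not read the loop variables, and the latter are distinct. -/
def loopsOK : List (ℕ × NExp) → Bool
  | [] => true
  | (x, b) :: L => !binds L x && !b.reads x && L.all (fun p => !b.reads p.1 && !p.2.reads x) &&
      loopsOK L

lemma exists_of_binds {y : ℕ} : ∀ {L : List (ℕ × NExp)}, binds L y = true → ∃ p ∈ L, p.1 = y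
  | (z, c) :: L, h => by
    simp only [binds, Bool.or_eq_true] at h
    rcases h with h | h
    · exact ⟨(z, c), by simp, (Nat.eq_of_beq_eq_true h).symm⟩
    · obtain ⟨p, hp, hy⟩ := exists_of_binds h
      exact ⟨p, by simp [hp], hy⟩

lemma loopsOK_cons {x : ℕ} {b : NExp} {L : List (ℕ × NExp)} (h : loopsOK ((x, b) :: L) = true) :
    binds L x = false ∧ b.reads x = false ∧ (∀ y, binds L y = true → b.reads y = false) ∧
      (∀ p ∈ L, p.2.reads x = false) ∧ loopsOK L = true := by
  simp only [loopsOK, Bool.and_eq_true, Bool.not_eq_true', List.all_eq_true] at h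
  obtain ⟨⟨⟨h1, h2⟩, h3⟩, h4⟩ := h
  refine ⟨h1, h2, fun y hy => ?_, fun p hp => (h3 p hp).2, h4⟩
  obtain ⟨p, hp, rfl⟩ := exists_of_binds hy
  exact (h3 p hp).1

lemma not_reads_of_binds {y : ℕ} : ∀ {L : List (ℕ × NExp)}, loopsOK L = true → ∀ p ∈ L,
    binds L y = true → p.2.reads y = false
  | (z, c) :: L, h, p, hp, hy => by
    obtain ⟨k1, k2, k3, k4, k5⟩ := loopsOK_cons h
    simp only [binds, Bool.or_eq_true] at hy
    rcases List.mem_cons.1 hp with rfl | hp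
    · rcases hy with hy | hy
      · rw [Nat.eq_of_beq_eq_true hy, k2]
      · exact k3 y hy
    · rcases hy with hy | hy
      · rw [Nat.eq_of_beq_eq_true hy, k4 p hp]
      · exact not_reads_of_binds k5 p hp hy

/-- A bound for the cost of one round of nested loops. -/
def sumCost : List (ℕ × NExp) → RExp → ℕ
  | [], e => e.cost + 3
  | (_, b) :: L, e => sumCost L e + b.cost + 8

/-- Each loop variable is assigned before it is read, and the summand does not read the accumulator;
the previous contents of these registers are therefore irrelevant. -/
lemma sumVal_congr {acc : ℕ} {e : RExp} (he : e.reads acc = false) :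
    ∀ (L : List (ℕ × NExp)), loopsOK L = true → ∀ s s' : State,
      (∀ x, binds L x = false → s'.nvar x = s.nvar x) → (∀ x, x ≠ acc → s'.rvar x = s.rvar x) →
      s'.narr = s.narr → s'.rarr = s.rarr → sumVal s' L e = sumVal s L e
  | [], _, s, s', hn, hr, ha, hra => by
    refine e.eval_congr (fun x hx => hr x ?_) (funext fun x => hn x rfl) ha hra
    rintro rfl; simp [he] at hx
  | (x, b) :: L, hL, s, s', hn, hr, ha, hra => by
    obtain ⟨h1, h2, h3, h4, h5⟩ := loopsOK_cons hL
    have hb : b.eval s' = b.eval s := b.eval_congr (fun y hy => hn y (by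
      by_contra hc
      simp only [binds, Bool.or_eq_false_iff, not_and_or, Bool.not_eq_false] at hc
      rcases hc with hc | hc
      · rw [Nat.eq_of_beq_eq_true hc, h2] at hy; cases hy
      · rw [h3 y hc] at hy; cases hy)) ha
    simp only [sumVal, hb]
    refine Finset.sum_congr rfl fun k _ => sumVal_congr he L h5 _ _ ?_ hr ha hra
    intro y hy
    by_cases hyx : y = x
    · simp [hyx]
    · simp only [State.setN_nvar, hyx, if_false]
      refine hn y ?_
      simp only [binds, hy, Bool.or_false]
      exact Bool.eq_false_iff.2 fun h => hyx (Nat.eq_of_beq_eq_true h)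

lemma modN_sumLoop (acc : ℕ) (e : RExp) (x : ℕ) :
    ∀ L : List (ℕ × NExp), (sumLoop acc L e).modN x = binds L x
  | [] => rfl
  | (y, b) :: L => by
    simp only [sumLoop, forLt, Prog.modN, modN_sumLoop acc e x L, binds]
    cases Nat.beq x y <;> cases binds L x <;> rfl

lemma modR_sumLoop (acc : ℕ) (e : RExp) (x : ℕ) :
    ∀ L : List (ℕ × NExp), (sumLoop acc L e).modR x = Nat.beq x acc
  | [] => rfl
  | (y, b) :: L => by
    simp [sumLoop, forLt, Prog.modR, modR_sumLoop acc e x L]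

lemma modNA_sumLoop (acc : ℕ) (e : RExp) (x : ℕ) :
    ∀ L : List (ℕ × NExp), (sumLoop acc L e).modNA x = false
  | [] => rfl
  | (y, b) :: L => by
    simp [sumLoop, forLt, Prog.modNA, modNA_sumLoop acc e x L]

lemma modRA_sumLoop (acc : ℕ) (e : RExp) (x : ℕ) :
    ∀ L : List (ℕ × NExp), (sumLoop acc L e).modRA x = false
  | [] => rfl
  | (y, b) :: L => by
    simp [sumLoop, forLt, Prog.modRA, modRA_sumLoop acc e x L]

/-- Every level of nesting has fewer than `R` rounds and multiplies the time by at most `R`. The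
remaining factor depends only on the syntax, not on the state. -/
lemma Runs.sumLoop {acc R : ℕ} {e : RExp} (he : e.reads acc = false) :
    ∀ (L : List (ℕ × NExp)), loopsOK L = true → ∀ s : State, (∀ p ∈ L, p.2.eval s + 1 ≤ R) →
      Runs (RealRAM.sumLoop acc L e) s (sumCost L e * R ^ L.length)
        (fun s' => s'.rvar acc = s.rvar acc + sumVal s L e)
  | [], _, s, _ => by
    refine (Runs.setReal (Q := fun s' => s'.rvar acc = s.rvar acc + e.eval s) ?_).mono ?_
      (fun _ _ h => h)
    · simp [RExp.eval]
    · simp [RExp.cost, sumCost]; omega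
  | (x, b) :: L, hL, s, hR => by
    obtain ⟨h1, h2, h3, h4, h5⟩ := loopsOK_cons hL
    have hbR : b.eval s + 1 ≤ R := hR (x, b) (by simp)
    have hR1 : 1 ≤ R := by omega
    have hfr : ∀ s', Frame (RealRAM.forLt x b (RealRAM.sumLoop acc L e)) s s' →
        (∀ y, y ≠ x → binds L y = false → s'.nvar y = s.nvar y) ∧
        (∀ y, y ≠ acc → s'.rvar y = s.rvar y) ∧ s'.narr = s.narr ∧ s'.rarr = s.rarr := by
      intro s' hF
      have hF' : Frame (RealRAM.sumLoop acc ((x, b) :: L) e) s s' := hF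
      refine ⟨fun y hy hy' => hF'.nvar y ?_, fun y hy => hF'.rvar y ?_,
        funext fun y => hF'.narr y (modNA_sumLoop ..), funext fun y => hF'.rarr y (modRA_sumLoop ..)⟩
      · rw [modN_sumLoop]
        simp only [binds, hy', Bool.or_false]
        exact Bool.eq_false_iff.2 fun h => hy (Nat.eq_of_beq_eq_true h)
      · rw [modR_sumLoop]
        exact Bool.eq_false_iff.2 fun h => hy (Nat.eq_of_beq_eq_true h)
    refine (Runs.forLt (x := x) (b := b) (P := RealRAM.sumLoop acc L e) (s := s) (b.eval s)
      (sumCost L e * R ^ L.length)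
      (fun k s' => s'.rvar acc = s.rvar acc + ∑ l ∈ Finset.range k, sumVal (s.setN x l) L e)
      ?_ ?_ ?_ ?_).mono ?_ ?_
    · rw [modN_sumLoop, h1]
    · intro s' hF
      obtain ⟨g1, -, g3, -⟩ := hfr s' hF
      refine b.eval_congr (fun y hy => g1 y ?_ ?_) g3
      · rintro rfl; simp [h2] at hy
      · by_contra hc
        rw [h3 y (by simpa using hc)] at hy; cases hy
    · simp
    · intro k hk s' hF hxk hI
      obtain ⟨g1, g2, g3, g4⟩ := hfr s' hF
      refine (Runs.sumLoop he L h5 s' ?_).mono le_rfl ?_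
      · intro p hp
        have : p.2.eval s' = p.2.eval s := p.2.eval_congr (fun y hy => g1 y ?_ ?_) g3
        · rw [this]; exact hR p (by simp [hp])
        · rintro rfl; rw [h4 p hp] at hy; cases hy
        · by_contra hc
          rw [not_reads_of_binds h5 p hp (by simpa using hc)] at hy; cases hy
      · intro s'' _ h
        simp only [State.setN_rvar]
        rw [h, hI, Finset.sum_range_succ, add_assoc]
        congr 2
        -- The inner loops start with leftovers of earlier rounds in their variables and with a
        -- partial sum in the accumulator.
        refine sumVal_congr he L h5 _ _ (fun y hy => ?_) (fun y hy => g2 y hy) g3 g4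
        by_cases hyx : y = x
        · subst hyx; simp [hxk]
        · simp [hyx, g1 y hyx hy]
    · have e1 : 1 ≤ R ^ L.length := Nat.one_le_pow _ _ hR1
      calc (b.eval s + 1) * (sumCost L e * R ^ L.length + b.cost + 8)
          ≤ R * (sumCost L e * R ^ L.length + (b.cost + 8) * R ^ L.length) := by
            have := Nat.le_mul_of_pos_right (b.cost + 8) e1
            exact Nat.mul_le_mul hbR (by omega)
        _ = sumCost ((x, b) :: L) e * R ^ ((x, b) :: L).length := by
            simp only [sumCost, List.length_cons, pow_succ]; ring
    · intro s' _ h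
      exact h

/-! ### Complex arithmetic -/

/-- Expressions with complex values: pairs of real expressions. -/
structure CExp : Type where
  re : RExp
  im : RExp

namespace CExp

/-- Entry of a complex array, stored as two real arrays. -/
def get (a b : ℕ) (i : NExp) : CExp := ⟨.get a i, .get b i⟩
/-- Entry of a complex array, with real and imaginary parts at different places of one array. -/
def get₂ (a : ℕ) (i j : NExp) : CExp := ⟨.get a i, .get a j⟩
/-- A natural number. -/
def ofNat (e : NExp) : CExp := ⟨.ofNat e, .ofNat (.const 0)⟩
/-- Product. -/
def mul (z w : CExp) : CExp :=
  ⟨.sub (.mul z.re w.re) (.mul z.im w.im), .add (.mul z.re w.im) (.mul z.im w.re)⟩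
/-- Difference. -/
def sub (z w : CExp) : CExp := ⟨.sub z.re w.re, .sub z.im w.im⟩
/-- Complex conjugate. -/
def conj (z : CExp) : CExp := ⟨z.re, .sub (.ofNat (.const 0)) z.im⟩

/-- Value. -/
noncomputable def ev (s : State) (z : CExp) : ℂ := ⟨z.re.eval s, z.im.eval s⟩

variable (s : State) (z w : CExp)

lemma eval_re : z.re.eval s = (z.ev s).re := rfl
lemma eval_im : z.im.eval s = (z.ev s).im := rfl
lemma ev_get (a b : ℕ) (i : NExp) : (get a b i).ev s = ⟨s.rarr a (i.eval s), s.rarr b (i.eval s)⟩ :=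
  rfl
lemma ev_get₂ (a : ℕ) (i j : NExp) :
    (get₂ a i j).ev s = ⟨s.rarr a (i.eval s), s.rarr a (j.eval s)⟩ := rfl
lemma ev_ofNat (e : NExp) : (ofNat e).ev s = (e.eval s : ℂ) := by
  apply Complex.ext <;> simp [ev, ofNat, RExp.eval, NExp.eval]
lemma ev_mul : (mul z w).ev s = z.ev s * w.ev s := by
  apply Complex.ext <;> simp [ev, mul, RExp.eval]
lemma ev_sub : (sub z w).ev s = z.ev s - w.ev s := by
  apply Complex.ext <;> simp [ev, sub, RExp.eval]
lemma ev_conj : (conj z).ev s = star (z.ev s) := by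
  apply Complex.ext <;> simp [ev, conj, RExp.eval, NExp.eval]

end CExp

end RealRAM

/-! ## Transfer matrices -/

namespace Transfer

open Matrix Finset
open scoped ComplexOrder

/-! ### Sesquilinear forms and domination -/

section Forms

variable {ι κ : Type*} [Fintype ι] [Fintype κ]

/-- The sesquilinear form of a matrix. -/
def qf (X : Matrix ι ι ℂ) (c c' : ι → ℂ) : ℂ := star c ⬝ᵥ (X *ᵥ c')

/-- The squared Euclidean norm. -/
noncomputable def nsq (c : ι → ℂ) : ℝ := ∑ i, ‖c i‖ ^ 2

lemma nsq_nonneg (c : ι → ℂ) : 0 ≤ nsq c := sum_nonneg fun _ _ => by positivity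

lemma qf_eq_sum (X : Matrix ι ι ℂ) (c c' : ι → ℂ) :
    qf X c c' = ∑ i, ∑ j, star (c i) * X i j * c' j := by
  simp only [qf, dotProduct, mulVec, Finset.mul_sum, Pi.star_apply, mul_assoc]

lemma qf_add (X Y : Matrix ι ι ℂ) (c c' : ι → ℂ) : qf (X + Y) c c' = qf X c c' + qf Y c c' := by
  simp [qf, add_mulVec, dotProduct_add]

lemma qf_sub (X Y : Matrix ι ι ℂ) (c c' : ι → ℂ) : qf (X - Y) c c' = qf X c c' - qf Y c c' := by
  simp [qf, sub_mulVec, dotProduct_sub]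

lemma qf_smul (z : ℂ) (X : Matrix ι ι ℂ) (c c' : ι → ℂ) : qf (z • X) c c' = z * qf X c c' := by
  simp [qf, smul_mulVec, dotProduct_smul]

lemma qf_sum {τ : Type*} (s : Finset τ) (X : τ → Matrix ι ι ℂ) (c c' : ι → ℂ) :
    qf (∑ t ∈ s, X t) c c' = ∑ t ∈ s, qf (X t) c c' := by
  simp [qf, sum_mulVec, dotProduct_sum]

lemma qf_conj (M N : Matrix κ ι ℂ) (X : Matrix κ κ ℂ) (c c' : ι → ℂ) :
    qf (Mᴴ * X * N) c c' = qf X (M *ᵥ c) (N *ᵥ c') := by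
  simp only [qf, star_mulVec, ← mulVec_mulVec, dotProduct_mulVec, vecMul_vecMul]

lemma qf_single [DecidableEq ι] (X : Matrix ι ι ℂ) (i j : ι) :
    qf X (Pi.single i 1) (Pi.single j 1) = X i j := by
  simp [qf]

lemma qf_one [DecidableEq ι] (c : ι → ℂ) : qf 1 c c = (nsq c : ℂ) := by
  simp only [qf, one_mulVec, dotProduct, nsq, Pi.star_apply, Complex.ofReal_sum]
  refine sum_congr rfl fun i _ => ?_
  rw [Complex.star_def, mul_comm, Complex.mul_conj, Complex.normSq_eq_norm_sq]

lemma qf_gram (B : Matrix κ ι ℂ) (c c' : ι → ℂ) :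
    qf (Bᴴ * B) c c' = ∑ w, star ((B *ᵥ c) w) * (B *ᵥ c') w := by
  classical
  have := qf_conj B B 1 c c'
  rw [Matrix.mul_one] at this
  rw [this]
  simp [qf, dotProduct]

lemma qf_gram_self (B : Matrix κ ι ℂ) (c : ι → ℂ) : qf (Bᴴ * B) c c = (nsq (B *ᵥ c) : ℂ) := by
  classical
  rw [qf_gram, ← qf_one, qf]
  simp [dotProduct]

/-- The form of `E` is bounded by `J` times that of `G`. -/
def Dom (E G : Matrix ι ι ℂ) (J : ℝ) : Prop :=
  ∀ c c' : ι → ℂ, ‖qf E c c'‖ ≤ J / 2 * ((qf G c c).re + (qf G c' c').re)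

lemma Dom.apply [DecidableEq ι] {E G : Matrix ι ι ℂ} {J : ℝ} (h : Dom E G J) (i j : ι) :
    ‖E i j‖ ≤ J / 2 * ((G i i).re + (G j j).re) := by
  simpa [qf_single] using h (Pi.single i 1) (Pi.single j 1)

lemma Dom.add {E E' G : Matrix ι ι ℂ} {J J' : ℝ} (h : Dom E G J) (h' : Dom E' G J') :
    Dom (E + E') G (J + J') := fun c c' => by
  rw [qf_add]
  refine (norm_add_le _ _).trans ((add_le_add (h c c') (h' c c')).trans (le_of_eq (by ring)))

/-- Sum `‖c i‖ * ‖c' j‖ ≤ (‖c i‖ ^ 2 + ‖c' j‖ ^ 2) / 2` over all pairs; each square occurs once for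
every value of the other index. -/
lemma dom_one_of_entries [DecidableEq ι] {X : Matrix ι ι ℂ} {η : ℝ} (h : ∀ i j, ‖X i j‖ ≤ η) :
    Dom X 1 (Fintype.card ι * η) := by
  intro c c'
  rw [qf_eq_sum, qf_one, qf_one, Complex.ofReal_re, Complex.ofReal_re]
  calc ‖∑ i, ∑ j, star (c i) * X i j * c' j‖
      ≤ ∑ i, ∑ j, η * (‖c i‖ ^ 2 / 2 + ‖c' j‖ ^ 2 / 2) := by
        refine (norm_sum_le _ _).trans (sum_le_sum fun i _ => (norm_sum_le _ _).trans
          (sum_le_sum fun j _ => ?_))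
        rw [norm_mul, norm_mul, norm_star]
        have h1 := h i j
        have h0 : 0 ≤ η := (norm_nonneg _).trans h1
        have h2 : ‖c i‖ * ‖X i j‖ * ‖c' j‖ ≤ η * (‖c i‖ * ‖c' j‖) := by
          have := mul_le_mul_of_nonneg_right h1 (mul_nonneg (norm_nonneg (c i)) (norm_nonneg (c' j)))
          linarith
        refine h2.trans (mul_le_mul_of_nonneg_left ?_ h0)
        nlinarith [sq_nonneg (‖c i‖ - ‖c' j‖)]
    _ = _ := by
        simp only [← Finset.mul_sum, sum_add_distrib, sum_const, card_univ, nsmul_eq_mul, nsq,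
          ← Finset.sum_div]
        ring

end Forms

variable {d D : ℕ}

/-- The tensor of one site: a matrix for each basis vector of the site. -/
abbrev Tensor (d D : ℕ) : Type := Fin d → Matrix (Fin D) (Fin D) ℂ

/-- Transport of an operator on the left bond of a site to its right bond. -/
noncomputable def xfer (a : Tensor d D) (X : Matrix (Fin D) (Fin D) ℂ) : Matrix (Fin D) (Fin D) ℂ :=
  ∑ i, (a i)ᴴ * X * a i

/-- Transport of a density matrix on the right bond of a site to its left bond. -/
noncomputable def dual (a : Tensor d D) (ρ : Matrix (Fin D) (Fin D) ℂ) :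
    Matrix (Fin D) (Fin D) ℂ := ∑ i, a i * ρ * (a i)ᴴ

/-- Transport across two sites, with an operator acting on these. -/
noncomputable def xfer2 (h : Matrix (Fin d × Fin d) (Fin d × Fin d) ℂ) (a b : Tensor d D)
    (X : Matrix (Fin D) (Fin D) ℂ) : Matrix (Fin D) (Fin D) ℂ :=
  ∑ p, ∑ q, h p q • ((a p.1 * b p.2)ᴴ * X * (a q.1 * b q.2))

/-- Left environment of the bond `k`. -/
noncomputable def env (A : ℕ → Tensor d D) (X : Matrix (Fin D) (Fin D) ℂ) :
    ℕ → Matrix (Fin D) (Fin D) ℂ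
  | 0 => X
  | k + 1 => xfer (A k) (env A X k)

/-- Left environment of the bond `j + 2 + l` with the operator `h` on the sites `j`, `j + 1`. -/
noncomputable def ener (A : ℕ → Tensor d D) (h : Matrix (Fin d × Fin d) (Fin d × Fin d) ℂ) (j : ℕ)
    (X : Matrix (Fin D) (Fin D) ℂ) : ℕ → Matrix (Fin D) (Fin D) ℂ
  | 0 => xfer2 h (A j) (A (j + 1)) (env A X j)
  | l + 1 => xfer (A (j + 2 + l)) (ener A h j X l)

/-- Operators move to the right and density matrices to the left by mutually adjoint maps, by
cyclicity of the trace. -/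
lemma trace_mul_xfer (a : Tensor d D) (ρ X : Matrix (Fin D) (Fin D) ℂ) :
    (ρ * xfer a X).trace = (dual a ρ * X).trace := by
  simp only [xfer, dual, Finset.mul_sum, Finset.sum_mul, trace_sum]
  refine sum_congr rfl fun i _ => ?_
  rw [← Matrix.mul_assoc, Matrix.trace_mul_comm]
  simp only [← Matrix.mul_assoc]

lemma xfer_add (a : Tensor d D) (X Y : Matrix (Fin D) (Fin D) ℂ) :
    xfer a (X + Y) = xfer a X + xfer a Y := by
  simp [xfer, Matrix.mul_add, Matrix.add_mul, sum_add_distrib]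

lemma xfer2_add (h : Matrix (Fin d × Fin d) (Fin d × Fin d) ℂ) (a b : Tensor d D)
    (X Y : Matrix (Fin D) (Fin D) ℂ) : xfer2 h a b (X + Y) = xfer2 h a b X + xfer2 h a b Y := by
  simp [xfer2, Matrix.mul_add, Matrix.add_mul, sum_add_distrib, smul_add]

lemma env_add (A : ℕ → Tensor d D) (X Y : Matrix (Fin D) (Fin D) ℂ) (k : ℕ) :
    env A (X + Y) k = env A X k + env A Y k := by
  induction k with
  | zero => rfl
  | succ k ih => simp only [env, ih, xfer_add]

lemma ener_add (A : ℕ → Tensor d D) (h : Matrix (Fin d × Fin d) (Fin d × Fin d) ℂ) (j : ℕ)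
    (X Y : Matrix (Fin D) (Fin D) ℂ) (l : ℕ) :
    ener A h j (X + Y) l = ener A h j X l + ener A h j Y l := by
  induction l with
  | zero => simp only [ener, env_add, xfer2_add]
  | succ k ih => simp only [ener, ih, xfer_add]

lemma posSemidef_xfer (a : Tensor d D) {X : Matrix (Fin D) (Fin D) ℂ} (hX : X.PosSemidef) :
    (xfer a X).PosSemidef :=
  Matrix.posSemidef_sum _ fun i _ => hX.conjTranspose_mul_mul_same (a i)

lemma posSemidef_dual (a : Tensor d D) {X : Matrix (Fin D) (Fin D) ℂ} (hX : X.PosSemidef) :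
    (dual a X).PosSemidef :=
  Matrix.posSemidef_sum _ fun i _ => hX.mul_mul_conjTranspose_same (a i)

lemma posSemidef_env (A : ℕ → Tensor d D) {X : Matrix (Fin D) (Fin D) ℂ} (hX : X.PosSemidef)
    (k : ℕ) : (env A X k).PosSemidef := by
  induction k with
  | zero => exact hX
  | succ k ih => exact posSemidef_xfer _ ih

lemma qf_xfer (a : Tensor d D) (X : Matrix (Fin D) (Fin D) ℂ) (c c' : Fin D → ℂ) :
    qf (xfer a X) c c' = ∑ i, qf X (a i *ᵥ c) (a i *ᵥ c') := by
  simp only [xfer, qf_sum, qf_conj]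

/-- Transport pulls the forms back along the matrices `a i` and adds them up. Domination concerns
all pairs of vectors, so it survives with the same constant and without any assumption on the
tensor. -/
lemma Dom.xfer (a : Tensor d D) {E G : Matrix (Fin D) (Fin D) ℂ} {J : ℝ} (h : Dom E G J) :
    Dom (xfer a E) (xfer a G) J := fun c c' => by
  simp only [qf_xfer, Complex.re_sum]
  rw [← sum_add_distrib, Finset.mul_sum]
  exact (norm_sum_le _ _).trans (sum_le_sum fun i _ => h _ _)

/-- The form of a two-site operator is bounded by `J`. -/
def FormBound (h : Matrix (Fin d × Fin d) (Fin d × Fin d) ℂ) (J : ℝ) : Prop :=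
  ∀ v w : Fin d × Fin d → ℂ, ‖qf h v w‖ ≤ J / 2 * (nsq v + nsq w)

open scoped MatrixOrder in
lemma exists_gram {G : Matrix (Fin D) (Fin D) ℂ} (hG : G.PosSemidef) :
    ∃ B : Matrix (Fin D) (Fin D) ℂ, G = Bᴴ * B :=
  CStarAlgebra.nonneg_iff_eq_star_mul_self.1 hG.nonneg

/-- With `G = Bᴴ * B`, every row `w` of `B` turns a bond vector into a vector on the two sites. Both
forms are sums over `w` of forms in these vectors, one with `h` and one with the identity, so the
bound for `h` applies row by row. -/
lemma Dom.xfer2 {h : Matrix (Fin d × Fin d) (Fin d × Fin d) ℂ} {J : ℝ} (hh : FormBound h J)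
    (a b : Tensor d D) {G : Matrix (Fin D) (Fin D) ℂ} (hG : G.PosSemidef) :
    Dom (Transfer.xfer2 h a b G) (Transfer.xfer b (Transfer.xfer a G)) J := by
  obtain ⟨B, rfl⟩ := exists_gram hG
  have key : ∀ c : Fin D → ℂ, (qf (Transfer.xfer b (Transfer.xfer a (Bᴴ * B))) c c).re =
      ∑ w, nsq fun p : Fin d × Fin d => (B *ᵥ (a p.1 *ᵥ (b p.2 *ᵥ c))) w := by
    intro c
    simp only [qf_xfer, qf_gram_self, Complex.re_sum, Complex.ofReal_re, nsq]
    rw [sum_comm, ← Fintype.sum_prod_type', sum_comm]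
  intro c c'
  have e : qf (Transfer.xfer2 h a b (Bᴴ * B)) c c' =
      ∑ w, qf h (fun p => (B *ᵥ (a p.1 *ᵥ (b p.2 *ᵥ c))) w)
        (fun p => (B *ᵥ (a p.1 *ᵥ (b p.2 *ᵥ c'))) w) := by
    simp only [Transfer.xfer2, qf_sum, qf_smul, qf_conj, qf_gram, ← mulVec_mulVec]
    simp only [qf_eq_sum, Finset.mul_sum]
    rw [sum_comm' (t' := univ) (s' := fun _ => univ) (by simp)]
    conv_lhs => enter [2, q]; rw [sum_comm]
    rw [sum_comm]
    refine sum_congr rfl fun w _ => ?_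
    rw [sum_comm]
    refine sum_congr rfl fun p _ => sum_congr rfl fun q _ => ?_
    ring
  rw [e, key, key, ← sum_add_distrib, Finset.mul_sum]
  exact (norm_sum_le _ _).trans (sum_le_sum fun w _ => hh _ _)

/-- This keeps all energy errors linear in the length: however far a local term is transported, it
costs at most `J` times the corresponding squared norm. -/
lemma Dom.ener {h : Matrix (Fin d × Fin d) (Fin d × Fin d) ℂ} {J : ℝ} (hh : FormBound h J)
    (A : ℕ → Tensor d D) (j : ℕ) {X : Matrix (Fin D) (Fin D) ℂ} (hX : X.PosSemidef) (l : ℕ) :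
    Dom (Transfer.ener A h j X l) (env A X (j + 2 + l)) J := by
  induction l with
  | zero => exact Dom.xfer2 hh _ _ (posSemidef_env A hX j)
  | succ l ih => exact ih.xfer _

/-- The left environments of approximate isometries stay close to the identity. -/
lemma dom_env_sub_one {A : ℕ → Tensor d D} {θ : ℝ} {n : ℕ} (hθ : 0 ≤ θ)
    (hA : ∀ k < n, Dom (Transfer.xfer (A k) 1 - 1) 1 θ) (hn : 2 * n * θ ≤ 1) :
    ∀ k ≤ n, Dom (env A 1 k - 1) 1 (2 * k * θ) := by
  intro k
  induction k with
  | zero => intro _ c c'; simp [env, qf]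
  | succ k ih =>
    intro hk
    have h1 := (ih (by omega)).xfer (A k)
    have h2 := hA k (by omega)
    have hkn : (k : ℝ) ≤ n := by exact_mod_cast (by omega : k ≤ n)
    have hkθ : 2 * k * θ ≤ 1 := by nlinarith
    -- The new error `2kθ(1 + θ) + θ` is at most `2(k + 1)θ` precisely because `2kθ ≤ 1`.
    have h3 : Dom (Transfer.xfer (A k) (env A 1 k - 1)) 1 (2 * k * θ * (1 + θ)) := by
      intro c c'
      refine (h1 c c').trans ?_
      have h4 : ∀ c : Fin D → ℂ, (qf (Transfer.xfer (A k) 1) c c).re ≤ (1 + θ) * (qf 1 c c).re := by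
        intro c
        have := h2 c c
        rw [qf_sub] at this
        have := (Complex.re_le_norm _).trans this
        simp only [Complex.sub_re] at this
        linarith
      have := h4 c
      have := h4 c'
      have : 0 ≤ 2 * k * θ / 2 := by positivity
      nlinarith
    have h5 : env A 1 (k + 1) - 1 =
        Transfer.xfer (A k) (env A 1 k - 1) + (Transfer.xfer (A k) 1 - 1) := by
      have : Transfer.xfer (A k) (env A 1 k) =
          Transfer.xfer (A k) (env A 1 k - 1) + Transfer.xfer (A k) 1 := by
        rw [← xfer_add]; simp
      rw [env, this]; abel
    intro c c'
    rw [h5]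
    refine ((h3.add h2) c c').trans ?_
    rw [qf_one, qf_one, Complex.ofReal_re, Complex.ofReal_re]
    have e1 := nsq_nonneg c
    have e2 := nsq_nonneg c'
    refine mul_le_mul_of_nonneg_right ?_ (by linarith)
    push_cast
    nlinarith

lemma norm_trace_mul_le {X Y : Matrix (Fin D) (Fin D) ℂ} {x y : ℝ} (hX : ∀ i j, ‖X i j‖ ≤ x)
    (hY : ∀ i j, ‖Y i j‖ ≤ y) : ‖(X * Y).trace‖ ≤ D ^ 2 * (x * y) := by
  simp only [trace, diag_apply, mul_apply]
  calc ‖∑ i, ∑ j, X i j * Y j i‖ ≤ ∑ i : Fin D, ∑ j : Fin D, x * y := by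
        refine (norm_sum_le _ _).trans (sum_le_sum fun i _ => (norm_sum_le _ _).trans
          (sum_le_sum fun j _ => ?_))
        rw [norm_mul]
        exact mul_le_mul (hX i j) (hY j i) (norm_nonneg _) ((norm_nonneg _).trans (hX i j))
    _ = _ := by simp; ring

end Transfer

/-! ### Stability of approximate canonical forms -/

namespace Transfer

open Matrix Finset
open scoped ComplexOrder

variable {d D : ℕ}

lemma re_qf_nonneg {X : Matrix (Fin D) (Fin D) ℂ} (hX : X.PosSemidef) (c : Fin D → ℂ) :
    0 ≤ (qf X c c).re := by
  obtain ⟨B, rfl⟩ := exists_gram hX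
  rw [qf_gram_self]
  exact nsq_nonneg (B *ᵥ c)

/-- The Cauchy–Schwarz inequality for a positive form, with the geometric mean replaced by the
arithmetic one. -/
lemma dom_self {X : Matrix (Fin D) (Fin D) ℂ} (hX : X.PosSemidef) : Dom X X 1 := by
  obtain ⟨B, rfl⟩ := exists_gram hX
  intro c c'
  rw [qf_gram_self, qf_gram_self, qf_gram, Complex.ofReal_re, Complex.ofReal_re, nsq, nsq,
    ← sum_add_distrib, Finset.mul_sum]
  refine (norm_sum_le _ _).trans (sum_le_sum fun w _ => ?_)
  rw [norm_mul, norm_star]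
  nlinarith [sq_nonneg (‖(B *ᵥ c) w‖ - ‖(B *ᵥ c') w‖)]

lemma Dom.mono {E G Q : Matrix (Fin D) (Fin D) ℂ} {J : ℝ} (h : Dom E G J) (hQ : Q.PosSemidef)
    (hJ : 0 ≤ J) : Dom E (G + Q) J := fun c c' => by
  refine (h c c').trans (mul_le_mul_of_nonneg_left ?_ (by linarith))
  rw [qf_add, qf_add, Complex.add_re, Complex.add_re]
  linarith [re_qf_nonneg hQ c, re_qf_nonneg hQ c']

lemma FormBound.nonneg {h : Matrix (Fin d × Fin d) (Fin d × Fin d) ℂ} {J : ℝ}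
    (hh : FormBound h J) (hd : 0 < d) : 0 ≤ J := by
  have := (norm_nonneg _).trans (hh (Pi.single (⟨0, hd⟩, ⟨0, hd⟩) 1) (Pi.single (⟨0, hd⟩, ⟨0, hd⟩) 1))
  have e : nsq (Pi.single ((⟨0, hd⟩, ⟨0, hd⟩) : Fin d × Fin d) (1 : ℂ)) = 1 := by
    have := qf_one (Pi.single ((⟨0, hd⟩, ⟨0, hd⟩) : Fin d × Fin d) (1 : ℂ))
    rw [qf_single, one_apply_eq] at this
    exact_mod_cast this.symm
  rw [e] at this
  linarith

lemma FormBound.apply {h : Matrix (Fin d × Fin d) (Fin d × Fin d) ℂ} {J : ℝ}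
    (hh : FormBound h J) (p q : Fin d × Fin d) : ‖h p q‖ ≤ J := by
  have := hh (Pi.single p 1) (Pi.single q 1)
  have e : ∀ p : Fin d × Fin d, nsq (Pi.single p (1 : ℂ)) = 1 := by
    intro p
    have := qf_one (Pi.single p (1 : ℂ))
    rw [qf_single, one_apply_eq] at this
    exact_mod_cast this.symm
  rw [e, e, qf_single] at this
  linarith

lemma norm_mul_apply_le {X Y : Matrix (Fin D) (Fin D) ℂ} {x y : ℝ} (hX : ∀ i j, ‖X i j‖ ≤ x)
    (hY : ∀ i j, ‖Y i j‖ ≤ y) (i j : Fin D) : ‖(X * Y) i j‖ ≤ D * (x * y) := by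
  rw [mul_apply]
  calc _ ≤ ∑ k : Fin D, x * y := (norm_sum_le _ _).trans (sum_le_sum fun k _ => by
        rw [norm_mul]
        exact mul_le_mul (hX i k) (hY k j) (norm_nonneg _) ((norm_nonneg _).trans (hX i k)))
    _ = _ := by simp

lemma norm_xfer2_apply_le {h : Matrix (Fin d × Fin d) (Fin d × Fin d) ℂ} {J x : ℝ}
    (hh : ∀ p q, ‖h p q‖ ≤ J) {a b : Tensor d D} (ha : ∀ i α β, ‖a i α β‖ ≤ 2)
    (hb : ∀ i α β, ‖b i α β‖ ≤ 2) {X : Matrix (Fin D) (Fin D) ℂ} (hX : ∀ i j, ‖X i j‖ ≤ x)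
    (γ γ' : Fin D) : ‖xfer2 h a b X γ γ'‖ ≤ 16 * d ^ 4 * D ^ 4 * J * x := by
  have h1 : ∀ p : Fin d × Fin d, ∀ i j, ‖(a p.1 * b p.2) i j‖ ≤ D * (2 * 2) :=
    fun p => norm_mul_apply_le (ha p.1) (hb p.2)
  have h2 : ∀ p : Fin d × Fin d, ∀ i j, ‖((a p.1 * b p.2)ᴴ) i j‖ ≤ D * (2 * 2) := fun p i j => by
    rw [conjTranspose_apply, norm_star]; exact h1 p j i
  simp only [xfer2, Matrix.sum_apply, Matrix.smul_apply, smul_eq_mul]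
  calc _ ≤ ∑ p : Fin d × Fin d, ∑ q : Fin d × Fin d,
        J * (D * ((D * (D * (2 * 2) * x)) * (D * (2 * 2)))) := by
        refine (norm_sum_le _ _).trans (sum_le_sum fun p _ => (norm_sum_le _ _).trans
          (sum_le_sum fun q _ => ?_))
        rw [norm_mul]
        exact mul_le_mul (hh p q)
          (norm_mul_apply_le (norm_mul_apply_le (h2 p) hX) (h1 q) γ γ') (norm_nonneg _)
          ((norm_nonneg _).trans (hh p q))
    _ = _ := by simp; ring

/-- The expectation value of a two-site operator predicted by the tensors of the two sites and
the density matrix to the right of them. -/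
noncomputable def weight (h : Matrix (Fin d × Fin d) (Fin d × Fin d) ℂ) (a b : Tensor d D)
    (ρ : Matrix (Fin D) (Fin D) ℂ) : ℝ := (ρ * xfer2 h a b 1).trace.re

/-- Density matrices that are consistent with the tensors up to an error of `δ`. -/
lemma norm_trace_sub_trace_le {A : ℕ → Tensor d D} {ρ : ℕ → Matrix (Fin D) (Fin D) ℂ} {η y : ℝ}
    {n s L : ℕ} (hs : s + L = n)
    (hρ : ∀ k < n, ∀ i j, ‖(ρ k - dual (A k) (ρ (k + 1))) i j‖ ≤ η)
    {Y : ℕ → Matrix (Fin D) (Fin D) ℂ} (hY : ∀ l < L, Y (l + 1) = xfer (A (s + l)) (Y l))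
    (hy : ∀ l ≤ L, ∀ i j, ‖Y l i j‖ ≤ y) :
    ∀ l ≤ L, ‖(ρ s * Y 0).trace - (ρ (s + l) * Y l).trace‖ ≤ l * (D ^ 2 * (η * y)) := by
  intro l
  induction l with
  | zero => simp
  | succ l ih =>
    intro hl
    have h1 := ih (by omega)
    -- Passing one site replaces `ρ (s + l)` by the transported `ρ (s + l + 1)`; the difference is
    -- the violation of consistency at that site.
    have h2 : (ρ (s + l) * Y l).trace - (ρ (s + (l + 1)) * Y (l + 1)).trace =
        ((ρ (s + l) - dual (A (s + l)) (ρ (s + l + 1))) * Y l).trace := by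
      rw [hY l (by omega), trace_mul_xfer, sub_mul, trace_sub]; rfl
    have h3 := norm_trace_mul_le (hρ (s + l) (by omega)) (hy l (by omega))
    rw [← h2] at h3
    calc _ ≤ _ := norm_sub_le_norm_sub_add_norm_sub _ ((ρ (s + l) * Y l).trace) _
      _ ≤ _ := add_le_add h1 h3
      _ = _ := by push_cast; ring

variable [NeZero D]

/-- The projection onto the first vector of a bond. -/
noncomputable def vac (D : ℕ) [NeZero D] : Matrix (Fin D) (Fin D) ℂ := Matrix.single 0 0 1

lemma vac_apply (i j : Fin D) : vac D i j = if i = 0 ∧ j = 0 then 1 else 0 := by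
  simp [vac, Matrix.single_apply, eq_comm]

lemma trace_vac_mul (X : Matrix (Fin D) (Fin D) ℂ) : (vac D * X).trace = X 0 0 := by
  simp only [trace, diag_apply, mul_apply, vac_apply]
  rw [Finset.sum_eq_single 0, Finset.sum_eq_single 0] <;> simp +contextual

lemma trace_mul_vac (X : Matrix (Fin D) (Fin D) ℂ) : (X * vac D).trace = X 0 0 := by
  rw [trace_mul_comm, trace_vac_mul]

lemma posSemidef_vac : (vac D).PosSemidef := by
  have : vac D = (vac D)ᴴ * vac D := by simp [vac]
  rw [this]
  exact posSemidef_conjTranspose_mul_self _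

lemma posSemidef_one_sub_vac : (1 - vac D).PosSemidef := by
  have : 1 - vac D = (1 - vac D)ᴴ * (1 - vac D) := by
    simp [vac, mul_sub, sub_mul]
  rw [this]
  exact posSemidef_conjTranspose_mul_self _

/-- Tensors that are approximate isometries, with approximately consistent density matrices. -/
structure Approx (n : ℕ) (A : ℕ → Tensor d D) (ρ : ℕ → Matrix (Fin D) (Fin D) ℂ) (η : ℝ) :
    Prop where
  iso : ∀ k < n, ∀ i j, ‖(xfer (A k) 1 - 1) i j‖ ≤ η
  compat : ∀ k < n, ∀ i j, ‖(ρ k - dual (A k) (ρ (k + 1))) i j‖ ≤ η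
  init : ‖ρ 0 0 0 - 1‖ ≤ η
  final : ∀ i j, ‖(ρ n - vac D) i j‖ ≤ η
  tensor_le : ∀ k < n, ∀ i α β, ‖A k i α β‖ ≤ 2
  density_le : ∀ k ≤ n, ∀ α β, ‖ρ k α β‖ ≤ 2

namespace Approx

variable {n : ℕ} {A : ℕ → Tensor d D} {ρ : ℕ → Matrix (Fin D) (Fin D) ℂ} {η : ℝ}

lemma nonneg (h : Approx n A ρ η) : 0 ≤ η := (norm_nonneg _).trans h.init

lemma dom_env (h : Approx n A ρ η) (hn : 2 * n * (D * η) ≤ 1) {k : ℕ} (hk : k ≤ n) :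
    Dom (env A 1 k - 1) 1 (2 * n * (D * η)) := by
  have h1 := dom_env_sub_one (A := A) (θ := D * η) (n := n)
    (mul_nonneg (Nat.cast_nonneg _) h.nonneg)
    (fun k hk => by simpa using dom_one_of_entries (h.iso k hk)) hn k hk
  intro c c'
  refine (h1 c c').trans ?_
  have hkn : (k : ℝ) ≤ n := by exact_mod_cast hk
  rw [qf_one, qf_one, Complex.ofReal_re, Complex.ofReal_re]
  have := nsq_nonneg c
  have := nsq_nonneg c'
  have := h.nonneg
  gcongr

lemma env_sub_apply (h : Approx n A ρ η) (hn : 2 * n * (D * η) ≤ 1) {k : ℕ} (hk : k ≤ n)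
    (i j : Fin D) : ‖(env A 1 k - 1) i j‖ ≤ 2 * n * (D * η) := by
  have := (h.dom_env hn hk).apply i j
  simp only [one_apply_eq, Complex.one_re] at this
  linarith

lemma env_diag_le (h : Approx n A ρ η) (hn : 2 * n * (D * η) ≤ 1) {k : ℕ} (hk : k ≤ n)
    (i : Fin D) : (env A 1 k i i).re ≤ 1 + 2 * n * (D * η) := by
  have := (Complex.re_le_norm _).trans (h.env_sub_apply hn hk i i)
  simp only [Matrix.sub_apply, one_apply_eq, Complex.sub_re, Complex.one_re] at this
  linarith

/-- An expectation value is moved to the right end, where the density matrix is almost the vacuum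
and the trace reads off a single entry. At most `n` violations of consistency and one of the final
condition add up to `n + 1` errors. -/
lemma telescope (h : Approx n A ρ η) {s L : ℕ} (hs : s + L = n) {y : ℝ}
    {Y : ℕ → Matrix (Fin D) (Fin D) ℂ} (hY : ∀ l < L, Y (l + 1) = xfer (A (s + l)) (Y l))
    (hy : ∀ l ≤ L, ∀ i j, ‖Y l i j‖ ≤ y) :
    ‖(ρ s * Y 0).trace - Y L 0 0‖ ≤ (n + 1) * (D ^ 2 * (η * y)) := by
  have h1 := norm_trace_sub_trace_le hs h.compat hY hy L le_rfl
  have h2 := norm_trace_mul_le h.final (hy L le_rfl)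
  rw [sub_mul, trace_sub, trace_vac_mul] at h2
  rw [hs] at h1
  have h0 : 0 ≤ y := (norm_nonneg _).trans (hy 0 (by omega) 0 0)
  have hL : (L : ℝ) ≤ n := by exact_mod_cast (by omega : L ≤ n)
  have h3 : (L : ℝ) * (D ^ 2 * (η * y)) ≤ n * (D ^ 2 * (η * y)) := by
    have := h.nonneg
    gcongr
  calc _ ≤ _ := norm_sub_le_norm_sub_add_norm_sub _ ((ρ n * Y L).trace) _
    _ ≤ _ := add_le_add h1 h2
    _ ≤ _ := by linarith

/-- Since `vac ≤ 1`, the environment started from the vacuum is dominated by the one started from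
the identity, which is close to the identity. -/
lemma norm_env_vac_le (h : Approx n A ρ η) (hn : 2 * n * (D * η) ≤ 1) {k : ℕ} (hk : k ≤ n)
    (i j : Fin D) : ‖env A (vac D) k i j‖ ≤ 2 := by
  have e : env A 1 k = env A (vac D) k + env A (1 - vac D) k := by
    rw [← env_add]; simp
  have h1 : Dom (env A (vac D) k) (env A 1 k) 1 := by
    rw [e]
    exact (dom_self (posSemidef_env A posSemidef_vac k)).mono
      (posSemidef_env A posSemidef_one_sub_vac k) zero_le_one
  have := h1.apply i j
  linarith [h.env_diag_le hn hk i, h.env_diag_le hn hk j]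

lemma one_le_mul_sq {n : ℕ} (hn0 : 1 ≤ n) : (1 : ℝ) ≤ n * (D : ℝ) ^ 2 := by
  have hD : (1 : ℝ) ≤ D := by exact_mod_cast Nat.one_le_iff_ne_zero.2 (NeZero.ne D)
  have : (1 : ℝ) ≤ n := by exact_mod_cast hn0
  nlinarith

/-- The squared norm of the state. -/
lemma abs_norm_sub_one_le (h : Approx n A ρ η) (hn0 : 1 ≤ n) (hn : 2 * n * (D * η) ≤ 1) :
    |(env A (vac D) n 0 0).re - 1| ≤ 5 * n * D ^ 2 * η := by
  have h1 := h.telescope (s := 0) (L := n) (by simp) (y := 2) (Y := env A (vac D))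
    (fun l _ => by simp [env]) (fun l hl => h.norm_env_vac_le hn hl)
  rw [show env A (vac D) 0 = vac D from rfl, trace_mul_vac] at h1
  have h2 := h.init
  have h3 : ‖env A (vac D) n 0 0 - 1‖ ≤ (n + 1) * (D ^ 2 * (η * 2)) + η := by
    calc _ ≤ _ := norm_sub_le_norm_sub_add_norm_sub _ (ρ 0 0 0) _
      _ ≤ _ := add_le_add (by rwa [norm_sub_rev]) h2
  have h4 := (Complex.abs_re_le_norm _).trans h3
  simp only [Complex.sub_re, Complex.one_re] at h4
  refine h4.trans ?_
  have h5 := one_le_mul_sq (D := D) hn0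
  have h6 : (1 : ℝ) ≤ n := by exact_mod_cast hn0
  have h7 : (n + 1 : ℝ) * (D ^ 2 * (η * 2)) ≤ (2 * n) * (D ^ 2 * (η * 2)) := by
    have := h.nonneg
    gcongr
    linarith
  nlinarith [h.nonneg]

/-- The energy of one bond of the state is predicted by the local tensors. -/
lemma abs_weight_sub_le (h : Approx n A ρ η) (hn : 2 * n * (D * η) ≤ 1) (hd : 0 < d)
    {H : Matrix (Fin d × Fin d) (Fin d × Fin d) ℂ} {J : ℝ} (hH : FormBound H J) {j l : ℕ}
    (hj : j + 2 + l = n) :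
    |weight H (A j) (A (j + 1)) (ρ (j + 2)) - (ener A H j (vac D) l 0 0).re| ≤
      75 * n * d ^ 4 * D ^ 7 * η * J := by
  have hn0 : 1 ≤ n := by omega
  have hJ := hH.nonneg hd
  have hη := h.nonneg
  -- Domination bounds the entries by `J` times diagonal entries of the environment of the identity,
  -- which are at most `2`.
  have hent : ∀ l' ≤ l, ∀ i k, ‖ener A H j 1 l' i k‖ ≤ 2 * J := by
    intro l' hl' i k
    have h1 := (Dom.ener hH A j PosSemidef.one l').apply i k
    have h2 := h.env_diag_le hn (k := j + 2 + l') (by omega) i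
    have h3 := h.env_diag_le hn (k := j + 2 + l') (by omega) k
    nlinarith
  have h1 := h.telescope hj (y := 2 * J) (Y := ener A H j 1) (fun l _ => rfl) hent
  -- The prediction takes the sites before `j` for exact isometries, that is, it replaces their
  -- environment by `1`.
  have h2 : ‖(ρ (j + 2) * xfer2 H (A j) (A (j + 1)) 1).trace -
      (ρ (j + 2) * ener A H j 1 0).trace‖ ≤ D ^ 2 * (2 * (16 * d ^ 4 * D ^ 4 * J *
        (2 * n * (D * η)))) := by
    have e : xfer2 H (A j) (A (j + 1)) 1 - ener A H j 1 0 =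
        xfer2 H (A j) (A (j + 1)) (1 - env A 1 j) := by
      rw [ener, sub_eq_iff_eq_add, ← xfer2_add]; simp
    rw [← trace_sub, ← mul_sub, e]
    refine norm_trace_mul_le (h.density_le (j + 2) (by omega)) ?_
    refine norm_xfer2_apply_le hH.apply (h.tensor_le j (by omega)) (h.tensor_le (j + 1) (by omega)) ?_
    intro i k
    have := h.env_sub_apply hn (k := j) (by omega) i k
    rwa [Matrix.sub_apply, norm_sub_rev] at this
  -- The chain starts from the vacuum, not from the identity. The difference is dominated by `J`
  -- times `env A 1 n 0 0 - env A (vac D) n 0 0`; the first term is at most `1 + 2nDη` and the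
  -- second at least `1 - 5nD²η`, which gives the `7`.
  have h3 : ‖ener A H j 1 l 0 0 - ener A H j (vac D) l 0 0‖ ≤ J * (7 * n * D ^ 2 * η) := by
    have e1 : ener A H j 1 l = ener A H j (vac D) l + ener A H j (1 - vac D) l := by
      rw [← ener_add]; simp
    have e2 : env A 1 n = env A (vac D) n + env A (1 - vac D) n := by
      rw [← env_add]; simp
    have h4 := (Dom.ener hH A j (posSemidef_one_sub_vac (D := D)) l).apply 0 0
    rw [hj] at h4
    have h5 := h.env_diag_le hn le_rfl 0
    have h6 := abs_le.1 (h.abs_norm_sub_one_le hn0 hn)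
    rw [e2, Matrix.add_apply, Complex.add_re] at h5
    rw [e1, Matrix.add_apply, add_sub_cancel_left]
    have hD1 : (1 : ℝ) ≤ D := by exact_mod_cast Nat.one_le_iff_ne_zero.2 (NeZero.ne D)
    have h7 : 2 * (n : ℝ) * (D * η) ≤ 2 * n * (D ^ 2 * η) := by
      gcongr
      nlinarith
    calc _ ≤ _ := h4
      _ = J * (env A (1 - vac D) n 0 0).re := by ring
      _ ≤ _ := by
        gcongr
        linarith [h6.1]
  have h4 : ‖(ρ (j + 2) * xfer2 H (A j) (A (j + 1)) 1).trace - ener A H j (vac D) l 0 0‖ ≤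
      D ^ 2 * (2 * (16 * d ^ 4 * D ^ 4 * J * (2 * n * (D * η)))) +
      ((n + 1) * (D ^ 2 * (η * (2 * J))) + J * (7 * n * D ^ 2 * η)) := by
    calc _ ≤ _ := norm_sub_le_norm_sub_add_norm_sub _ ((ρ (j + 2) * ener A H j 1 0).trace) _
      _ ≤ _ := add_le_add h2 ((norm_sub_le_norm_sub_add_norm_sub _ (ener A H j 1 l 0 0) _).trans
          (add_le_add h1 h3))
  have h5 := (Complex.abs_re_le_norm _).trans h4
  rw [Complex.sub_re] at h5
  refine h5.trans ?_
  have hn1 : (1 : ℝ) ≤ n := by exact_mod_cast hn0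
  have hD1 : (1 : ℝ) ≤ D := by exact_mod_cast Nat.one_le_iff_ne_zero.2 (NeZero.ne D)
  have hd1 : (1 : ℝ) ≤ d := by exact_mod_cast hd
  -- The three contributions are 64, 4 and 7 times the same monomial, 75 in all.
  have e1 : (D : ℝ) ^ 2 * (2 * (16 * d ^ 4 * D ^ 4 * J * (2 * n * (D * η)))) =
      64 * (n * d ^ 4 * D ^ 7 * η * J) := by ring
  have e2 : (n + 1 : ℝ) * (D ^ 2 * (η * (2 * J))) ≤ 4 * (n * d ^ 4 * D ^ 7 * η * J) := by
    calc (n + 1 : ℝ) * (D ^ 2 * (η * (2 * J))) ≤ (2 * n) * (D ^ 2 * (η * (2 * J))) := by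
          gcongr; linarith
      _ = 4 * (n * 1 * D ^ 2 * η * J) := by ring
      _ ≤ _ := by
        gcongr
        · exact one_le_pow₀ hd1
        · norm_num
  have e3 : J * (7 * n * D ^ 2 * η) ≤ 7 * (n * d ^ 4 * D ^ 7 * η * J) := by
    calc J * (7 * n * D ^ 2 * η) = 7 * (n * 1 * D ^ 2 * η * J) := by ring
      _ ≤ _ := by
        gcongr
        · exact one_le_pow₀ hd1
        · norm_num
  linarith

end Approx

end Transfer

/-! ### Environments as sums over basis vectors; norm and energy of a chain -/

namespace Transfer

open Matrix Finset
open scoped ComplexOrder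

variable {d D : ℕ}

/-- The product of the tensors of the first `k` sites, for given basis vectors of these. -/
noncomputable def amp (A : ℕ → Tensor d D) : (k : ℕ) → (Fin k → Fin d) → Matrix (Fin D) (Fin D) ℂ
  | 0, _ => 1
  | k + 1, i => amp A k (Fin.init i) * A k (i (Fin.last k))

lemma sum_snoc {M : Type*} [AddCommMonoid M] {k : ℕ} {τ : Type*} [Fintype τ]
    (f : (Fin (k + 1) → τ) → M) : ∑ i, f i = ∑ i : Fin k → τ, ∑ a, f (Fin.snoc i a) := by
  classical
  rw [← Fintype.sum_prod_type', ← (Equiv.prodComm _ _).sum_comp,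
    ← (Fin.snocEquiv fun _ => τ).sum_comp]
  rfl

lemma amp_snoc (A : ℕ → Tensor d D) {k : ℕ} (i : Fin k → Fin d) (a : Fin d) :
    amp A (k + 1) (Fin.snoc (α := fun _ => Fin d) i a) = amp A k i * A k a := by
  simp [amp]

lemma env_eq_sum (A : ℕ → Tensor d D) (X : Matrix (Fin D) (Fin D) ℂ) (k : ℕ) :
    env A X k = ∑ i, (amp A k i)ᴴ * X * amp A k i := by
  induction k with
  | zero => simp [env, amp]
  | succ k ih =>
    rw [sum_snoc, env, xfer, ih, sum_comm]
    refine sum_congr rfl fun a _ => ?_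
    rw [Finset.mul_sum, Finset.sum_mul]
    refine sum_congr rfl fun i _ => ?_
    rw [amp_snoc, conjTranspose_mul]
    simp only [Matrix.mul_assoc]

/-- Matrix entries of an operator on the sites `j` and `j + 1` of a chain of `k` sites. -/
def bondOp (h : Matrix (Fin d × Fin d) (Fin d × Fin d) ℂ) (j : ℕ) {k : ℕ} (hj : j + 1 < k)
    (x y : Fin k → Fin d) : ℂ :=
  if ∀ t : Fin k, (t : ℕ) ≠ j → (t : ℕ) ≠ j + 1 → x t = y t then
    h (x ⟨j, by omega⟩, x ⟨j + 1, hj⟩) (y ⟨j, by omega⟩, y ⟨j + 1, hj⟩)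
  else 0

lemma snoc_mk_lt {τ : Type*} {k t : ℕ} (x : Fin k → τ) (a : τ) (ht : t < k) :
    Fin.snoc (α := fun _ => τ) x a ⟨t, by omega⟩ = x ⟨t, ht⟩ :=
  Fin.snoc_castSucc (α := fun _ => τ) a x ⟨t, ht⟩

lemma snoc_mk_self {τ : Type*} {k : ℕ} (x : Fin k → τ) (a : τ) :
    Fin.snoc (α := fun _ => τ) x a ⟨k, by omega⟩ = a :=
  Fin.snoc_last (α := fun _ => τ) a x

lemma bondOp_snoc (h : Matrix (Fin d × Fin d) (Fin d × Fin d) ℂ) (j : ℕ) {k : ℕ} (hj : j + 1 < k)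
    (x y : Fin k → Fin d) (a b : Fin d) :
    bondOp h j (k := k + 1) (by omega) (Fin.snoc (α := fun _ => Fin d) x a)
      (Fin.snoc (α := fun _ => Fin d) y b) = if a = b then bondOp h j hj x y else 0 := by
  simp only [bondOp, Fin.forall_fin_succ', Fin.snoc_castSucc, Fin.snoc_last, Fin.val_castSucc,
    Fin.val_last, snoc_mk_lt _ _ hj, snoc_mk_lt _ _ (show j < k by omega)]
  have h1 : k ≠ j := by omega
  have h2 : k ≠ j + 1 := by omega
  by_cases hab : a = b <;> simp [hab, h1, h2]

lemma bondOp_snoc_snoc (h : Matrix (Fin d × Fin d) (Fin d × Fin d) ℂ) (j : ℕ)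
    (x y : Fin j → Fin d) (a b a' b' : Fin d) :
    bondOp h j (k := j + 2) (by omega)
      (Fin.snoc (α := fun _ => Fin d) (Fin.snoc (α := fun _ => Fin d) x a : Fin (j + 1) → Fin d) b)
      (Fin.snoc (α := fun _ => Fin d) (Fin.snoc (α := fun _ => Fin d) y a' : Fin (j + 1) → Fin d) b')
      = if x = y then h (a, b) (a', b') else 0 := by
  simp only [bondOp, Fin.forall_fin_succ', Fin.snoc_castSucc, Fin.snoc_last, Fin.val_castSucc,
    Fin.val_last, snoc_mk_lt _ _ (show j < j + 1 by omega), snoc_mk_self]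
  have e : (∀ t : Fin j, (t : ℕ) ≠ j → (t : ℕ) ≠ j + 1 → x t = y t) ↔ x = y :=
    ⟨fun hxy => funext fun t => hxy t (by omega) (by omega), fun hxy t _ _ => by rw [hxy]⟩
  simp [e]

/-- Induction on the number of sites to the right of the bond, on each of which the operator is the
identity. In the base case the first `j` sites are summed diagonally and give the environment. -/
lemma ener_eq_sum (A : ℕ → Tensor d D) (h : Matrix (Fin d × Fin d) (Fin d × Fin d) ℂ) (j : ℕ)
    (X : Matrix (Fin D) (Fin D) ℂ) (l : ℕ) :
    ener A h j X l = ∑ x, ∑ y, bondOp h j (k := j + 2 + l) (by omega) x y •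
      ((amp A (j + 2 + l) x)ᴴ * X * amp A (j + 2 + l) y) := by
  induction l with
  | zero =>
    simp only [Nat.add_zero]
    rw [sum_snoc, sum_snoc]
    have e1 : ∀ (x : Fin j → Fin d) (a b : Fin d), (∑ y, bondOp h j (k := j + 2) (by omega)
        (Fin.snoc (α := fun _ => Fin d) (Fin.snoc (α := fun _ => Fin d) x a : Fin (j + 1) → Fin d) b)
        y • ((amp A (j + 2) (Fin.snoc (α := fun _ => Fin d)
          (Fin.snoc (α := fun _ => Fin d) x a : Fin (j + 1) → Fin d) b))ᴴ * X * amp A (j + 2) y)) =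
        ∑ a', ∑ b', h (a, b) (a', b') •
          ((amp A j x * A j a * A (j + 1) b)ᴴ * X * (amp A j x * A j a' * A (j + 1) b')) := by
      intro x a b
      rw [sum_snoc, sum_snoc]
      simp only [bondOp_snoc_snoc, amp_snoc, ite_smul, zero_smul]
      rw [sum_comm]
      refine sum_congr rfl fun a' _ => ?_
      rw [sum_comm]
      refine sum_congr rfl fun b' _ => ?_
      simp
    simp only [e1]
    rw [ener, env_eq_sum, xfer2, Fintype.sum_prod_type]
    conv_rhs => rw [sum_comm]
    refine sum_congr rfl fun a _ => ?_
    conv_rhs => rw [sum_comm]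
    refine sum_congr rfl fun b _ => ?_
    rw [Fintype.sum_prod_type]
    conv_rhs => rw [sum_comm]
    refine sum_congr rfl fun a' _ => ?_
    conv_rhs => rw [sum_comm]
    refine sum_congr rfl fun b' _ => ?_
    rw [Finset.mul_sum, Finset.sum_mul, Finset.smul_sum]
    refine sum_congr rfl fun x _ => ?_
    simp only [conjTranspose_mul, Matrix.mul_assoc]
  | succ l ih =>
    change _ = ∑ x : Fin (j + 2 + l + 1) → Fin d, ∑ y : Fin (j + 2 + l + 1) → Fin d,
      bondOp h j (k := j + 2 + l + 1) (by omega) x y •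
        ((amp A (j + 2 + l + 1) x)ᴴ * X * amp A (j + 2 + l + 1) y)
    have e1 : ∀ (x : Fin (j + 2 + l) → Fin d) (a : Fin d),
        (∑ y, bondOp h j (k := j + 2 + l + 1) (by omega) (Fin.snoc (α := fun _ => Fin d) x a) y •
        ((amp A (j + 2 + l + 1) (Fin.snoc (α := fun _ => Fin d) x a))ᴴ * X *
          amp A (j + 2 + l + 1) y)) =
        ∑ y, bondOp h j (k := j + 2 + l) (by omega) x y •
          ((amp A (j + 2 + l) x * A (j + 2 + l) a)ᴴ * X *
            (amp A (j + 2 + l) y * A (j + 2 + l) a)) := by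
      intro x a
      rw [sum_snoc]
      refine sum_congr rfl fun y _ => ?_
      simp only [bondOp_snoc h j (show j + 1 < j + 2 + l by omega), amp_snoc, ite_smul, zero_smul]
      simp
    rw [ener, ih, xfer, sum_snoc]
    simp only [e1]
    conv_rhs => rw [sum_comm]
    refine sum_congr rfl fun a _ => ?_
    rw [Finset.mul_sum, Finset.sum_mul]
    refine sum_congr rfl fun x _ => ?_
    rw [Finset.mul_sum, Finset.sum_mul]
    refine sum_congr rfl fun y _ => ?_
    rw [Matrix.mul_smul, Matrix.smul_mul]
    simp only [conjTranspose_mul, Matrix.mul_assoc]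

variable [NeZero D] {m : ℕ}

lemma conjTranspose_mul_vac_mul (M N : Matrix (Fin D) (Fin D) ℂ) :
    (Mᴴ * vac D * N) 0 0 = star (M 0 0) * N 0 0 := by
  simp only [mul_apply, vac_apply, conjTranspose_apply]
  rw [Finset.sum_eq_single 0, Finset.sum_eq_single 0] <;> simp +contextual

/-- The state of a chain described by the tensors of its sites. -/
noncomputable def state (m : ℕ) (A : ℕ → Tensor d D) : ChainState m d :=
  fun i => amp A (m + 2) i 0 0

lemma state_dotProduct_self (A : ℕ → Tensor d D) :
    star (state m A) ⬝ᵥ state m A = env A (vac D) (m + 2) 0 0 := by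
  rw [env_eq_sum, Matrix.sum_apply]
  simp only [conjTranspose_mul_vac_mul]
  rfl

lemma termOnChain_apply (H : NNHamiltonian m d) (j : Fin (m + 1)) (x y : Fin (m + 2) → Fin d) :
    H.termOnChain j x y = bondOp (H.term j) j (k := m + 2) (by omega) x y := by
  simp only [NNHamiltonian.termOnChain, bondOp, of_apply]
  have e : (∀ k, k ≠ j.castSucc → k ≠ j.succ → x k = y k) ↔
      (∀ t : Fin (m + 2), (t : ℕ) ≠ j → (t : ℕ) ≠ j + 1 → x t = y t) := by
    refine forall_congr' fun t => ?_
    simp [Fin.ext_iff]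
  simp only [e]
  rfl

lemma energy_eq_sum (H : NNHamiltonian m d) (ψ : ChainState m d) :
    H.energy ψ = ∑ j, (∑ x, ∑ y, H.termOnChain j x y * (star (ψ x) * ψ y)).re := by
  rw [NNHamiltonian.energy, NNHamiltonian.toMatrix, sum_mulVec, dotProduct_sum, Complex.re_sum]
  refine sum_congr rfl fun j _ => ?_
  simp only [dotProduct, mulVec, Finset.mul_sum, Pi.star_apply]
  congr 1
  refine sum_congr rfl fun x _ => sum_congr rfl fun y _ => ?_
  ring

lemma energy_smul (H : NNHamiltonian m d) (ψ : ChainState m d) (z : ℂ) :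
    H.energy (z • ψ) = ‖z‖ ^ 2 * H.energy ψ := by
  simp only [NNHamiltonian.energy, mulVec_smul, dotProduct_smul, star_smul, smul_dotProduct,
    smul_eq_mul]
  rw [← mul_assoc, Complex.star_def, Complex.mul_conj, Complex.normSq_eq_norm_sq,
    Complex.re_ofReal_mul]

lemma energy_state (H : NNHamiltonian m d) (A : ℕ → Tensor d D) :
    H.energy (state m A) = ∑ j : Fin (m + 1), (ener A (H.term j) j (vac D) (m - j) 0 0).re := by
  rw [energy_eq_sum]
  refine sum_congr rfl fun j _ => ?_
  -- The lengths `j + 2 + (m - j)` and `m + 2` agree only propositionally; a variable length avoids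
  -- casts between the types of basis vectors.
  have key : ∀ k, ∀ hk : (j : ℕ) + 2 + (m - j) = k,
      ener A (H.term j) j (vac D) (m - j) 0 0 = ∑ x, ∑ y,
        bondOp (H.term j) j (k := k) (by omega) x y * (star (amp A k x 0 0) * amp A k y 0 0) := by
    rintro k rfl
    rw [ener_eq_sum]
    simp only [Matrix.sum_apply, Matrix.smul_apply, conjTranspose_mul_vac_mul, smul_eq_mul]
  rw [key (m + 2) (by omega)]
  simp only [termOnChain_apply]
  rfl

/-- Cauchy–Schwarz, the operator norm bound, and `2xy ≤ x² + y²`. Only this form of the bound is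
used for the local terms from here on. -/
lemma formBound_of_termsBoundedBy {H : NNHamiltonian m d} {J : ℝ} (hJ : H.TermsBoundedBy J)
    (j : Fin (m + 1)) : FormBound (H.term j) J := by
  intro v w
  have h0 : 0 ≤ J := (norm_nonneg _).trans (hJ j)
  have e : qf (H.term j) v w = inner ℂ (WithLp.toLp 2 v : EuclideanSpace ℂ (Fin d × Fin d))
      (Matrix.toEuclideanCLM (n := Fin d × Fin d) (𝕜 := ℂ) (H.term j) (WithLp.toLp 2 w)) := by
    rw [Matrix.toEuclideanCLM_toLp, EuclideanSpace.inner_toLp_toLp, qf, dotProduct_comm]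
  have hn : ∀ v : Fin d × Fin d → ℂ, ‖(WithLp.toLp 2 v : EuclideanSpace ℂ (Fin d × Fin d))‖ ^ 2 =
      nsq v := fun v => by rw [EuclideanSpace.norm_sq_eq]; rfl
  rw [e, ← hn, ← hn]
  refine (norm_inner_le_norm _ _).trans ?_
  have h1 := (Matrix.toEuclideanCLM (n := Fin d × Fin d) (𝕜 := ℂ) (H.term j)).le_of_opNorm_le
    (hJ j) (WithLp.toLp 2 w)
  have h2 := norm_nonneg (WithLp.toLp 2 v : EuclideanSpace ℂ (Fin d × Fin d))
  have h3 := norm_nonneg (WithLp.toLp 2 w : EuclideanSpace ℂ (Fin d × Fin d))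
  calc _ ≤ ‖(WithLp.toLp 2 v : EuclideanSpace ℂ (Fin d × Fin d))‖ *
        (J * ‖(WithLp.toLp 2 w : EuclideanSpace ℂ (Fin d × Fin d))‖) := by gcongr
    _ ≤ _ := by
      nlinarith [sq_nonneg (‖(WithLp.toLp 2 v : EuclideanSpace ℂ (Fin d × Fin d))‖ -
        ‖(WithLp.toLp 2 w : EuclideanSpace ℂ (Fin d × Fin d))‖)]

/-- The energy per bond of a state is at most `J` times its squared norm. -/
lemma abs_energy_state_le {H : NNHamiltonian m d} {J : ℝ} (hJ : H.TermsBoundedBy J)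
    (A : ℕ → Tensor d D) :
    |H.energy (state m A)| ≤ (m + 1) * (J * (env A (vac D) (m + 2) 0 0).re) := by
  rw [energy_state]
  refine (abs_sum_le_sum_abs _ _).trans ?_
  calc _ ≤ ∑ j : Fin (m + 1), J * (env A (vac D) (m + 2) 0 0).re := by
        refine sum_le_sum fun j _ => (Complex.abs_re_le_norm _).trans ?_
        have := (Dom.ener (formBound_of_termsBoundedBy hJ j) A j posSemidef_vac (m - j)).apply 0 0
        rw [show (j : ℕ) + 2 + (m - j) = m + 2 by omega] at this
        linarith
    _ = _ := by simp

end Transfer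

/-! ### Canonical form of a matrix product state -/

namespace Transfer

open Matrix Finset
open scoped ComplexOrder

variable {d D : ℕ}

/-- Sum over the paths through a product of matrices. -/
lemma amp_apply_eq_sum [NeZero D] (A : ℕ → Tensor d D) (m : ℕ) (i : Fin (m + 1) → Fin d)
    (β : Fin D) :
    amp A (m + 1) i 0 β = ∑ α : Fin (m + 1) → Fin D, if α (Fin.last m) = β then
      A 0 (i 0) 0 (α 0) * ∏ j : Fin m, A (j + 1) (i j.succ) (α j.castSucc) (α j.succ) else 0 := by
  induction m generalizing β with
  | zero =>
    rw [← (Equiv.funUnique (Fin 1) (Fin D)).symm.sum_comp]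
    simp [amp]
  | succ m ih =>
    rw [amp, mul_apply, sum_snoc]
    simp only [ih, Finset.sum_mul]
    rw [sum_comm]
    refine sum_congr rfl fun α _ => ?_
    rw [Finset.sum_eq_single (α (Fin.last m)) (by
      intro b _ hb
      rw [if_neg (Ne.symm hb), zero_mul]) (by simp)]
    rw [Finset.sum_eq_single β (by
      intro b _ hb
      simp [hb]) (by simp)]
    have h0 : ∀ a : Fin D, (Fin.snoc (α := fun _ => Fin D) α a : Fin (m + 2) → Fin D) 0 = α 0 :=
      fun a => Fin.snoc_castSucc (α := fun _ => Fin D) a α 0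
    have h1 : ∀ (a : Fin D) (j : Fin m),
        (Fin.snoc (α := fun _ => Fin D) α a : Fin (m + 2) → Fin D) j.castSucc.succ = α j.succ :=
      fun a j => Fin.snoc_castSucc (α := fun _ => Fin D) a α j.succ
    simp only [if_true, Fin.snoc_last, Fin.prod_univ_castSucc, Fin.snoc_castSucc, h0, h1,
      Fin.val_castSucc, Fin.val_last, Fin.succ_last, mul_assoc]
    rfl

lemma state_apply_eq_sum [NeZero D] (A : ℕ → Tensor d D) (m : ℕ) (i : Fin (m + 2) → Fin d) :
    state m A i = ∑ α : Fin (m + 1) → Fin D, A 0 (i 0) 0 (α 0) *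
      (∏ j : Fin m, A (j + 1) (i j.succ.castSucc) (α j.castSucc) (α j.succ)) *
      A (m + 1) (i (Fin.last (m + 1))) (α (Fin.last m)) 0 := by
  rw [state, amp, mul_apply]
  simp only [amp_apply_eq_sum, Finset.sum_mul]
  rw [sum_comm]
  refine sum_congr rfl fun α _ => ?_
  rw [Finset.sum_eq_single (α (Fin.last m)) (by
    intro b _ hb
    rw [if_neg (Ne.symm hb), zero_mul]) (by simp), if_pos rfl]
  rfl

/-- The tensors of a matrix product state, the weights of the bonds being absorbed. -/
noncomputable def absorbed {m : ℕ} (ψ : MPS m d D) (k : ℕ) : Tensor d D := fun i =>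
  of fun α β =>
    -- The end tensors become square: the first occupies row `0`, and the last is repeated in every
    -- column, of which only column `0` enters the state. Each bond weight goes to the site on its
    -- right.
    if k = 0 then (if (α : ℕ) = 0 then ψ.first i β else 0)
    else if h : k - 1 < m then (ψ.lam ⟨k - 1, by omega⟩ α : ℂ) * ψ.bulk ⟨k - 1, h⟩ i α β
    else (ψ.lam (Fin.last m) α : ℂ) * ψ.last i α

lemma state_absorbed [NeZero D] {m : ℕ} (ψ : MPS m d D) : state m (absorbed ψ) = ψ.toState := by
  funext i
  rw [state_apply_eq_sum, MPS.toState]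
  refine sum_congr rfl fun α _ => ?_
  have h1 : ∀ j : Fin m, absorbed ψ (j + 1) (i j.succ.castSucc) (α j.castSucc) (α j.succ) =
      (ψ.lam j.castSucc (α j.castSucc) : ℂ) *
        ψ.bulk j (i j.succ.castSucc) (α j.castSucc) (α j.succ) := by
    intro j
    simp only [absorbed, of_apply, Nat.add_one_ne_zero, if_false, Nat.add_sub_cancel, j.2, dif_pos]
    rfl
  simp only [h1, Finset.prod_mul_distrib, Fin.prod_univ_castSucc]
  simp [absorbed]
  ring

/-- Only row `0` of the first tensor is filled. This is why starting a chain from the vacuum or from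
the identity will make no difference for exact data. -/
lemma amp_absorbed_apply [NeZero D] {m : ℕ} (ψ : MPS m d D) (k : ℕ) (i : Fin (k + 1) → Fin d)
    {γ : Fin D} (hγ : γ ≠ 0) (β : Fin D) : amp (absorbed ψ) (k + 1) i γ β = 0 := by
  induction k generalizing β with
  | zero =>
    simp [amp, absorbed, hγ]
  | succ k ih =>
    rw [amp, mul_apply]
    exact sum_eq_zero fun α _ => by rw [ih, zero_mul]

lemma xfer_one_apply (a : Tensor d D) (β β' : Fin D) :
    xfer a 1 β β' = ∑ i, ∑ α, star (a i α β) * a i α β' := by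
  simp only [xfer, Matrix.mul_one, Matrix.sum_apply, mul_apply, conjTranspose_apply]

/-- Factorization of a tensor into an isometry and an upper triangular matrix. -/
lemma exists_isometry_mul [NeZero D] (hd : 0 < d) (T : Tensor d D) :
    ∃ (a : Tensor d D) (X : Matrix (Fin D) (Fin D) ℂ),
      (∀ i, T i = a i * X) ∧ xfer a 1 = 1 ∧ ∀ γ, γ ≠ 0 → X γ 0 = 0 := by
  classical
  have hle : D ≤ d * D := Nat.le_mul_of_pos_left D hd
  let col : Fin D → EuclideanSpace ℂ (Fin d × Fin D) := fun β => WithLp.toLp 2 fun p => T p.1 p.2 β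
  -- The `D` columns are padded with zeros to the full dimension, so Gram–Schmidt yields a complete
  -- orthonormal basis even if the columns are dependent. Its first `D` vectors form the isometry.
  let f : Fin (d * D) → EuclideanSpace ℂ (Fin d × Fin D) := fun t => if h : (t : ℕ) < D then col ⟨t, h⟩ else 0
  have hcard : Module.finrank ℂ (EuclideanSpace ℂ (Fin d × Fin D)) =
      Fintype.card (Fin (d * D)) := by simp
  let b := InnerProductSpace.gramSchmidtOrthonormalBasis hcard f
  let ι : Fin D → Fin (d * D) := Fin.castLE hle
  have hf : ∀ β, f (ι β) = col β := fun β => by simp [f, ι]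
  have htri : ∀ t β, ι β < t → inner ℂ (b t) (col β) = 0 := fun t β h => by
    rw [← hf]; exact InnerProductSpace.gramSchmidtOrthonormalBasis_inv_triangular hcard f h
  refine ⟨fun i => of fun α β => b (ι β) (i, α), of fun γ β => inner ℂ (b (ι γ)) (col β), ?_, ?_, ?_⟩
  · intro i
    ext α β
    -- By triangularity the basis vectors with index beyond `β`, and so all those beyond the first
    -- `D`, have coefficient zero.
    have h1 : col β = ∑ γ, inner ℂ (b (ι γ)) (col β) • b (ι γ) := by
      conv_lhs => rw [← b.sum_repr' (col β)]
      symm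
      refine (Finset.sum_map univ (Fin.castLEEmb hle)
        (fun t => inner ℂ (b t) (col β) • b t)).symm.trans ?_
      refine Finset.sum_subset (subset_univ _) fun t _ ht => ?_
      rw [htri t β ?_, zero_smul]
      by_contra hc
      apply ht
      rw [Finset.mem_map]
      have : (t : ℕ) ≤ β := by simpa [ι, Fin.lt_def] using hc
      exact ⟨⟨t, by omega⟩, mem_univ _, by ext; simp⟩
    have h2 := congrArg (fun v : EuclideanSpace ℂ (Fin d × Fin D) => v (i, α)) h1
    simp only [mul_apply, of_apply]
    calc T i α β = (col β) (i, α) := rfl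
      _ = _ := h2
      _ = _ := by
        simp only [WithLp.ofLp_sum, Finset.sum_apply, WithLp.ofLp_smul, Pi.smul_apply, smul_eq_mul]
        exact sum_congr rfl fun γ _ => mul_comm _ _
  · ext β β'
    rw [xfer_one_apply]
    have h := b.orthonormal
    rw [orthonormal_iff_ite] at h
    have h3 := h (ι β) (ι β')
    simp only [ι, Fin.castLE_inj] at h3
    rw [Matrix.one_apply, ← h3, PiLp.inner_apply, Fintype.sum_prod_type]
    refine sum_congr rfl fun i _ => sum_congr rfl fun α _ => ?_
    simp [ι, mul_comm]
  · intro γ hγ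
    refine htri _ _ ?_
    have h0 : (γ : ℕ) ≠ 0 := Fin.val_eq_zero_iff.not.2 hγ
    exact Fin.lt_def.2 (show ((0 : Fin D) : ℕ) < (γ : ℕ) by rw [Fin.val_zero]; omega)

/-- Every sequence of tensors can be brought to left-canonical form. -/
lemma exists_canonical [NeZero D] (hd : 0 < d) (B : ℕ → Tensor d D) :
    ∃ (A : ℕ → Tensor d D) (X : ℕ → Matrix (Fin D) (Fin D) ℂ),
      (∀ k, xfer (A k) 1 = 1) ∧ (∀ k γ, γ ≠ 0 → X (k + 1) γ 0 = 0) ∧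
      ∀ k i, amp B k i = amp A k i * X k := by
  classical
  choose a Y h1 h2 h3 using fun T : Tensor d D => exists_isometry_mul hd T
  -- The triangular factor split off at one site is multiplied into the tensor of the next before
  -- that one is factored.
  let X : ℕ → Matrix (Fin D) (Fin D) ℂ := fun k =>
    Nat.rec 1 (fun k x => Y fun i => x * B k i) k
  refine ⟨fun k => a fun i => X k * B k i, X, fun k => h2 _, fun k γ hγ => h3 _ γ hγ, ?_⟩
  intro k
  induction k with
  | zero => intro i; simp [amp, X]
  | succ k ih =>
    intro i
    rw [amp, amp, ih, Matrix.mul_assoc, Matrix.mul_assoc, h1 (fun i => X k * B k i)]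

/-- Density matrices on the right of isometries. -/
noncomputable def dens [NeZero D] (A : ℕ → Tensor d D) (n : ℕ) : ℕ → Matrix (Fin D) (Fin D) ℂ
  | 0 => vac D
  | l + 1 => dual (A (n - (l + 1))) (dens A n l)

/-- Exact isometries, with the density matrices on their right. -/
structure Exact [NeZero D] (n : ℕ) (A : ℕ → Tensor d D) (ρ : ℕ → Matrix (Fin D) (Fin D) ℂ) :
    Prop where
  iso : ∀ k < n, xfer (A k) 1 = 1
  compat : ∀ k < n, ρ k = dual (A k) (ρ (k + 1))
  init : ρ 0 0 0 = 1
  final : ρ n = vac D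
  tensor_le : ∀ k < n, ∀ i α β, ‖A k i α β‖ ≤ 1
  density_le : ∀ k ≤ n, ∀ α β, ‖ρ k α β‖ ≤ 1

/-- The columns of an isometry are unit vectors. Hence its entries lie in the range covered by the
grid. -/
lemma norm_le_one_of_xfer {a : Tensor d D} (h : xfer a 1 = 1) (i : Fin d) (α β : Fin D) :
    ‖a i α β‖ ≤ 1 := by
  have h1 := congrFun (congrFun h β) β
  rw [xfer_one_apply, one_apply_eq] at h1
  have h2 : ∑ i, ∑ α, ‖a i α β‖ ^ 2 = 1 := by
    have : ((∑ i, ∑ α, ‖a i α β‖ ^ 2 : ℝ) : ℂ) = 1 := by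
      rw [← h1]; push_cast
      refine sum_congr rfl fun i _ => sum_congr rfl fun α _ => ?_
      rw [Complex.star_def, mul_comm, Complex.mul_conj, Complex.normSq_eq_norm_sq]; push_cast; rfl
    exact_mod_cast this
  have h3 : ‖a i α β‖ ^ 2 ≤ 1 := by
    rw [← h2]
    refine le_trans ?_ (single_le_sum (f := fun i => ∑ α, ‖a i α β‖ ^ 2)
      (fun _ _ => sum_nonneg fun _ _ => by positivity) (mem_univ i))
    exact single_le_sum (f := fun α => ‖a i α β‖ ^ 2) (fun _ _ => by positivity) (mem_univ α)
  exact (sq_le_one_iff₀ (norm_nonneg _)).1 h3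

/-- The diagonal entries are nonnegative with sum `1`, and positivity bounds the others by means of
two diagonal ones. -/
lemma norm_le_one_of_trace {ρ : Matrix (Fin D) (Fin D) ℂ} (h : ρ.PosSemidef) (ht : ρ.trace = 1)
    (i j : Fin D) : ‖ρ i j‖ ≤ 1 := by
  have h1 := (dom_self h).apply i j
  have h2 : ∀ i, (ρ i i).re ≤ 1 := by
    intro i
    have h3 : ∑ i, (ρ i i).re = 1 := by
      have := congrArg Complex.re ht
      simpa [trace] using this
    rw [← h3]
    refine single_le_sum (f := fun i => (ρ i i).re) (fun i _ => ?_) (mem_univ i)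
    have := re_qf_nonneg h (Pi.single i 1)
    rwa [qf_single] at this
  linarith [h2 i, h2 j]

/-! ### Exact data of a normalized state -/

section Optimum

variable {m : ℕ}

lemma env_one_of_iso {A : ℕ → Tensor d D} (h : ∀ k, xfer (A k) 1 = 1) (k : ℕ) :
    env A 1 k = 1 := by
  induction k with
  | zero => rfl
  | succ k ih => rw [env, ih, h]

variable [NeZero D]

/-- The adjoint of a map that fixes the identity preserves the trace. -/
lemma trace_dens (A : ℕ → Tensor d D) (h : ∀ k, xfer (A k) 1 = 1) (n l : ℕ) :
    (dens A n l).trace = 1 := by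
  induction l with
  | zero => simp [dens, vac]
  | succ l ih =>
    have := trace_mul_xfer (A (n - (l + 1))) (dens A n l) 1
    rw [h, Matrix.mul_one, Matrix.mul_one] at this
    rw [dens, ← this, ih]

lemma posSemidef_dens (A : ℕ → Tensor d D) (n l : ℕ) : (dens A n l).PosSemidef := by
  induction l with
  | zero => exact posSemidef_vac
  | succ l ih => exact posSemidef_dual _ ih

lemma dens_compat (A : ℕ → Tensor d D) {n k : ℕ} (hk : k < n) :
    dens A n (n - k) = dual (A k) (dens A n (n - (k + 1))) := by
  obtain ⟨l, hl⟩ : ∃ l, n - k = l + 1 := ⟨n - k - 1, by omega⟩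
  rw [hl, dens, show n - (l + 1) = k by omega, show n - (k + 1) = l by omega]

/-- Consistent density matrices transport expectation values exactly. -/
lemma trace_dens_mul (A : ℕ → Tensor d D) {n s L : ℕ} (hs : s + L = n)
    {Y : ℕ → Matrix (Fin D) (Fin D) ℂ} (hY : ∀ l < L, Y (l + 1) = xfer (A (s + l)) (Y l)) :
    (dens A n (n - s) * Y 0).trace = Y L 0 0 := by
  have key : ∀ l ≤ L, (dens A n (n - s) * Y 0).trace = (dens A n (n - (s + l)) * Y l).trace := by
    intro l
    induction l with
    | zero => simp
    | succ l ih =>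
      intro hl
      rw [ih (by omega), hY l (by omega), trace_mul_xfer, dens_compat A (show s + l < n by omega)]
      rfl
  rw [key L le_rfl, show n - (s + L) = 0 by omega, dens, trace_vac_mul]

/-- A normalized matrix product state has the energy predicted by an exact canonical form. -/
theorem exists_exact (hd : 0 < d) (H : NNHamiltonian m d) {J : ℝ} (hJ : H.TermsBoundedBy J)
    (ψ : MPS m d D) (hψ : ψ.Normalized) :
    ∃ (A : ℕ → Tensor d D) (ρ : ℕ → Matrix (Fin D) (Fin D) ℂ), Exact (m + 2) A ρ ∧
      H.energy ψ.toState = ∑ j : Fin (m + 1), weight (H.term j) (A j) (A (j + 1)) (ρ (j + 2)) := by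
  obtain ⟨A, X, hA, hX, hB⟩ := exists_canonical hd (absorbed ψ)
  set x := X (m + 2) 0 0 with hx
  -- Column `0` of the last triangular factor is a multiple of the first basis vector, so all that
  -- the sweep leaves over at the right end is the scalar `x`.
  have hcol : ∀ i γ, amp (absorbed ψ) (m + 2) i γ 0 = amp A (m + 2) i γ 0 * x := by
    intro i γ
    rw [hB, mul_apply, Finset.sum_eq_single 0 (fun b _ hb => by rw [hX (m + 1) b hb, mul_zero])
      (by simp)]
  have hst : ψ.toState = x • state m A := by
    rw [← state_absorbed]
    funext i
    rw [state, hcol, Pi.smul_apply, smul_eq_mul, mul_comm]; rfl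
  have hnorm : star x * x * env A (vac D) (m + 2) 0 0 = 1 := by
    have h1 : star ψ.toState ⬝ᵥ ψ.toState = 1 := hψ
    rw [hst] at h1
    rw [← state_dotProduct_self, ← h1, star_smul, smul_dotProduct, dotProduct_smul, smul_eq_mul,
      smul_eq_mul, mul_assoc]
  -- Normalization excludes `x = 0`, so the vanishing rows of the original product carry over to the
  -- canonical one.
  have hzero : ∀ γ, γ ≠ 0 → ∀ i, amp A (m + 2) i γ 0 = 0 := by
    intro γ hγ i
    have h1 := hcol i γ
    rw [amp_absorbed_apply ψ _ i hγ] at h1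
    rcases mul_eq_zero.1 h1.symm with h2 | h2
    · exact h2
    · rw [h2] at hnorm; simp at hnorm
  -- The rows other than `0` contribute nothing, hence the environments of the vacuum and of the
  -- identity have the same entry here, namely `1`.
  have hvac : env A (vac D) (m + 2) 0 0 = 1 := by
    have h1 := congrFun (congrFun (env_one_of_iso hA (m + 2)) 0) 0
    rw [env_eq_sum, one_apply_eq, Matrix.sum_apply] at h1
    rw [← h1, env_eq_sum, Matrix.sum_apply]
    refine sum_congr rfl fun i _ => ?_
    rw [conjTranspose_mul_vac_mul, Matrix.mul_one, mul_apply, Finset.sum_eq_single 0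
      (fun b _ hb => by rw [hzero b hb, mul_zero]) (by simp), conjTranspose_apply]
  have hxn : ‖x‖ ^ 2 = 1 := by
    rw [hvac, mul_one, Complex.star_def, mul_comm, Complex.mul_conj,
      Complex.normSq_eq_norm_sq] at hnorm
    exact_mod_cast hnorm
  refine ⟨A, fun k => dens A (m + 2) (m + 2 - k), ⟨fun k _ => hA k, fun k hk => dens_compat A hk,
    ?_, by simp [dens], fun k _ => norm_le_one_of_xfer (hA k),
    fun k _ => norm_le_one_of_trace (posSemidef_dens _ _ _) (trace_dens A hA _ _)⟩, ?_⟩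
  · have := trace_dens_mul A (n := m + 2) (s := 0) (L := m + 2) (by simp) (Y := env A (vac D))
      (fun l _ => by simp [env])
    rw [show env A (vac D) 0 = vac D from rfl, trace_mul_vac, hvac] at this
    exact this
  · rw [hst, energy_smul, hxn, one_mul, energy_state]
    refine sum_congr rfl fun j _ => ?_
    have h1 := trace_dens_mul A (n := m + 2) (s := j + 2) (L := m - j) (by omega)
      (Y := ener A (H.term j) j 1) (fun l _ => rfl)
    rw [ener, env_one_of_iso hA] at h1
    rw [weight, h1]
    have e1 : ener A (H.term j) j 1 (m - j) =
        ener A (H.term j) j (vac D) (m - j) + ener A (H.term j) j (1 - vac D) (m - j) := by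
      rw [← ener_add]; simp
    -- The part of the identity outside the vacuum has norm `0` at the right end, and therefore, by
    -- domination, no energy.
    have h2 := (Dom.ener (formBound_of_termsBoundedBy hJ j) A j
      (posSemidef_one_sub_vac (D := D)) (m - j)).apply 0 0
    have e2 : env A (1 - vac D) (m + 2) 0 0 = 0 := by
      have h3 : env A 1 (m + 2) = env A (vac D) (m + 2) + env A (1 - vac D) (m + 2) := by
        rw [← env_add]; simp
      have h4 := congrFun (congrFun h3 0) 0
      rw [env_one_of_iso hA, Matrix.add_apply, hvac, one_apply_eq] at h4
      exact (add_eq_left.1 h4.symm)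
    rw [show (j : ℕ) + 2 + (m - j) = m + 2 by omega, e2] at h2
    simp only [Complex.zero_re, add_zero, mul_zero, norm_le_zero_iff] at h2
    rw [e1, Matrix.add_apply, h2, add_zero]

end Optimum

end Transfer

/-! ### Real coordinates and rounding to a grid -/

namespace Transfer

open Matrix Finset
open scoped ComplexOrder

variable {d D : ℕ}

/-- The tensor with given real coordinates. -/
noncomputable def tensorOf (d D : ℕ) (v : ℕ → ℝ) : Tensor d D := fun i => of fun α β =>
  ⟨v ((i * D + α) * D + β), v (d * D * D + ((i * D + α) * D + β))⟩

/-- The matrix with given real coordinates. -/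
noncomputable def densityOf (d D : ℕ) (v : ℕ → ℝ) : Matrix (Fin D) (Fin D) ℂ := of fun α β =>
  ⟨v (2 * (d * D * D) + (α * D + β)), v (2 * (d * D * D) + D * D + (α * D + β))⟩

/-- Number of real coordinates of a tensor and a density matrix. -/
def coords (d D : ℕ) : ℕ := 2 * (d * D * D) + 2 * (D * D)

lemma index_lt {a b x y : ℕ} (hx : x < a) (hy : y < b) : x * b + y < a * b := by
  calc x * b + y < x * b + b := by omega
    _ = (x + 1) * b := by ring
    _ ≤ a * b := Nat.mul_le_mul_right _ hx

lemma tensor_index_lt (i : Fin d) (α β : Fin D) : ((i : ℕ) * D + α) * D + β < d * D * D :=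
  index_lt (index_lt i.2 α.2) β.2

lemma density_index_lt (α β : Fin D) : (α : ℕ) * D + β < D * D := index_lt α.2 β.2

lemma exists_index_fun₂ {a b : ℕ} (f : Fin a → Fin b → ℂ) (hf : ∀ i j, ‖f i j‖ ≤ 1) :
    ∃ u : ℕ → ℂ, (∀ (i : Fin a) (j : Fin b), u ((i : ℕ) * b + j) = f i j) ∧ ∀ q, ‖u q‖ ≤ 1 := by
  refine ⟨fun q => if h : q < a * b then
    f (finProdFinEquiv.symm ⟨q, h⟩).1 (finProdFinEquiv.symm ⟨q, h⟩).2 else 0, ?_, ?_⟩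
  · intro i j
    have h := index_lt i.2 j.2
    have e : (⟨(i : ℕ) * b + j, h⟩ : Fin (a * b)) = finProdFinEquiv (i, j) := by
      ext; simp [mul_comm, add_comm]
    simp only [h, dif_pos, e, Equiv.symm_apply_apply]
  · intro q
    dsimp only
    split_ifs
    · exact hf _ _
    · simp

/-- Four consecutive blocks hold the real and imaginary parts of the tensor and then those of the
density matrix. Being bounded by `1` is what allows rounding to the grid. -/
lemma exists_coordinates (A : Tensor d D) (ρ : Matrix (Fin D) (Fin D) ℂ)
    (hA : ∀ i α β, ‖A i α β‖ ≤ 1) (hρ : ∀ α β, ‖ρ α β‖ ≤ 1) :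
    ∃ u : ℕ → ℝ, tensorOf d D u = A ∧ densityOf d D u = ρ ∧ ∀ q, |u q| ≤ 1 := by
  choose f hf hf1 using fun i => exists_index_fun₂ (A i) (hA i)
  obtain ⟨a, ha, ha1⟩ := exists_index_fun₂ (a := d) (b := D * D) (fun i q => f i q)
    fun i q => hf1 i q
  obtain ⟨r, hr, hr1⟩ := exists_index_fun₂ ρ hρ
  have ha' : ∀ (i : Fin d) (α β : Fin D), a (((i : ℕ) * D + α) * D + β) = A i α β := by
    intro i α β
    rw [← hf i α β, ← ha i ⟨_, density_index_lt α β⟩]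
    congr 1; simp only; ring
  refine ⟨fun q => if q < d * D * D then (a q).re else if q < 2 * (d * D * D) then
    (a (q - d * D * D)).im else if q < 2 * (d * D * D) + D * D then (r (q - 2 * (d * D * D))).re
    else (r (q - (2 * (d * D * D) + D * D))).im, ?_, ?_, ?_⟩
  · funext i
    ext α β
    have h := tensor_index_lt i α β
    apply Complex.ext
    · simp [tensorOf, h, ha']
    · have h1 : ¬ (d * D * D + (((i : ℕ) * D + α) * D + β) < d * D * D) := by omega
      have h2 : d * D * D + (((i : ℕ) * D + α) * D + β) < 2 * (d * D * D) := by omega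
      simp only [tensorOf, of_apply, h1, h2, if_true, if_false, Nat.add_sub_cancel_left, ha']
  · ext α β
    have h := density_index_lt α β
    apply Complex.ext
    · have h1 : ¬ (2 * (d * D * D) + ((α : ℕ) * D + β) < d * D * D) := by omega
      have h2 : ¬ (2 * (d * D * D) + ((α : ℕ) * D + β) < 2 * (d * D * D)) := by omega
      have h3 : 2 * (d * D * D) + ((α : ℕ) * D + β) < 2 * (d * D * D) + D * D := by omega
      simp only [densityOf, of_apply, h1, h2, h3, if_true, if_false, Nat.add_sub_cancel_left, hr]
    · have h1 : ¬ (2 * (d * D * D) + D * D + ((α : ℕ) * D + β) < d * D * D) := by omega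
      have h2 : ¬ (2 * (d * D * D) + D * D + ((α : ℕ) * D + β) < 2 * (d * D * D)) := by omega
      have h3 : ¬ (2 * (d * D * D) + D * D + ((α : ℕ) * D + β) < 2 * (d * D * D) + D * D) := by
        omega
      simp only [densityOf, of_apply, h1, h2, h3, if_false, Nat.add_sub_cancel_left, hr]
  · intro q
    dsimp only
    split_ifs
    · exact (Complex.abs_re_le_norm _).trans (ha1 _)
    · exact (Complex.abs_im_le_norm _).trans (ha1 _)
    · exact (Complex.abs_re_le_norm _).trans (hr1 _)
    · exact (Complex.abs_im_le_norm _).trans (hr1 _)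

/-- Rounding to a grid of `2 M + 1` points. -/
lemma exists_grid_point {M : ℕ} (hM : 0 < M) {t : ℝ} (ht : |t| ≤ 1) :
    ∃ j : ℕ, j < 2 * M + 1 ∧ |((j : ℝ) - M) / M - t| ≤ 1 / M := by
  have hM' : (0 : ℝ) < M := by exact_mod_cast hM
  have h1 := abs_le.1 ht
  have h0 : 0 ≤ (t + 1) * M := by nlinarith
  refine ⟨⌊(t + 1) * M⌋₊, ?_, ?_⟩
  · have : ⌊(t + 1) * M⌋₊ ≤ 2 * M := by
      rw [← Nat.floor_natCast (R := ℝ) (2 * M)]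
      apply Nat.floor_le_floor
      push_cast
      nlinarith
    omega
  · have h2 := Nat.floor_le h0
    have h3 := Nat.lt_floor_add_one ((t + 1) * M)
    have e : ((⌊(t + 1) * M⌋₊ : ℝ) - M) / M - t = ((⌊(t + 1) * M⌋₊ : ℝ) - (t + 1) * M) / M := by
      field_simp; ring
    rw [e, abs_div, abs_of_pos hM']
    gcongr
    rw [abs_le]
    constructor <;> linarith

lemma norm_mk_sub_mk_le {x y x' y' δ : ℝ} (hx : |x - x'| ≤ δ) (hy : |y - y'| ≤ δ) :
    ‖(⟨x, y⟩ - ⟨x', y'⟩ : ℂ)‖ ≤ 2 * δ := by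
  refine (Complex.norm_le_abs_re_add_abs_im _).trans ?_
  simp only [Complex.sub_re, Complex.sub_im]
  linarith

lemma norm_mk_le {x y : ℝ} (hx : |x| ≤ 1) (hy : |y| ≤ 1) : ‖(⟨x, y⟩ : ℂ)‖ ≤ 2 := by
  refine (Complex.norm_le_abs_re_add_abs_im _).trans ?_
  simp only
  linarith

section Coordinates

variable {u v : ℕ → ℝ} {δ : ℝ}

lemma norm_tensorOf_sub_le (h : ∀ q < coords d D, |v q - u q| ≤ δ) (i : Fin d) (α β : Fin D) :
    ‖(tensorOf d D v i - tensorOf d D u i) α β‖ ≤ 2 * δ := by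
  have := tensor_index_lt i α β
  exact norm_mk_sub_mk_le (h _ (by rw [coords]; omega)) (h _ (by rw [coords]; omega))

lemma norm_densityOf_sub_le (h : ∀ q < coords d D, |v q - u q| ≤ δ) (α β : Fin D) :
    ‖(densityOf d D v - densityOf d D u) α β‖ ≤ 2 * δ := by
  have := density_index_lt α β
  exact norm_mk_sub_mk_le (h _ (by rw [coords]; omega)) (h _ (by rw [coords]; omega))

lemma norm_tensorOf_le (h : ∀ q < coords d D, |v q| ≤ 1) (i : Fin d) (α β : Fin D) :
    ‖tensorOf d D v i α β‖ ≤ 2 := by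
  have := tensor_index_lt i α β
  exact norm_mk_le (h _ (by rw [coords]; omega)) (h _ (by rw [coords]; omega))

lemma norm_densityOf_le (h : ∀ q < coords d D, |v q| ≤ 1) (α β : Fin D) :
    ‖densityOf d D v α β‖ ≤ 2 := by
  have := density_index_lt α β
  exact norm_mk_le (h _ (by rw [coords]; omega)) (h _ (by rw [coords]; omega))

end Coordinates

/-! ### Effect of rounding on the local quantities -/

section Perturbation

/-- The product rule `XY - X'Y' = X(Y - Y') + (X - X')Y'`. The following perturbation bounds iterate
it with entries of size `2` and deviations `2δ`. -/
lemma norm_mul_sub_mul_apply_le {X Y X' Y' : Matrix (Fin D) (Fin D) ℂ} {x y e f : ℝ}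
    (hX : ∀ i j, ‖X i j‖ ≤ x) (hY : ∀ i j, ‖Y' i j‖ ≤ y) (he : ∀ i j, ‖(X - X') i j‖ ≤ e)
    (hf : ∀ i j, ‖(Y - Y') i j‖ ≤ f) (i j : Fin D) :
    ‖(X * Y - X' * Y') i j‖ ≤ D * (x * f + e * y) := by
  have e1 : X * Y - X' * Y' = X * (Y - Y') + (X - X') * Y' := by
    rw [Matrix.mul_sub, Matrix.sub_mul]; abel
  rw [e1, Matrix.add_apply]
  refine (norm_add_le _ _).trans ((add_le_add (norm_mul_apply_le hX hf i j)
    (norm_mul_apply_le he hY i j)).trans (le_of_eq (by ring)))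

variable {a b a' b' : Tensor d D} {ρ ρ' : Matrix (Fin D) (Fin D) ℂ} {δ : ℝ}

lemma norm_conjTranspose_apply_le {X : Matrix (Fin D) (Fin D) ℂ} {x : ℝ} (h : ∀ i j, ‖X i j‖ ≤ x)
    (i j : Fin D) : ‖Xᴴ i j‖ ≤ x := by
  rw [conjTranspose_apply, norm_star]; exact h j i

lemma norm_xfer_one_sub_le (ha : ∀ i α β, ‖a i α β‖ ≤ 2) (ha' : ∀ i α β, ‖a' i α β‖ ≤ 2)
    (h : ∀ i α β, ‖(a i - a' i) α β‖ ≤ 2 * δ) (β β' : Fin D) :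
    ‖(xfer a 1 - xfer a' 1) β β'‖ ≤ 8 * d * D * δ := by
  simp only [xfer, ← Finset.sum_sub_distrib, Matrix.mul_one, Matrix.sum_apply]
  calc _ ≤ ∑ i : Fin d, (D : ℝ) * (2 * (2 * δ) + 2 * δ * 2) := by
        refine (norm_sum_le _ _).trans (sum_le_sum fun i _ => ?_)
        refine norm_mul_sub_mul_apply_le (norm_conjTranspose_apply_le (ha i)) (ha' i) ?_ (h i) β β'
        rw [← conjTranspose_sub]
        exact norm_conjTranspose_apply_le (h i)
    _ = _ := by simp; ring

lemma norm_dual_sub_le (ha : ∀ i α β, ‖a i α β‖ ≤ 2) (ha' : ∀ i α β, ‖a' i α β‖ ≤ 2)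
    (h : ∀ i α β, ‖(a i - a' i) α β‖ ≤ 2 * δ) (hρ : ∀ α β, ‖ρ α β‖ ≤ 2)
    (hρ' : ∀ α β, ‖ρ' α β‖ ≤ 2) (hr : ∀ α β, ‖(ρ - ρ') α β‖ ≤ 2 * δ) (β β' : Fin D) :
    ‖(dual a ρ - dual a' ρ') β β'‖ ≤ 24 * d * D ^ 2 * δ := by
  simp only [dual, ← Finset.sum_sub_distrib, Matrix.sum_apply]
  calc _ ≤ ∑ i : Fin d, (D : ℝ) * ((D * (2 * 2)) * (2 * δ) + (D * (2 * (2 * δ) + 2 * δ * 2)) * 2) := by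
        refine (norm_sum_le _ _).trans (sum_le_sum fun i _ => ?_)
        refine norm_mul_sub_mul_apply_le (norm_mul_apply_le (ha i) hρ)
          (norm_conjTranspose_apply_le (ha' i))
          (norm_mul_sub_mul_apply_le (ha i) hρ' (h i) hr) ?_ β β'
        rw [← conjTranspose_sub]
        exact norm_conjTranspose_apply_le (h i)
    _ = _ := by simp; ring

lemma abs_weight_sub_weight_le {H : Matrix (Fin d × Fin d) (Fin d × Fin d) ℂ} {J : ℝ}
    (hJ : 0 ≤ J) (hH : ∀ p q, ‖H p q‖ ≤ J) (hδ : 0 ≤ δ) (hD : 0 < D)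
    (ha : ∀ i α β, ‖a i α β‖ ≤ 2)
    (ha' : ∀ i α β, ‖a' i α β‖ ≤ 2) (hab : ∀ i α β, ‖(a i - a' i) α β‖ ≤ 2 * δ)
    (hb : ∀ i α β, ‖b i α β‖ ≤ 2) (hb' : ∀ i α β, ‖b' i α β‖ ≤ 2)
    (hbb : ∀ i α β, ‖(b i - b' i) α β‖ ≤ 2 * δ) (hρ : ∀ α β, ‖ρ α β‖ ≤ 2)
    (hr : ∀ α β, ‖(ρ - ρ') α β‖ ≤ 2 * δ) :
    |weight H a b ρ - weight H a' b' ρ'| ≤ 160 * d ^ 4 * D ^ 6 * J * δ := by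
  have hD1 : (1 : ℝ) ≤ D := by exact_mod_cast hD
  have h1 : ∀ p : Fin d × Fin d, ∀ i j, ‖(a p.1 * b p.2 - a' p.1 * b' p.2) i j‖ ≤
      D * (2 * (2 * δ) + 2 * δ * 2) := fun p =>
    norm_mul_sub_mul_apply_le (ha _) (hb' _) (hab _) (hbb _)
  have h2 : ∀ i j, ‖(xfer2 H a b 1 - xfer2 H a' b' 1) i j‖ ≤ 64 * d ^ 4 * D ^ 3 * J * δ := by
    intro i j
    simp only [xfer2, ← Finset.sum_sub_distrib, Matrix.mul_one, Matrix.sum_apply, ← smul_sub,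
      Matrix.smul_apply, smul_eq_mul]
    calc _ ≤ ∑ p : Fin d × Fin d, ∑ q : Fin d × Fin d, J * (D * ((D * (2 * 2)) *
          (D * (2 * (2 * δ) + 2 * δ * 2)) + (D * (2 * (2 * δ) + 2 * δ * 2)) * (D * (2 * 2)))) := by
          refine (norm_sum_le _ _).trans (sum_le_sum fun p _ => (norm_sum_le _ _).trans
            (sum_le_sum fun q _ => ?_))
          rw [norm_mul]
          refine mul_le_mul (hH p q) ?_ (norm_nonneg _) hJ
          refine norm_mul_sub_mul_apply_le
            (norm_conjTranspose_apply_le (norm_mul_apply_le (ha _) (hb _)))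
            (norm_mul_apply_le (ha' _) (hb' _)) ?_ (h1 q) i j
          rw [← conjTranspose_sub]
          exact norm_conjTranspose_apply_le (h1 p)
      _ = _ := by simp; ring
  have h3 : ∀ i j, ‖xfer2 H a' b' 1 i j‖ ≤ 16 * d ^ 4 * D ^ 4 * J * 1 :=
    norm_xfer2_apply_le hH ha' hb' (fun i j => by
      rw [one_apply]; split_ifs <;> simp)
  rw [weight, weight, ← Complex.sub_re]
  refine (Complex.abs_re_le_norm _).trans ?_
  have e1 : (ρ * xfer2 H a b 1).trace - (ρ' * xfer2 H a' b' 1).trace =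
      (ρ * (xfer2 H a b 1 - xfer2 H a' b' 1)).trace + ((ρ - ρ') * xfer2 H a' b' 1).trace := by
    rw [Matrix.mul_sub, Matrix.sub_mul, trace_sub, trace_sub]; ring
  rw [e1]
  refine (norm_add_le _ _).trans ((add_le_add (norm_trace_mul_le hρ h2)
    (norm_trace_mul_le hr h3)).trans ?_)
  have e2 : (d : ℝ) ^ 4 * D ^ 5 * J * δ ≤ d ^ 4 * D ^ 6 * J * δ := by
    gcongr
    norm_num
  calc _ = 128 * ((d : ℝ) ^ 4 * D ^ 5 * J * δ) + 32 * (d ^ 4 * D ^ 6 * J * δ) := by ring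
    _ ≤ _ := by linarith

end Perturbation

/-- Contribution of the layers `k - 1` and `k` to the energy. -/
noncomputable def stepCost (n : ℕ) (h : ℕ → Matrix (Fin d × Fin d) (Fin d × Fin d) ℂ) (D k : ℕ)
    (v w : ℕ → ℝ) : ℝ :=
  if 2 ≤ k ∧ k ≤ n then
    weight (h (k - 2)) (tensorOf d D v) (tensorOf d D w) (densityOf d D w) else 0

/-- The energy of a path. -/
noncomputable def pathCost (n : ℕ) (h : ℕ → Matrix (Fin d × Fin d) (Fin d × Fin d) ℂ) (D : ℕ)
    (pts : ℕ → ℕ → ℝ) (y : ℕ → ℕ) : ℝ :=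
  ∑ k ∈ range (n + 1), stepCost n h D (k + 1) (pts (y k)) (pts (y (k + 1)))

/-- The steps into layer `1` and into the additional layer `n + 1` have no energy; the `n - 1` steps
between them correspond to the bonds. -/
lemma pathCost_eq (m : ℕ) (h : ℕ → Matrix (Fin d × Fin d) (Fin d × Fin d) ℂ)
    (pts : ℕ → ℕ → ℝ) (y : ℕ → ℕ) : pathCost (m + 2) h D pts y =
      ∑ j : Fin (m + 1), weight (h j) (tensorOf d D (pts (y (j + 1))))
        (tensorOf d D (pts (y (j + 2)))) (densityOf d D (pts (y (j + 2)))) := by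
  rw [pathCost, Finset.sum_range_succ, Finset.sum_range_succ', Finset.sum_range]
  simp [stepCost]
  refine sum_congr rfl fun j _ => ?_
  rw [if_pos (by omega)]

/-- A finite set of points that contains all points of a grid with `2 M + 1` values. -/
structure Net (P M S : ℕ) (pts : ℕ → ℕ → ℝ) : Prop where
  abs_le : ∀ x < S, ∀ q < P, |pts x q| ≤ 1
  complete : ∀ f : ℕ → ℕ, (∀ q, f q < 2 * M + 1) →
    ∃ x < S, ∀ q < P, pts x q = ((f q : ℝ) - M) / M

lemma norm_le_of_sum_sq_le {X : Matrix (Fin D) (Fin D) ℂ} {η : ℝ} (hη : 0 ≤ η)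
    (h : ∑ α, ∑ β, ‖X α β‖ ^ 2 ≤ η ^ 2) (α β : Fin D) : ‖X α β‖ ≤ η := by
  have h1 : ‖X α β‖ ^ 2 ≤ η ^ 2 := by
    refine le_trans ?_ h
    refine le_trans ?_ (single_le_sum (f := fun α => ∑ β, ‖X α β‖ ^ 2)
      (fun _ _ => sum_nonneg fun _ _ => by positivity) (mem_univ α))
    exact single_le_sum (f := fun β => ‖X α β‖ ^ 2) (fun _ _ => by positivity) (mem_univ β)
  exact (sq_le_sq₀ (norm_nonneg _) hη).1 h1

lemma sum_sq_le {X : Matrix (Fin D) (Fin D) ℂ} {x : ℝ} (h : ∀ α β, ‖X α β‖ ≤ x) :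
    ∑ α, ∑ β, ‖X α β‖ ^ 2 ≤ D ^ 2 * x ^ 2 := by
  calc _ ≤ ∑ α : Fin D, ∑ β : Fin D, x ^ 2 := sum_le_sum fun α _ => sum_le_sum fun β _ => by
        have := h α β
        gcongr
    _ = _ := by simp; ring

lemma exists_rounded {M S : ℕ} {pts : ℕ → ℕ → ℝ} (hM : 0 < M) (hpts : Net (coords d D) M S pts)
    (A : Tensor d D) (ρ : Matrix (Fin D) (Fin D) ℂ)
    (hA : ∀ i α β, ‖A i α β‖ ≤ 1) (hρ : ∀ α β, ‖ρ α β‖ ≤ 1) :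
    ∃ x < S, (∀ i α β, ‖(tensorOf d D (pts x) i - A i) α β‖ ≤ 2 * (1 / M : ℝ)) ∧
      (∀ α β, ‖(densityOf d D (pts x) - ρ) α β‖ ≤ 2 * (1 / M : ℝ)) := by
  obtain ⟨u, rfl, rfl, hu⟩ := exists_coordinates A ρ hA hρ
  choose f hf1 hf2 using fun q => exists_grid_point hM (hu q)
  obtain ⟨x, hx, hxf⟩ := hpts.complete f hf1
  have h : ∀ q < coords d D, |pts x q - u q| ≤ 1 / M := fun q hq => by
    rw [hxf q hq]; exact hf2 q
  exact ⟨x, hx, norm_tensorOf_sub_le h, norm_densityOf_sub_le h⟩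

/-! ### Admissible paths: soundness, completeness and near-optimality -/

variable [NeZero D]

/-- Violation of the constraints between consecutive layers `k - 1` and `k` of a chain of `n`
sites: the data of layer `k` are the tensor of the `k`-th site and the density matrix to its right. -/
noncomputable def penalty (d D n k : ℕ) [NeZero D] (v w : ℕ → ℝ) : ℝ :=
  (if k = 1 then ‖densityOf d D v 0 0 - 1‖ ^ 2 else 0) +
  (if k = n + 1 then ∑ α, ∑ β, ‖(densityOf d D v - vac D) α β‖ ^ 2 else 0) +
  (if k ≤ n then ∑ β, ∑ β', ‖(xfer (tensorOf d D w) 1 - 1) β β'‖ ^ 2 else 0) +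
  (if k ≤ n then ∑ α, ∑ α', ‖(densityOf d D v -
    dual (tensorOf d D w) (densityOf d D w)) α α'‖ ^ 2 else 0)

/-- A path through the layers that satisfies the constraints. -/
structure Path (d D n S : ℕ) [NeZero D] (η : ℝ) (pts : ℕ → ℕ → ℝ) (y : ℕ → ℕ) : Prop where
  lt : ∀ k ≤ n + 1, y k < S
  ok : ∀ k, 1 ≤ k → k ≤ n + 1 → penalty d D n k (pts (y (k - 1))) (pts (y k)) ≤ η ^ 2

/-- The data along an admissible path are approximately canonical. -/
lemma Path.approx {n S M : ℕ} {η : ℝ} {pts : ℕ → ℕ → ℝ} {y : ℕ → ℕ}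
    (hy : Path d D n S η pts y) (hη : 0 ≤ η) (hn : 1 ≤ n) (hpts : Net (coords d D) M S pts) :
    Approx n (fun k => tensorOf d D (pts (y (k + 1)))) (fun k => densityOf d D (pts (y k))) η := by
  have hnn : ∀ X : Matrix (Fin D) (Fin D) ℂ, 0 ≤ ∑ α, ∑ β, ‖X α β‖ ^ 2 := fun X =>
    sum_nonneg fun _ _ => sum_nonneg fun _ _ => by positivity
  refine ⟨fun k hk => norm_le_of_sum_sq_le hη ?_, fun k hk => norm_le_of_sum_sq_le hη ?_, ?_,
    norm_le_of_sum_sq_le hη ?_, fun k hk => ?_, fun k hk => ?_⟩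
  · have := hy.ok (k + 1) (by omega) (by omega)
    simp only [penalty, if_pos (show k + 1 ≤ n by omega), if_neg (show ¬ k + 1 = n + 1 by omega),
      Nat.add_sub_cancel] at this
    refine le_trans ?_ this
    have h1 := hnn (densityOf d D (pts (y k)) -
      dual (tensorOf d D (pts (y (k + 1)))) (densityOf d D (pts (y (k + 1)))))
    have h2 : 0 ≤ (if k + 1 = 1 then ‖densityOf d D (pts (y k)) 0 0 - 1‖ ^ 2 else 0) := by
      split_ifs <;> positivity
    linarith
  · have := hy.ok (k + 1) (by omega) (by omega)
    simp only [penalty, if_pos (show k + 1 ≤ n by omega), if_neg (show ¬ k + 1 = n + 1 by omega),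
      Nat.add_sub_cancel] at this
    refine le_trans ?_ this
    have h1 := hnn (xfer (tensorOf d D (pts (y (k + 1)))) 1 - 1)
    have h2 : 0 ≤ (if k + 1 = 1 then ‖densityOf d D (pts (y k)) 0 0 - 1‖ ^ 2 else 0) := by
      split_ifs <;> positivity
    linarith
  · have := hy.ok 1 (by omega) (by omega)
    simp only [penalty, if_pos hn, if_neg (show ¬ 1 = n + 1 by omega), Nat.sub_self, if_true] at this
    have h1 := hnn (xfer (tensorOf d D (pts (y 1))) 1 - 1)
    have h2 := hnn (densityOf d D (pts (y 0)) -
      dual (tensorOf d D (pts (y 1))) (densityOf d D (pts (y 1))))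
    refine (sq_le_sq₀ (norm_nonneg _) hη).1 (le_trans ?_ this)
    linarith
  · have := hy.ok (n + 1) (by omega) (by omega)
    simpa [penalty, show n ≠ 0 by omega] using this
  · exact norm_tensorOf_le (hpts.abs_le _ (hy.lt _ (by omega)))
  · exact norm_densityOf_le (hpts.abs_le _ (hy.lt _ (by omega)))

/-- Exact canonical data can be rounded to an admissible path. -/
lemma Exact.exists_path {m M S : ℕ} {η : ℝ} {pts : ℕ → ℕ → ℝ}
    {A : ℕ → Tensor d D} {ρ : ℕ → Matrix (Fin D) (Fin D) ℂ} (hE : Exact (m + 2) A ρ)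
    (hd : 0 < d) (hM : 0 < M) (hpts : Net (coords d D) M S pts)
    (hMη : 28 * d * D ^ 3 * (1 / M : ℝ) ≤ η) {J : ℝ} (hJ : 0 ≤ J)
    (h : ℕ → Matrix (Fin d × Fin d) (Fin d × Fin d) ℂ) (hh : ∀ j ≤ m, ∀ p q, ‖h j p q‖ ≤ J) :
    ∃ z, Path d D (m + 2) S η pts z ∧ pathCost (m + 2) h D pts z ≤
      ∑ j : Fin (m + 1), weight (h j) (A j) (A (j + 1)) (ρ (j + 2)) +
        (m + 1) * (160 * d ^ 4 * D ^ 6 * J * (1 / M : ℝ)) := by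
  -- Layer `k` rounds the tensor of site `k - 1`. In layer `0` truncated subtraction supplies some
  -- tensor that no constraint reads, and beyond layer `m + 2` any point will do.
  have key : ∀ k, ∃ x < S, k ≤ m + 2 →
      (∀ i α β, ‖(tensorOf d D (pts x) i - A (k - 1) i) α β‖ ≤ 2 * (1 / M : ℝ)) ∧
      (∀ α β, ‖(densityOf d D (pts x) - ρ k) α β‖ ≤ 2 * (1 / M : ℝ)) := by
    intro k
    by_cases hk : k ≤ m + 2
    · obtain ⟨x, hx, h1, h2⟩ := exists_rounded hM hpts (A (k - 1)) (ρ k)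
        (hE.tensor_le _ (by omega)) (hE.density_le k hk)
      exact ⟨x, hx, fun _ => ⟨h1, h2⟩⟩
    · obtain ⟨x, hx, -⟩ := exists_rounded hM hpts (A 0) (ρ 0)
        (hE.tensor_le _ (by omega)) (hE.density_le 0 (by omega))
      exact ⟨x, hx, fun h => absurd h hk⟩
  choose z hz hzc using key
  set δ : ℝ := 1 / M with hδ
  have hδ0 : 0 ≤ δ := by positivity
  have hd1 : (1 : ℝ) ≤ d := by exact_mod_cast hd
  have hD1 : (1 : ℝ) ≤ D := by exact_mod_cast Nat.one_le_iff_ne_zero.2 (NeZero.ne D)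
  have hA2 : ∀ k < m + 2, ∀ i α β, ‖A k i α β‖ ≤ 2 := fun k hk i α β =>
    (hE.tensor_le k hk i α β).trans one_le_two
  have hρ2 : ∀ k ≤ m + 2, ∀ α β, ‖ρ k α β‖ ≤ 2 := fun k hk α β =>
    (hE.density_le k hk α β).trans one_le_two
  have hT : ∀ k, ∀ i α β, ‖tensorOf d D (pts (z k)) i α β‖ ≤ 2 := fun k =>
    norm_tensorOf_le (hpts.abs_le _ (hz k))
  have hR : ∀ k, ∀ α β, ‖densityOf d D (pts (z k)) α β‖ ≤ 2 := fun k =>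
    norm_densityOf_le (hpts.abs_le _ (hz k))
  have hbase : δ ≤ d * D ^ 3 * δ := by
    have : (1 : ℝ) ≤ d * D ^ 3 := one_le_mul_of_one_le_of_one_le hd1 (one_le_pow₀ hD1)
    nlinarith
  refine ⟨z, ⟨fun k _ => hz k, fun k hk1 hk => ?_⟩, ?_⟩
  · obtain ⟨l, rfl⟩ : ∃ l, k = l + 1 := ⟨k - 1, by omega⟩
    simp only [Nat.add_sub_cancel]
    have p1 : (if l + 1 = 1 then ‖densityOf d D (pts (z l)) 0 0 - 1‖ ^ 2 else 0) ≤
        4 * (d * D ^ 3 * δ) ^ 2 := by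
      split_ifs with h0
      · obtain rfl : l = 0 := by omega
        have := (hzc 0 (by omega)).2 0 0
        rw [Matrix.sub_apply, hE.init] at this
        calc _ ≤ (2 * δ) ^ 2 := by gcongr
          _ = 4 * δ ^ 2 := by ring
          _ ≤ _ := by gcongr
      · positivity
    have p2 : (if l + 1 = m + 2 + 1 then ∑ α, ∑ β, ‖(densityOf d D (pts (z l)) - vac D) α β‖ ^ 2
        else 0) ≤ 4 * (d * D ^ 3 * δ) ^ 2 := by
      split_ifs with h0
      · obtain rfl : l = m + 2 := by omega
        have := (hzc (m + 2) (by omega)).2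
        rw [hE.final] at this
        have hDD : (D : ℝ) ≤ d * D ^ 3 := by
          calc (D : ℝ) = 1 * D ^ 1 := by ring
            _ ≤ _ := by gcongr; norm_num
        calc _ ≤ D ^ 2 * (2 * δ) ^ 2 := sum_sq_le this
          _ = 4 * (D * δ) ^ 2 := by ring
          _ ≤ _ := by gcongr
      · positivity
    have p3 : (if l + 1 ≤ m + 2 then
        ∑ β, ∑ β', ‖(xfer (tensorOf d D (pts (z (l + 1)))) 1 - 1) β β'‖ ^ 2 else 0) ≤
        64 * (d * D ^ 3 * δ) ^ 2 := by
      split_ifs with h0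
      · have h1 := norm_xfer_one_sub_le (hT (l + 1)) (hA2 l (by omega)) (hzc (l + 1) h0).1
        rw [hE.iso l (by omega)] at h1
        calc _ ≤ D ^ 2 * (8 * d * D * δ) ^ 2 := sum_sq_le h1
          _ = 64 * (d * D ^ 2 * δ) ^ 2 := by ring
          _ ≤ _ := by gcongr; norm_num
      · positivity
    have p4 : (if l + 1 ≤ m + 2 then ∑ α, ∑ α', ‖(densityOf d D (pts (z l)) -
        dual (tensorOf d D (pts (z (l + 1)))) (densityOf d D (pts (z (l + 1))))) α α'‖ ^ 2
        else 0) ≤ 676 * (d * D ^ 3 * δ) ^ 2 := by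
      split_ifs with h0
      · have h1 : ∀ α α', ‖(densityOf d D (pts (z l)) - dual (tensorOf d D (pts (z (l + 1))))
            (densityOf d D (pts (z (l + 1))))) α α'‖ ≤ 26 * (d * D ^ 2 * δ) := by
          intro α α'
          have e1 := (hzc l (by omega)).2 α α'
          have e2 := norm_dual_sub_le (hT (l + 1)) (hA2 l (by omega)) (hzc (l + 1) h0).1
            (hR (l + 1)) (hρ2 (l + 1) h0) (hzc (l + 1) h0).2 α α'
          rw [← hE.compat l (by omega)] at e2
          rw [Matrix.sub_apply] at e1 e2 ⊢
          have e3 : δ ≤ d * D ^ 2 * δ := by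
            have : (1 : ℝ) ≤ d * D ^ 2 :=
              one_le_mul_of_one_le_of_one_le hd1 (one_le_pow₀ hD1)
            nlinarith
          calc _ ≤ _ := norm_sub_le_norm_sub_add_norm_sub _ (ρ l α α') _
            _ ≤ 2 * δ + 24 * d * D ^ 2 * δ := add_le_add e1 (by rw [norm_sub_rev]; exact e2)
            _ ≤ _ := by linarith
        calc _ ≤ D ^ 2 * (26 * (d * D ^ 2 * δ)) ^ 2 := sum_sq_le h1
          _ = 676 * (d * D ^ 3 * δ) ^ 2 := by ring
      · positivity
    -- The four bounds add up to `4 + 4 + 64 + 676 = 748 ≤ 28 ^ 2`.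
    calc penalty d D (m + 2) (l + 1) (pts (z l)) (pts (z (l + 1)))
        ≤ (28 * d * D ^ 3 * δ) ^ 2 := by
          rw [penalty]
          nlinarith
      _ ≤ _ := by gcongr
  · rw [pathCost_eq]
    have h1 : ∀ j : Fin (m + 1), weight (h j) (tensorOf d D (pts (z (j + 1))))
        (tensorOf d D (pts (z (j + 2)))) (densityOf d D (pts (z (j + 2)))) ≤
        weight (h j) (A j) (A (j + 1)) (ρ (j + 2)) + 160 * d ^ 4 * D ^ 6 * J * δ := by
      intro j
      have := (abs_le.1 (abs_weight_sub_weight_le hJ (hh j (by omega)) hδ0 (NeZero.pos D)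
        (hT (j + 1)) (hA2 j (by omega)) (hzc (j + 1) (by omega)).1 (hT (j + 2))
        (hA2 (j + 1) (by omega)) (hzc (j + 2) (by omega)).1 (hR (j + 2))
        (hzc (j + 2) (by omega)).2)).2
      linarith
    refine (sum_le_sum fun j _ => h1 j).trans (le_of_eq ?_)
    rw [sum_add_distrib]
    simp

/-- A path of least cost yields a state whose energy is almost minimal. -/
theorem Path.energy_le {m M S : ℕ} {η ε : ℝ} {pts : ℕ → ℕ → ℝ} {y : ℕ → ℕ} (hd : 0 < d)
    (hM : 0 < M) (hpts : Net (coords d D) M S pts) (hε : 0 < ε)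
    (hη : η * (80 * d ^ 4 * D ^ 7) = ε) (hMη : 28 * d * D ^ 3 * (1 / M : ℝ) ≤ η)
    (H : NNHamiltonian m d) (h : ℕ → Matrix (Fin d × Fin d) (Fin d × Fin d) ℂ)
    (hh : ∀ j : Fin (m + 1), h j = H.term j)
    (hy : Path d D (m + 2) S η pts y)
    (hopt : ∀ z, Path d D (m + 2) S η pts z → pathCost (m + 2) h D pts y ≤ pathCost (m + 2) h D pts z)
    (hn : ((m + 2 : ℕ) : ℝ) * D ^ 2 * ε < 1) {g : ℝ}
    (hg : g = (env (fun k => tensorOf d D (pts (y (k + 1)))) (vac D) (m + 2) 0 0).re) :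
    0 < g ∧ ∀ J : ℝ, H.TermsBoundedBy J → ∀ ψ : MPS m d D, ψ.Normalized →
      H.energy (state m fun k => tensorOf d D (pts (y (k + 1)))) / g ≤
        H.energy ψ.toState + 2 * J * D ^ 2 * ((m + 2 : ℕ) : ℝ) ^ 2 * ε := by
  set A : ℕ → Tensor d D := fun k => tensorOf d D (pts (y (k + 1))) with hA
  set n : ℝ := ((m + 2 : ℕ) : ℝ) with hndef
  have hn1 : (1 : ℝ) ≤ n := by rw [hndef]; exact_mod_cast (by omega : 1 ≤ m + 2)
  have hnm : ((m : ℝ) + 1) ≤ n := by rw [hndef]; push_cast; linarith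
  have hd1 : (1 : ℝ) ≤ d := by exact_mod_cast hd
  have hD1 : (1 : ℝ) ≤ D := by exact_mod_cast Nat.one_le_iff_ne_zero.2 (NeZero.ne D)
  have hη0 : 0 < η := by
    by_contra hc
    have : 0 ≤ 80 * (d : ℝ) ^ 4 * D ^ 7 := by positivity
    nlinarith
  have hηε : 80 * η ≤ ε := by
    have : (1 : ℝ) ≤ d ^ 4 * D ^ 7 :=
      one_le_mul_of_one_le_of_one_le (one_le_pow₀ hd1) (one_le_pow₀ hD1)
    nlinarith
  have hnη : 80 * (n * D ^ 2 * η) < 1 := by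
    have : n * D ^ 2 * (80 * η) ≤ n * D ^ 2 * ε := by gcongr
    linarith
  have hsmall : 2 * ((m + 2 : ℕ) : ℝ) * (D * η) ≤ 1 := by
    have : n * (D * η) ≤ n * (D ^ 2 * η) := by gcongr; nlinarith
    rw [← hndef]; nlinarith
  have hap : Approx (m + 2) A (fun k => densityOf d D (pts (y k))) η :=
    hy.approx hη0.le (by omega) hpts
  have hnorm := hap.abs_norm_sub_one_le (by omega) hsmall
  rw [← hg, ← hndef] at hnorm
  have hnorm' := abs_le.1 hnorm
  -- Here `5nD²η < 5 / 80`, so the squared norm differs from `1` by less than `1 / 16`.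
  have hg0 : 0 < g := by nlinarith
  refine ⟨hg0, fun J hJ ψ hψ => ?_⟩
  have hJ0 : 0 ≤ J := (norm_nonneg _).trans (hJ 0)
  obtain ⟨B, ρ, hE, hEψ⟩ := exists_exact hd H hJ ψ hψ
  obtain ⟨z, hz, hzc⟩ := hE.exists_path hd hM hpts hMη hJ0 h (fun j hj p q => by
    have := hh ⟨j, by omega⟩
    simp only at this
    rw [this]
    exact (formBound_of_termsBoundedBy hJ _).apply p q)
  have hyz := hopt z hz
  simp only [hh] at hzc
  rw [← hEψ] at hzc
  -- The grid was made fine enough for the constraints, which leaves ample room: `2240 = 28 * 80`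
  -- exceeds the `160` needed here.
  have hMε : 160 * (d : ℝ) ^ 4 * D ^ 6 * J * (1 / M : ℝ) ≤ J * ε := by
    have hM0 : (0 : ℝ) ≤ 1 / M := by positivity
    have h1 : 2240 * ((d : ℝ) ^ 5 * D ^ 10 * (1 / M : ℝ)) ≤ ε := by
      calc _ = (28 * d * D ^ 3 * (1 / M : ℝ)) * (80 * d ^ 4 * D ^ 7) := by ring
        _ ≤ η * (80 * d ^ 4 * D ^ 7) := by gcongr
        _ = ε := hη
    have h2 : (d : ℝ) ^ 4 * D ^ 6 * (1 / M : ℝ) ≤ d ^ 5 * D ^ 10 * (1 / M : ℝ) := by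
      gcongr <;> norm_num [hd1, hD1]
    calc _ = J * (160 * ((d : ℝ) ^ 4 * D ^ 6 * (1 / M : ℝ))) := by ring
      _ ≤ _ := by
        refine mul_le_mul_of_nonneg_left ?_ hJ0
        have : 0 ≤ (d : ℝ) ^ 4 * D ^ 6 * (1 / M : ℝ) := by positivity
        linarith
  have hEA : H.energy (state m A) ≤ pathCost (m + 2) h D pts y +
      (m + 1) * (75 * n * d ^ 4 * D ^ 7 * η * J) := by
    rw [energy_state, pathCost_eq]
    have h1 : ∀ j : Fin (m + 1), (ener A (H.term j) j (vac D) (m - j) 0 0).re ≤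
        weight (h j) (tensorOf d D (pts (y (j + 1)))) (tensorOf d D (pts (y (j + 2))))
          (densityOf d D (pts (y (j + 2)))) + 75 * n * d ^ 4 * D ^ 7 * η * J := by
      intro j
      have := (abs_le.1 (hap.abs_weight_sub_le hsmall hd (formBound_of_termsBoundedBy hJ j)
        (show (j : ℕ) + 2 + (m - j) = m + 2 by omega))).1
      rw [hh]
      simp only [hA, ← hndef] at this ⊢
      linarith
    refine (sum_le_sum fun j _ => h1 j).trans (le_of_eq ?_)
    rw [sum_add_distrib]
    simp
  have hself : |H.energy (state m A)| ≤ (m + 1) * (J * g) := by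
    rw [hg]; exact abs_energy_state_le hJ A
  -- The normalized energy is at most `nJ` in absolute value, so dividing by `g` changes the energy
  -- by at most `nJ` times `|1 - g|`.
  have hdiv : H.energy (state m A) / g ≤ H.energy (state m A) + n * J * (5 * n * D ^ 2 * η) := by
    have e : H.energy (state m A) / g =
        H.energy (state m A) + (H.energy (state m A) / g) * (1 - g) := by
      field_simp; ring
    have h1 : |H.energy (state m A) / g| ≤ n * J := by
      rw [abs_div, abs_of_pos hg0, div_le_iff₀ hg0]
      refine hself.trans ?_
      rw [← mul_assoc]
      gcongr
    have h2 : (H.energy (state m A) / g) * (1 - g) ≤ n * J * (5 * n * D ^ 2 * η) := by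
      refine (le_abs_self _).trans ?_
      rw [abs_mul]
      refine mul_le_mul h1 (by rw [abs_sub_comm]; exact hnorm) (abs_nonneg _) (by positivity)
    linarith
  -- The prediction error (75 parts) and the normalization error (5 parts) together give `n²Jε`;
  -- rounding the competitor adds at most `nJε`.
  have hsum1 : (m + 1) * (75 * n * d ^ 4 * D ^ 7 * η * J) ≤ 75 * (n ^ 2 * J * (η * (d ^ 4 * D ^ 7))) := by
    calc _ ≤ n * (75 * n * d ^ 4 * D ^ 7 * η * J) := by gcongr
      _ = _ := by ring
  have hsum2 : n * J * (5 * n * D ^ 2 * η) ≤ 5 * (n ^ 2 * J * (η * (d ^ 4 * D ^ 7))) := by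
    calc n * J * (5 * n * D ^ 2 * η) = 5 * (n ^ 2 * J * (η * (1 * D ^ 2))) := by ring
      _ ≤ _ := by
        gcongr
        · exact one_le_pow₀ hd1
        · norm_num
  have hsum3 : ((m : ℝ) + 1) * (160 * d ^ 4 * D ^ 6 * J * (1 / M : ℝ)) ≤ n * (J * ε) := by gcongr
  have hfin : n * (J * ε) + n ^ 2 * J * ε ≤ 2 * J * D ^ 2 * n ^ 2 * ε := by
    have h1 : n * (J * ε) ≤ n ^ 2 * (J * ε) := by gcongr; nlinarith
    have h2 : n ^ 2 * (J * ε) * 1 ≤ n ^ 2 * (J * ε) * D ^ 2 := by gcongr; exact one_le_pow₀ hD1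
    linarith
  have hηsum : 80 * (n ^ 2 * J * (η * (d ^ 4 * D ^ 7))) = n ^ 2 * J * ε := by
    rw [← hη]; ring
  linarith

end Transfer

/-! ### Notation for program expressions -/

namespace RealRAM

instance : Add NExp := ⟨.add⟩
instance : Sub NExp := ⟨.sub⟩
instance : Mul NExp := ⟨.mul⟩
instance : Mul CExp := ⟨CExp.mul⟩
instance : Sub CExp := ⟨CExp.sub⟩

/-- A constant. -/
abbrev nc (k : ℕ) : NExp := .const k
/-- A register. -/
abbrev nv (x : ℕ) : NExp := .var x

section
variable (s : State) (e f : NExp) (z w : CExp)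
@[simp] lemma eval_add : (e + f).eval s = e.eval s + f.eval s := rfl
@[simp] lemma eval_sub : (e - f).eval s = e.eval s - f.eval s := rfl
@[simp] lemma eval_mul : (e * f).eval s = e.eval s * f.eval s := rfl
@[simp] lemma eval_const (k : ℕ) : (NExp.const k).eval s = k := rfl
@[simp] lemma eval_var (x : ℕ) : (NExp.var x).eval s = s.nvar x := rfl
@[simp] lemma eval_get (a : ℕ) : (NExp.get a e).eval s = s.narr a (e.eval s) := rfl
@[simp] lemma cost_add : (e + f).cost = e.cost + f.cost + 1 := rfl
@[simp] lemma cost_sub : (e - f).cost = e.cost + f.cost + 1 := rfl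
@[simp] lemma cost_mul : (e * f).cost = e.cost + f.cost + 1 := rfl
@[simp] lemma cost_const (k : ℕ) : (NExp.const k).cost = 1 := rfl
@[simp] lemma cost_var (x : ℕ) : (NExp.var x).cost = 1 := rfl
@[simp] lemma cost_get (a : ℕ) : (NExp.get a e).cost = e.cost + 1 := rfl
lemma ev_hmul : (z * w).ev s = z.ev s * w.ev s := CExp.ev_mul s z w
lemma ev_hsub : (z - w).ev s = z.ev s - w.ev s := CExp.ev_sub s z w
end

end RealRAM

/-! ## The algorithm -/

namespace MPSAlgorithm

open RealRAM Transfer Finset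

/-- Entry of the tensor of a net point. -/
def tensorE (p i α β : NExp) : CExp :=
  .get₂ 9 (p * nv 5 + ((i * nv 2 + α) * nv 2 + β)) (p * nv 5 + (nv 7 + ((i * nv 2 + α) * nv 2 + β)))

/-- Entry of the density matrix of a net point. -/
def densityE (p α β : NExp) : CExp :=
  .get₂ 9 (p * nv 5 + (nc 2 * nv 7 + (α * nv 2 + β)))
    (p * nv 5 + (nc 2 * nv 7 + nv 2 * nv 2 + (α * nv 2 + β)))

/-- Entry of the local terms of the Hamiltonian. -/
def termE (j i i' k k' : NExp) : CExp :=
  .get 0 1 ((((j * nv 1 + i) * nv 1 + i') * nv 1 + k) * nv 1 + k')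

/-- Entry of a tensor with given coordinates, with natural numbers as indices. -/
def tensorN (d D : ℕ) (v : ℕ → ℝ) (i α β : ℕ) : ℂ :=
  ⟨v ((i * D + α) * D + β), v (d * D * D + ((i * D + α) * D + β))⟩

/-- Entry of a matrix with given coordinates, with natural numbers as indices. -/
def densityN (d D : ℕ) (v : ℕ → ℝ) (α β : ℕ) : ℂ :=
  ⟨v (2 * (d * D * D) + (α * D + β)), v (2 * (d * D * D) + D * D + (α * D + β))⟩

/-- Entry of a local term, with natural numbers as indices. -/
def termN (d : ℕ) (r₀ r₁ : ℕ → ℝ) (j i i' k k' : ℕ) : ℂ :=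
  ⟨r₀ ((((j * d + i) * d + i') * d + k) * d + k'), r₁ ((((j * d + i) * d + i') * d + k) * d + k')⟩

/-- The local terms stored in two arrays. -/
noncomputable def termOf (d : ℕ) (r₀ r₁ : ℕ → ℝ) (j : ℕ) : Matrix (Fin d × Fin d) (Fin d × Fin d) ℂ :=
  Matrix.of fun p q => termN d r₀ r₁ j p.1 p.2 q.1 q.2

/-- The coordinates of the points of the net. -/
def points (P : ℕ) (net : ℕ → ℝ) (x q : ℕ) : ℝ := net (x * P + q)

/-- The memory holds the parameters, the Hamiltonian and the net. -/
structure Ready (n d D P S : ℕ) (net r₀ r₁ : ℕ → ℝ) (s : State) : Prop where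
  n_eq : s.nvar 0 = n
  d_eq : s.nvar 1 = d
  D_eq : s.nvar 2 = D
  P_eq : s.nvar 5 = P
  S_eq : s.nvar 6 = S
  T_eq : s.nvar 7 = d * D * D
  net_eq : s.rarr 9 = net
  re_eq : s.rarr 0 = r₀
  im_eq : s.rarr 1 = r₁

/-- Loops for the boundary constraints. -/
def boundaryLoops : List (ℕ × NExp) :=
  -- Truncated subtraction as a case distinction: with `k` in register 10, the bound is `1` for `k =
  -- 1`, `D` for `k = n + 1`, and `0` in between. So the same summand serves the initial and the
  -- final condition.
  [(20, (nc 1 - (nv 10 - nc 1)) + (nc 1 - (nv 0 + nc 1 - nv 10)) * nv 2),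
   (21, (nc 1 - (nv 10 - nc 1)) + (nc 1 - (nv 0 + nc 1 - nv 10)) * nv 2)]

/-- Deviation of the density matrix from the vacuum. -/
def boundaryE : CExp := densityE (nv 12) (nv 20) (nv 21) -
  .ofNat ((nc 1 - nv 20) * (nc 1 - nv 21))

/-- Guard for the layers below `n + 1`. -/
def innerGuard : NExp := nc 1 - (nv 10 - nv 0)

/-- Loops for the isometry constraint. -/
def isometryLoops : List (ℕ × NExp) :=
  -- The loop over register 29 runs once or never and acts as a conditional. Registers 22, 23 and
  -- 24, 25 are two copies of the summation indices, since the square of a modulus is accumulated as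
  -- a sum over pairs.
  [(29, innerGuard), (20, nv 2), (21, nv 2), (22, nv 1), (23, nv 2), (24, nv 1), (25, nv 2)]

/-- Summand of the deviation from an isometry. -/
def isometryE (i α : NExp) : CExp :=
  -- The entry of the identity matrix has to be subtracted only once, in the summand `i = α = 0`;
  -- the last truncated difference is the Kronecker delta of the two bond indices.
  (tensorE (nv 11) i α (nv 20)).conj * tensorE (nv 11) i α (nv 21) -
    .ofNat ((nc 1 - i) * (nc 1 - α) * (nc 1 - ((nv 20 - nv 21) + (nv 21 - nv 20))))

/-- Loops for the consistency constraint. -/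
def consistencyLoops : List (ℕ × NExp) :=
  [(29, innerGuard), (20, nv 2), (21, nv 2), (22, nv 1), (23, nv 2), (24, nv 2), (25, nv 1),
   (26, nv 2), (27, nv 2)]

/-- Summand of the deviation of the density matrices from being consistent. -/
def consistencyE (i γ γ' : NExp) : CExp :=
  densityE (nv 12) (nv 20) (nv 21) * .ofNat ((nc 1 - i) * (nc 1 - γ) * (nc 1 - γ')) -
    tensorE (nv 11) i (nv 20) γ * densityE (nv 11) γ γ' * (tensorE (nv 11) i (nv 21) γ').conj

/-- Loops for the energy of a bond. -/
def energyLoops : List (ℕ × NExp) :=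
  [(29, (nc 1 - (nc 2 - nv 10)) * innerGuard), (20, nv 1), (21, nv 1), (22, nv 1), (23, nv 1),
   (24, nv 2), (25, nv 2), (26, nv 2), (27, nv 2), (28, nv 2)]

/-- Summand of the energy of a bond. -/
def energyE : CExp :=
  densityE (nv 11) (nv 24) (nv 25) * termE (nv 10 - nc 2) (nv 20) (nv 21) (nv 22) (nv 23) *
    (tensorE (nv 12) (nv 20) (nv 26) (nv 27) * tensorE (nv 11) (nv 21) (nv 27) (nv 25)).conj *
    (tensorE (nv 12) (nv 22) (nv 26) (nv 28) * tensorE (nv 11) (nv 23) (nv 28) (nv 24))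

/-! ### Values of the nested loops as finite sums -/

section Values

variable {n d D P S k x y : ℕ} {net r₀ r₁ : ℕ → ℝ} {s : State}

lemma ev_tensorE (hs : Ready n d D P S net r₀ r₁ s) (p i α β : NExp) :
    (tensorE p i α β).ev s =
      tensorN d D (points P net (p.eval s)) (i.eval s) (α.eval s) (β.eval s) := by
  simp only [tensorE, CExp.ev_get₂, eval_add, eval_mul, eval_var, hs.P_eq, hs.D_eq, hs.T_eq,
    hs.net_eq, tensorN, points]

lemma ev_densityE (hs : Ready n d D P S net r₀ r₁ s) (p α β : NExp) :
    (densityE p α β).ev s = densityN d D (points P net (p.eval s)) (α.eval s) (β.eval s) := by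
  simp only [densityE, CExp.ev_get₂, eval_add, eval_mul, eval_var, eval_const, hs.P_eq, hs.D_eq,
    hs.T_eq, hs.net_eq, densityN, points]

lemma ev_termE (hs : Ready n d D P S net r₀ r₁ s) (j i i' k k' : NExp) :
    (termE j i i' k k').ev s =
      termN d r₀ r₁ (j.eval s) (i.eval s) (i'.eval s) (k.eval s) (k'.eval s) := by
  simp only [termE, CExp.ev_get, eval_add, eval_mul, eval_var, hs.d_eq, hs.re_eq, hs.im_eq, termN]

lemma Ready.setN (hs : Ready n d D P S net r₀ r₁ s) {x : ℕ} (hx : 8 ≤ x) (v : ℕ) :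
    Ready n d D P S net r₀ r₁ (s.setN x v) := by
  have h : ∀ z, z ≤ 7 → (s.setN x v).nvar z = s.nvar z := fun z hz => by
    rw [State.setN_nvar, if_neg (by omega)]
  exact ⟨(h 0 (by omega)).trans hs.n_eq, (h 1 (by omega)).trans hs.d_eq,
    (h 2 (by omega)).trans hs.D_eq, (h 5 (by omega)).trans hs.P_eq, (h 6 (by omega)).trans hs.S_eq,
    (h 7 (by omega)).trans hs.T_eq, hs.net_eq, hs.re_eq, hs.im_eq⟩

lemma sumVal_boundary (hs : Ready n d D P S net r₀ r₁ s) (hk : s.nvar 10 = k) (hx : s.nvar 12 = x) :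
    sumVal s boundaryLoops (boundaryE * boundaryE.conj).re =
      ∑ α ∈ range ((1 - (k - 1)) + (1 - (n + 1 - k)) * D),
        ∑ β ∈ range ((1 - (k - 1)) + (1 - (n + 1 - k)) * D),
          ‖densityN d D (points P net x) α β - (((1 - α) * (1 - β) : ℕ) : ℂ)‖ ^ 2 := by
  simp only [boundaryLoops, sumVal, eval_add, eval_sub, eval_mul, eval_const, eval_var, hk, hs.n_eq,
    hs.D_eq, State.setN_nvar]
  norm_num only [if_false, hk, hs.n_eq, hs.D_eq]
  refine sum_congr rfl fun α _ => sum_congr rfl fun β _ => ?_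
  have hs' := (hs.setN (x := 20) (by norm_num) α).setN (x := 21) (by norm_num) β
  rw [CExp.eval_re, ev_hmul, CExp.ev_conj, Complex.star_def, Complex.mul_conj, Complex.ofReal_re,
    Complex.normSq_eq_norm_sq, boundaryE, ev_hsub, ev_densityE hs', CExp.ev_ofNat]
  simp [hx]

lemma sumVal_isometry (hs : Ready n d D P S net r₀ r₁ s) (hk : s.nvar 10 = k) (hy : s.nvar 11 = y) :
    sumVal s isometryLoops (isometryE (nv 22) (nv 23) * (isometryE (nv 24) (nv 25)).conj).re =
      ∑ _z ∈ range (1 - (k - n)), ∑ β ∈ range D, ∑ β' ∈ range D,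
        ∑ i ∈ range d, ∑ α ∈ range D, ∑ i' ∈ range d, ∑ α' ∈ range D,
          ((star (tensorN d D (points P net y) i α β) * tensorN d D (points P net y) i α β' -
            (((1 - i) * (1 - α) * (1 - ((β - β') + (β' - β))) : ℕ) : ℂ)) *
          star (star (tensorN d D (points P net y) i' α' β) * tensorN d D (points P net y) i' α' β' -
            (((1 - i') * (1 - α') * (1 - ((β - β') + (β' - β))) : ℕ) : ℂ))).re := by
  simp only [isometryLoops, innerGuard, sumVal]
  refine sum_congr ?_ fun z _ => sum_congr ?_ fun β _ => sum_congr ?_ fun β' _ =>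
    sum_congr ?_ fun i _ => sum_congr ?_ fun α _ => sum_congr ?_ fun i' _ =>
    sum_congr ?_ fun α' _ => ?_
  · simp [hk, hs.n_eq]
  iterate 6 simp [hs.d_eq, hs.D_eq]
  have hs' := ((((((hs.setN (x := 29) (by norm_num) z).setN (x := 20) (by norm_num) β).setN
    (x := 21) (by norm_num) β').setN (x := 22) (by norm_num) i).setN (x := 23) (by norm_num) α).setN
    (x := 24) (by norm_num) i').setN (x := 25) (by norm_num) α'
  simp only [CExp.eval_re, ev_hmul, ev_hsub, CExp.ev_conj, isometryE, ev_tensorE hs', CExp.ev_ofNat]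
  simp [hy]

lemma sumVal_consistency (hs : Ready n d D P S net r₀ r₁ s) (hk : s.nvar 10 = k)
    (hx : s.nvar 12 = x) (hy : s.nvar 11 = y) :
    sumVal s consistencyLoops (consistencyE (nv 22) (nv 23) (nv 24) *
      (consistencyE (nv 25) (nv 26) (nv 27)).conj).re =
      ∑ _z ∈ range (1 - (k - n)), ∑ α ∈ range D, ∑ α' ∈ range D,
        ∑ i ∈ range d, ∑ γ ∈ range D, ∑ γ' ∈ range D, ∑ j ∈ range d, ∑ δ ∈ range D, ∑ δ' ∈ range D,
          ((densityN d D (points P net x) α α' * (((1 - i) * (1 - γ) * (1 - γ') : ℕ) : ℂ) -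
            tensorN d D (points P net y) i α γ * densityN d D (points P net y) γ γ' *
              star (tensorN d D (points P net y) i α' γ')) *
          star (densityN d D (points P net x) α α' * (((1 - j) * (1 - δ) * (1 - δ') : ℕ) : ℂ) -
            tensorN d D (points P net y) j α δ * densityN d D (points P net y) δ δ' *
              star (tensorN d D (points P net y) j α' δ'))).re := by
  simp only [consistencyLoops, innerGuard, sumVal]
  refine sum_congr ?_ fun z _ => sum_congr ?_ fun β _ => sum_congr ?_ fun β' _ =>
    sum_congr ?_ fun i _ => sum_congr ?_ fun α _ => sum_congr ?_ fun α' _ =>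
    sum_congr ?_ fun j _ => sum_congr ?_ fun δ _ => sum_congr ?_ fun δ' _ => ?_
  · simp [hk, hs.n_eq]
  iterate 8 simp [hs.d_eq, hs.D_eq]
  have hs' := ((((((((hs.setN (x := 29) (by norm_num) z).setN (x := 20) (by norm_num) β).setN
    (x := 21) (by norm_num) β').setN (x := 22) (by norm_num) i).setN (x := 23) (by norm_num) α).setN
    (x := 24) (by norm_num) α').setN (x := 25) (by norm_num) j).setN (x := 26) (by norm_num) δ).setN
    (x := 27) (by norm_num) δ'
  simp only [CExp.eval_re, ev_hmul, ev_hsub, CExp.ev_conj, consistencyE, ev_tensorE hs',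
    ev_densityE hs', CExp.ev_ofNat]
  simp [hx, hy]

lemma sumVal_energy (hs : Ready n d D P S net r₀ r₁ s) (hk : s.nvar 10 = k)
    (hx : s.nvar 12 = x) (hy : s.nvar 11 = y) :
    sumVal s energyLoops energyE.re =
      ∑ _z ∈ range ((1 - (2 - k)) * (1 - (k - n))), ∑ i ∈ range d, ∑ j ∈ range d, ∑ i' ∈ range d,
        ∑ j' ∈ range d, ∑ γ' ∈ range D, ∑ γ ∈ range D, ∑ α ∈ range D, ∑ β ∈ range D,
        ∑ β' ∈ range D,
          (densityN d D (points P net y) γ' γ * termN d r₀ r₁ (k - 2) i j i' j' *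
            star (tensorN d D (points P net x) i α β * tensorN d D (points P net y) j β γ) *
            (tensorN d D (points P net x) i' α β' * tensorN d D (points P net y) j' β' γ')).re := by
  simp only [energyLoops, innerGuard, sumVal]
  refine sum_congr ?_ fun z _ => sum_congr ?_ fun i _ => sum_congr ?_ fun j _ =>
    sum_congr ?_ fun i' _ => sum_congr ?_ fun j' _ => sum_congr ?_ fun γ' _ =>
    sum_congr ?_ fun γ _ => sum_congr ?_ fun α _ => sum_congr ?_ fun β _ =>
    sum_congr ?_ fun β' _ => ?_
  · simp [hk, hs.n_eq]
  iterate 9 simp [hs.d_eq, hs.D_eq]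
  have hs' := (((((((((hs.setN (x := 29) (by norm_num) z).setN (x := 20) (by norm_num) i).setN
    (x := 21) (by norm_num) j).setN (x := 22) (by norm_num) i').setN (x := 23) (by norm_num) j').setN
    (x := 24) (by norm_num) γ').setN (x := 25) (by norm_num) γ).setN (x := 26) (by norm_num) α).setN
    (x := 27) (by norm_num) β).setN (x := 28) (by norm_num) β'
  simp only [CExp.eval_re, ev_hmul, CExp.ev_conj, energyE, ev_tensorE hs',
    ev_densityE hs', ev_termE hs']
  simp [hx, hy, hk]

end Values

end MPSAlgorithm

/-! ### Identification of these sums with the penalty and the energy -/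

namespace MPSAlgorithm

open RealRAM Transfer Finset

section Sums

lemma sum_guard (k n : ℕ) (f : ℝ) : ∑ _z ∈ range (1 - (k - n)), f = if k ≤ n then f else 0 := by
  split_ifs with h
  · simp [Nat.sub_eq_zero_of_le h]
  · simp [show 1 - (k - n) = 0 by omega]

lemma sum_one_sub {d : ℕ} (hd : 0 < d) (f : ℕ → ℂ) :
    ∑ i ∈ range d, ((1 - i : ℕ) : ℂ) * f i = f 0 := by
  rw [Finset.sum_eq_single 0 (fun i _ hi => by simp [show 1 - i = 0 by omega])
    (fun h => absurd (mem_range.2 hd) h)]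
  simp

lemma re_mul_star (z : ℂ) : (z * star z).re = ‖z‖ ^ 2 := by
  rw [Complex.star_def, Complex.mul_conj, Complex.ofReal_re, Complex.normSq_eq_norm_sq]

/-- Expanding the square of a modulus lets one accumulator compute it; the inner complex sum is
never stored. -/
lemma sum_re_mul_star {ι : Type*} (s : Finset ι) (f : ι → ℂ) :
    ∑ i ∈ s, ∑ j ∈ s, (f i * star (f j)).re = ‖∑ i ∈ s, f i‖ ^ 2 := by
  rw [← re_mul_star, star_sum, Finset.sum_mul_sum, Complex.re_sum]
  simp only [Complex.re_sum]

lemma sum_re_mul_star₂ (s t : Finset ℕ) (f : ℕ → ℕ → ℂ) :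
    ∑ i ∈ s, ∑ α ∈ t, ∑ i' ∈ s, ∑ α' ∈ t, (f i α * star (f i' α')).re =
      ‖∑ i ∈ s, ∑ α ∈ t, f i α‖ ^ 2 := by
  have h : ∀ g : ℕ → ℕ → ℝ, ∑ i ∈ s, ∑ α ∈ t, g i α = ∑ p ∈ s ×ˢ t, g p.1 p.2 := fun g => by
    rw [Finset.sum_product]
  have h' : ∀ g : ℕ → ℕ → ℂ, ∑ i ∈ s, ∑ α ∈ t, g i α = ∑ p ∈ s ×ˢ t, g p.1 p.2 := fun g => by
    rw [Finset.sum_product]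
  rw [h', ← sum_re_mul_star, h]
  exact sum_congr rfl fun _ _ => h _

lemma sum_re_mul_star₃ (s t u : Finset ℕ) (f : ℕ → ℕ → ℕ → ℂ) :
    ∑ i ∈ s, ∑ α ∈ t, ∑ β ∈ u, ∑ i' ∈ s, ∑ α' ∈ t, ∑ β' ∈ u, (f i α β * star (f i' α' β')).re =
      ‖∑ i ∈ s, ∑ α ∈ t, ∑ β ∈ u, f i α β‖ ^ 2 := by
  have h : ∀ g : ℕ → ℕ → ℕ → ℝ, ∑ i ∈ s, ∑ α ∈ t, ∑ β ∈ u, g i α β =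
      ∑ p ∈ s ×ˢ t ×ˢ u, g p.1 p.2.1 p.2.2 := fun g => by
    rw [Finset.sum_product]; exact sum_congr rfl fun _ _ => by rw [Finset.sum_product]
  have h' : ∀ g : ℕ → ℕ → ℕ → ℂ, ∑ i ∈ s, ∑ α ∈ t, ∑ β ∈ u, g i α β =
      ∑ p ∈ s ×ˢ t ×ˢ u, g p.1 p.2.1 p.2.2 := fun g => by
    rw [Finset.sum_product]; exact sum_congr rfl fun _ _ => by rw [Finset.sum_product]
  rw [h', ← sum_re_mul_star, h]
  exact sum_congr rfl fun _ _ => h _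

variable {n d D k : ℕ} {v w : ℕ → ℝ}

lemma tensorOf_apply (i : Fin d) (α β : Fin D) : tensorOf d D v i α β = tensorN d D v i α β := rfl
lemma densityOf_apply (α β : Fin D) : densityOf d D v α β = densityN d D v α β := rfl

lemma boundary_eq [NeZero D] (hk : 1 ≤ k) (hkn : k ≤ n + 1) (hn : 1 ≤ n) :
    ∑ α ∈ range ((1 - (k - 1)) + (1 - (n + 1 - k)) * D),
        ∑ β ∈ range ((1 - (k - 1)) + (1 - (n + 1 - k)) * D),
          ‖densityN d D v α β - (((1 - α) * (1 - β) : ℕ) : ℂ)‖ ^ 2 =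
      (if k = 1 then ‖densityOf d D v 0 0 - 1‖ ^ 2 else 0) +
      (if k = n + 1 then ∑ α, ∑ β, ‖(densityOf d D v - vac D) α β‖ ^ 2 else 0) := by
  by_cases h1 : k = 1
  · subst h1
    have h2 : 1 ≠ n + 1 := by omega
    rw [if_pos rfl, if_neg h2, show (1 - (1 - 1)) + (1 - (n + 1 - 1)) * D = 1 by
      rw [show 1 - (n + 1 - 1) = 0 by omega]; simp]
    simp [densityOf_apply]
  · rw [if_neg h1, show 1 - (k - 1) = 0 by omega]
    by_cases h2 : k = n + 1
    · subst h2
      rw [if_pos rfl, show 0 + (1 - (n + 1 - (n + 1))) * D = D by simp]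
      rw [Finset.sum_range]
      simp only [Finset.sum_range, zero_add]
      refine sum_congr rfl fun α _ => sum_congr rfl fun β _ => ?_
      rw [Matrix.sub_apply, densityOf_apply, vac_apply]
      congr 3
      by_cases hα : α = 0 <;> by_cases hβ : β = 0
      · simp [hα, hβ]
      · have : (β : ℕ) ≠ 0 := Fin.val_eq_zero_iff.not.2 hβ
        simp [hβ, show 1 - (β : ℕ) = 0 by omega]
      · have : (α : ℕ) ≠ 0 := Fin.val_eq_zero_iff.not.2 hα
        simp [hα, show 1 - (α : ℕ) = 0 by omega]
      · have : (β : ℕ) ≠ 0 := Fin.val_eq_zero_iff.not.2 hβ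
        simp [hβ, show 1 - (β : ℕ) = 0 by omega]
    · rw [if_neg h2, show 1 - (n + 1 - k) = 0 by omega]
      simp

lemma isometry_eq (hd : 0 < d) (hD : 0 < D) :
    ∑ _z ∈ range (1 - (k - n)), ∑ β ∈ range D, ∑ β' ∈ range D,
        ∑ i ∈ range d, ∑ α ∈ range D, ∑ i' ∈ range d, ∑ α' ∈ range D,
          ((star (tensorN d D w i α β) * tensorN d D w i α β' -
            (((1 - i) * (1 - α) * (1 - ((β - β') + (β' - β))) : ℕ) : ℂ)) *
          star (star (tensorN d D w i' α' β) * tensorN d D w i' α' β' -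
            (((1 - i') * (1 - α') * (1 - ((β - β') + (β' - β))) : ℕ) : ℂ))).re =
      if k ≤ n then ∑ β, ∑ β', ‖(xfer (tensorOf d D w) 1 - 1) β β'‖ ^ 2 else 0 := by
  rw [sum_guard]
  refine if_congr Iff.rfl ?_ rfl
  rw [Finset.sum_range]
  refine sum_congr rfl fun β _ => ?_
  rw [Finset.sum_range]
  refine sum_congr rfl fun β' _ => ?_
  rw [sum_re_mul_star₂ (range d) (range D) fun i α => star (tensorN d D w i α β) *
    tensorN d D w i α β' - (((1 - i) * (1 - α) * (1 - (((β : ℕ) - β') + (β' - β))) : ℕ) : ℂ)]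
  congr 2
  rw [Matrix.sub_apply, xfer_one_apply]
  simp only [Finset.sum_sub_distrib]
  congr 1
  · rw [Finset.sum_range]
    refine sum_congr rfl fun i _ => ?_
    rw [Finset.sum_range]; rfl
  · simp only [Nat.cast_mul, mul_assoc, ← Finset.mul_sum]
    rw [sum_one_sub hd, sum_one_sub hD, Matrix.one_apply]
    by_cases h : β = β'
    · simp [h]
    · have : (β : ℕ) ≠ β' := fun hc => h (Fin.ext hc)
      rw [if_neg h, show 1 - ((β : ℕ) - β' + (β' - β)) = 0 by omega]; simp

lemma consistency_eq (hd : 0 < d) (hD : 0 < D) :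
    ∑ _z ∈ range (1 - (k - n)), ∑ α ∈ range D, ∑ α' ∈ range D,
        ∑ i ∈ range d, ∑ γ ∈ range D, ∑ γ' ∈ range D, ∑ j ∈ range d, ∑ δ ∈ range D, ∑ δ' ∈ range D,
          ((densityN d D v α α' * (((1 - i) * (1 - γ) * (1 - γ') : ℕ) : ℂ) -
            tensorN d D w i α γ * densityN d D w γ γ' * star (tensorN d D w i α' γ')) *
          star (densityN d D v α α' * (((1 - j) * (1 - δ) * (1 - δ') : ℕ) : ℂ) -
            tensorN d D w j α δ * densityN d D w δ δ' * star (tensorN d D w j α' δ'))).re =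
      if k ≤ n then ∑ α, ∑ α', ‖(densityOf d D v -
        dual (tensorOf d D w) (densityOf d D w)) α α'‖ ^ 2 else 0 := by
  rw [sum_guard]
  refine if_congr Iff.rfl ?_ rfl
  rw [Finset.sum_range]
  refine sum_congr rfl fun α _ => ?_
  rw [Finset.sum_range]
  refine sum_congr rfl fun α' _ => ?_
  rw [sum_re_mul_star₃ (range d) (range D) (range D) fun i γ γ' =>
    densityN d D v α α' * (((1 - i) * (1 - γ) * (1 - γ') : ℕ) : ℂ) -
      tensorN d D w i α γ * densityN d D w γ γ' * star (tensorN d D w i α' γ')]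
  congr 2
  rw [Matrix.sub_apply]
  simp only [Finset.sum_sub_distrib]
  congr 1
  · simp only [Nat.cast_mul, mul_assoc, ← Finset.mul_sum]
    have e := sum_one_sub hD fun _ => 1
    simp only [mul_one] at e
    rw [e, sum_one_sub hD fun _ => 1, sum_one_sub hd fun _ => 1, mul_one]
    rfl
  · simp only [dual, Matrix.sum_apply, Matrix.mul_apply, Matrix.conjTranspose_apply, Finset.sum_mul]
    rw [Finset.sum_range]
    refine sum_congr rfl fun i _ => ?_
    rw [sum_comm, Finset.sum_range]
    refine sum_congr rfl fun γ' _ => ?_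
    rw [Finset.sum_range]
    rfl

lemma xfer2_one_apply (h : Matrix (Fin d × Fin d) (Fin d × Fin d) ℂ) (a b : Tensor d D)
    (γ γ' : Fin D) : xfer2 h a b 1 γ γ' = ∑ i, ∑ j, ∑ i', ∑ j', ∑ α, ∑ β, ∑ β',
      h (i, j) (i', j') * (star (a i α β * b j β γ) * (a i' α β' * b j' β' γ')) := by
  simp only [xfer2, Matrix.mul_one, Matrix.sum_apply, Matrix.smul_apply, smul_eq_mul]
  rw [Fintype.sum_prod_type]
  refine sum_congr rfl fun i _ => sum_congr rfl fun j _ => ?_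
  rw [Fintype.sum_prod_type]
  refine sum_congr rfl fun i' _ => sum_congr rfl fun j' _ => ?_
  rw [Matrix.mul_apply, Finset.mul_sum]
  refine sum_congr rfl fun α _ => ?_
  rw [Matrix.conjTranspose_apply, Matrix.mul_apply, Matrix.mul_apply, star_sum, Finset.sum_mul_sum,
    Finset.mul_sum]
  refine sum_congr rfl fun β _ => ?_
  rw [Finset.mul_sum]

lemma energy_eq [NeZero D] (r₀ r₁ : ℕ → ℝ) :
    ∑ _z ∈ range ((1 - (2 - k)) * (1 - (k - n))), ∑ i ∈ range d, ∑ j ∈ range d, ∑ i' ∈ range d,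
        ∑ j' ∈ range d, ∑ γ' ∈ range D, ∑ γ ∈ range D, ∑ α ∈ range D, ∑ β ∈ range D,
        ∑ β' ∈ range D,
          (densityN d D w γ' γ * termN d r₀ r₁ (k - 2) i j i' j' *
            star (tensorN d D v i α β * tensorN d D w j β γ) *
            (tensorN d D v i' α β' * tensorN d D w j' β' γ')).re =
      stepCost n (termOf d r₀ r₁) D k v w := by
  have e : (1 - (2 - k)) * (1 - (k - n)) = if 2 ≤ k ∧ k ≤ n then 1 else 0 := by
    split_ifs with h
    · rw [show 1 - (2 - k) = 1 by omega, show 1 - (k - n) = 1 by omega]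
    · rcases Nat.lt_or_ge k 2 with h2 | h2
      · rw [show 1 - (2 - k) = 0 by omega, zero_mul]
      · rw [show 1 - (k - n) = 0 by omega, mul_zero]
  rw [e, stepCost]
  split_ifs with h
  swap; · rw [range_zero, sum_empty]
  have hw : weight (termOf d r₀ r₁ (k - 2)) (tensorOf d D v) (tensorOf d D w) (densityOf d D w) =
      ∑ γ' : Fin D, ∑ γ : Fin D, ∑ i : Fin d, ∑ j : Fin d, ∑ i' : Fin d, ∑ j' : Fin d,
        ∑ α : Fin D, ∑ β : Fin D, ∑ β' : Fin D, (densityN d D w γ' γ *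
          (termN d r₀ r₁ (k - 2) i j i' j' * (star (tensorN d D v i α β * tensorN d D w j β γ) *
            (tensorN d D v i' α β' * tensorN d D w j' β' γ')))).re := by
    rw [weight, Matrix.trace, Complex.re_sum]
    refine sum_congr rfl fun γ' _ => ?_
    rw [Matrix.diag_apply, Matrix.mul_apply, Complex.re_sum]
    refine sum_congr rfl fun γ _ => ?_
    rw [xfer2_one_apply]
    simp only [Finset.mul_sum, Complex.re_sum]
    rfl
  rw [Finset.sum_range_one, hw]
  simp only [Finset.sum_range]
  -- The program sums over the site indices outermost, the trace over the bond indices.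
  have h1 : ∀ f : Fin D → Fin D → Fin d → Fin d → Fin d → Fin d → ℝ,
      ∑ i, ∑ j, ∑ i', ∑ j', ∑ γ', ∑ γ, f γ' γ i j i' j' =
      ∑ γ', ∑ γ, ∑ i, ∑ j, ∑ i', ∑ j', f γ' γ i j i' j' := by
    have out : ∀ g : Fin d → Fin d → Fin d → Fin d → Fin D → ℝ,
        ∑ i, ∑ j, ∑ i', ∑ j', ∑ x, g i j i' j' x = ∑ x, ∑ i, ∑ j, ∑ i', ∑ j', g i j i' j' x := by
      intro g
      calc _ = ∑ p : Fin d × Fin d × Fin d × Fin d, ∑ x, g p.1 p.2.1 p.2.2.1 p.2.2.2 x := by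
            simp only [Fintype.sum_prod_type]
        _ = ∑ x, ∑ p : Fin d × Fin d × Fin d × Fin d, g p.1 p.2.1 p.2.2.1 p.2.2.2 x := sum_comm
        _ = _ := by simp only [Fintype.sum_prod_type]
    exact fun f => (out _).trans (sum_congr rfl fun γ' _ => out _)
  refine (h1 _).trans ?_
  refine sum_congr rfl fun γ' _ => sum_congr rfl fun γ _ => sum_congr rfl fun i _ =>
    sum_congr rfl fun j _ => sum_congr rfl fun i' _ => sum_congr rfl fun j' _ =>
    sum_congr rfl fun α _ => sum_congr rfl fun β _ => sum_congr rfl fun β' _ => ?_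
  congr 1
  ring

end Sums

end MPSAlgorithm

/-! ### Evaluation of one step -/

namespace MPSAlgorithm

open RealRAM Transfer Finset

/-- The program does not change the data of `Ready`. -/
def keeps (P : Prog) : Bool :=
  !P.modN 0 && !P.modN 1 && !P.modN 2 && !P.modN 5 && !P.modN 6 && !P.modN 7 && !P.modRA 9 &&
    !P.modRA 0 && !P.modRA 1

lemma Ready.frame {n d D P S : ℕ} {net r₀ r₁ : ℕ → ℝ} {s s' : State} {Q : Prog}
    (h : Ready n d D P S net r₀ r₁ s) (hF : Frame Q s s') (hQ : keeps Q = true) :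
    Ready n d D P S net r₀ r₁ s' := by
  simp only [keeps, Bool.and_eq_true, Bool.not_eq_true'] at hQ
  obtain ⟨⟨⟨⟨⟨⟨⟨⟨h0, h1⟩, h2⟩, h5⟩, h6⟩, h7⟩, h9⟩, ha⟩, hb⟩ := hQ
  exact ⟨(hF.nvar 0 h0).trans h.n_eq, (hF.nvar 1 h1).trans h.d_eq, (hF.nvar 2 h2).trans h.D_eq,
    (hF.nvar 5 h5).trans h.P_eq, (hF.nvar 6 h6).trans h.S_eq, (hF.nvar 7 h7).trans h.T_eq,
    (hF.rarr 9 h9).trans h.net_eq, (hF.rarr 0 ha).trans h.re_eq, (hF.rarr 1 hb).trans h.im_eq⟩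

/-- Compute the penalty and the energy of a step into the real registers `2` and `1`. -/
def weigh : Prog :=
  .seq (.setReal 1 (.ofNat (nc 0))) <| .seq (.setReal 2 (.ofNat (nc 0))) <|
  .seq (sumLoop 2 boundaryLoops (boundaryE * boundaryE.conj).re) <|
  .seq (sumLoop 2 isometryLoops (isometryE (nv 22) (nv 23) * (isometryE (nv 24) (nv 25)).conj).re) <|
  .seq (sumLoop 2 consistencyLoops (consistencyE (nv 22) (nv 23) (nv 24) *
    (consistencyE (nv 25) (nv 26) (nv 27)).conj).re)
  (sumLoop 1 energyLoops energyE.re)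

lemma pow_le_pow_ten {R C e : ℕ} (hR : 1 ≤ R) (he : e ≤ 10) : C * R ^ e ≤ C * R ^ 10 :=
  Nat.mul_le_mul_left _ (Nat.pow_le_pow_right hR he)

/-- Register 10 holds the step, registers 12 and 11 the points of its left and right layers. The
exponent `10` is the nesting depth of the energy loops, and `C` comes from the syntax alone. -/
lemma runs_weigh : ∃ C : ℕ, ∀ {n d D P S k x y R : ℕ} [NeZero D] {net r₀ r₁ : ℕ → ℝ} {s : State},
    Ready n d D P S net r₀ r₁ s → s.nvar 10 = k → s.nvar 12 = x → s.nvar 11 = y →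
    1 ≤ k → k ≤ n + 1 → 1 ≤ n → 0 < d → d + 1 ≤ R → D + 1 ≤ R →
    Runs weigh s (C * R ^ 10) fun s' =>
      s'.rvar 2 = penalty d D n k (points P net x) (points P net y) ∧
      s'.rvar 1 = stepCost n (termOf d r₀ r₁) D k (points P net x) (points P net y) := by
  refine ⟨sumCost boundaryLoops (boundaryE * boundaryE.conj).re +
    sumCost isometryLoops (isometryE (nv 22) (nv 23) * (isometryE (nv 24) (nv 25)).conj).re +
    sumCost consistencyLoops (consistencyE (nv 22) (nv 23) (nv 24) *
      (consistencyE (nv 25) (nv 26) (nv 27)).conj).re + sumCost energyLoops energyE.re + 10, ?_⟩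
  intro n d D P S k x y R _ net r₀ r₁ s hs hk hx hy hk1 hkn hn hd hdR hDR
  have hD : 0 < D := NeZero.pos D
  have hR : 1 ≤ R := by omega
  refine Runs.mono (Runs.seq (R₁ := fun s' => s'.rvar 1 = 0) (Runs.setReal (by simp [RExp.eval]))
    fun s1 hF1 h1 => Runs.seq (R₁ := fun s' => s'.rvar 2 = 0) (Runs.setReal (by simp [RExp.eval]))
    fun s2 hF2 h2 => ?_) (T := 2 + 1 + (2 + 1 +
      (sumCost boundaryLoops (boundaryE * boundaryE.conj).re * R ^ 2 +
      (sumCost isometryLoops (isometryE (nv 22) (nv 23) * (isometryE (nv 24) (nv 25)).conj).re * R ^ 7 +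
      (sumCost consistencyLoops (consistencyE (nv 22) (nv 23) (nv 24) *
      (consistencyE (nv 25) (nv 26) (nv 27)).conj).re * R ^ 9 +
      sumCost energyLoops energyE.re * R ^ 10))))) ?_ (fun _ _ h => h)
  swap
  · have e0 : 1 ≤ R ^ 10 := Nat.one_le_pow _ _ hR
    have e1 := pow_le_pow_ten (R := R) (C := sumCost boundaryLoops (boundaryE * boundaryE.conj).re)
      (e := 2) hR (by norm_num)
    have e2 := pow_le_pow_ten (R := R) (C := sumCost isometryLoops
      (isometryE (nv 22) (nv 23) * (isometryE (nv 24) (nv 25)).conj).re) (e := 7) hR (by norm_num)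
    have e3 := pow_le_pow_ten (R := R) (C := sumCost consistencyLoops
      (consistencyE (nv 22) (nv 23) (nv 24) *
      (consistencyE (nv 25) (nv 26) (nv 27)).conj).re) (e := 9) hR (by norm_num)
    simp only [Nat.add_mul]
    omega
  have hs2 := (hs.frame hF1 rfl).frame hF2 rfl
  have g : ∀ t, 10 ≤ t → t ≤ 12 → s2.nvar t = s.nvar t := fun t _ _ => by
    interval_cases t <;> exact (hF2.nvar _ rfl).trans (hF1.nvar _ rfl)
  refine Runs.seq (Runs.sumLoop (R := R) rfl boundaryLoops rfl s2 ?_) fun s3 hF3 h3 => ?_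
  · intro p hp
    have hb : (1 - (k - 1)) + (1 - (n + 1 - k)) * D ≤ D := by
      rcases Nat.lt_or_ge k (n + 1) with h | h
      · rw [show 1 - (n + 1 - k) = 0 by omega]; omega
      · rw [show 1 - (k - 1) = 0 by omega, show 1 - (n + 1 - k) = 1 by omega]; omega
    simp only [boundaryLoops, List.mem_cons, List.not_mem_nil, or_false] at hp
    rcases hp with rfl | rfl <;>
    · simp only [eval_add, eval_sub, eval_mul, eval_const, eval_var, hs2.n_eq, hs2.D_eq,
        g 10 le_rfl (by norm_num), hk]
      omega
  have hs3 := hs2.frame hF3 rfl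
  have g3 : ∀ t, 10 ≤ t → t ≤ 12 → s3.nvar t = s.nvar t := fun t h h' => by
    rw [← g t h h']; interval_cases t <;> exact hF3.nvar _ rfl
  refine Runs.seq (Runs.sumLoop (R := R) rfl isometryLoops rfl s3 ?_) fun s4 hF4 h4 => ?_
  · intro p hp
    simp only [isometryLoops, innerGuard, List.mem_cons, List.not_mem_nil, or_false] at hp
    rcases hp with rfl | rfl | rfl | rfl | rfl | rfl | rfl <;>
    · simp only [eval_sub, eval_const, eval_var, hs3.d_eq, hs3.D_eq]
      omega
  have hs4 := hs3.frame hF4 rfl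
  have g4 : ∀ t, 10 ≤ t → t ≤ 12 → s4.nvar t = s.nvar t := fun t h h' => by
    rw [← g3 t h h']; interval_cases t <;> exact hF4.nvar _ rfl
  refine Runs.seq (Runs.sumLoop (R := R) rfl consistencyLoops rfl s4 ?_) fun s5 hF5 h5 => ?_
  · intro p hp
    simp only [consistencyLoops, innerGuard, List.mem_cons, List.not_mem_nil, or_false] at hp
    rcases hp with rfl | rfl | rfl | rfl | rfl | rfl | rfl | rfl | rfl <;>
    · simp only [eval_sub, eval_const, eval_var, hs4.d_eq, hs4.D_eq]
      omega
  have hs5 := hs4.frame hF5 rfl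
  have g5 : ∀ t, 10 ≤ t → t ≤ 12 → s5.nvar t = s.nvar t := fun t h h' => by
    rw [← g4 t h h']; interval_cases t <;> exact hF5.nvar _ rfl
  refine (Runs.sumLoop (R := R) rfl energyLoops rfl s5 ?_).mono le_rfl fun s6 hF6 h6 => ?_
  · intro p hp
    have hg : (1 - (2 - k)) * (1 - (k - n)) ≤ 1 := by
      calc _ ≤ 1 * 1 := Nat.mul_le_mul (by omega) (by omega)
        _ = 1 := rfl
    simp only [energyLoops, innerGuard, List.mem_cons, List.not_mem_nil, or_false] at hp
    rcases hp with rfl | rfl | rfl | rfl | rfl | rfl | rfl | rfl | rfl | rfl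
    · simp only [eval_sub, eval_mul, eval_const, eval_var, hs5.n_eq, g5 10 le_rfl (by norm_num), hk]
      omega
    all_goals
      simp only [eval_var, hs5.d_eq, hs5.D_eq]
      omega
  · have r2 : s6.rvar 2 = s5.rvar 2 := hF6.rvar 2 rfl
    have r1 : s5.rvar 1 = 0 := by
      rw [hF5.rvar 1 rfl, hF4.rvar 1 rfl, hF3.rvar 1 rfl, hF2.rvar 1 rfl, h1]
    constructor
    · rw [r2, h5, h4, h3, h2,
        sumVal_boundary hs2 ((g 10 (by norm_num) (by norm_num)).trans hk)
          ((g 12 (by norm_num) (by norm_num)).trans hx),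
        sumVal_isometry hs3 ((g3 10 (by norm_num) (by norm_num)).trans hk)
          ((g3 11 (by norm_num) (by norm_num)).trans hy),
        sumVal_consistency hs4 ((g4 10 (by norm_num) (by norm_num)).trans hk)
          ((g4 12 (by norm_num) (by norm_num)).trans hx) ((g4 11 (by norm_num) (by norm_num)).trans hy),
        boundary_eq hk1 hkn hn, isometry_eq hd hD, consistency_eq hd hD, penalty]
      ring
    · rw [h6, r1, zero_add,
        sumVal_energy hs5 ((g5 10 (by norm_num) (by norm_num)).trans hk)
          ((g5 12 (by norm_num) (by norm_num)).trans hx) ((g5 11 (by norm_num) (by norm_num)).trans hy),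
        energy_eq]

end MPSAlgorithm

/-! ### Dynamic programming -/

namespace MPSAlgorithm

open RealRAM Transfer Finset

/-- Among the candidates below `X`, the flag `f` tells whether there is an admissible one, and then
`b` is an admissible one with the least value, `v`. -/
structure Best (adm : ℕ → Prop) (val : ℕ → ℝ) (X f : ℕ) (v : ℝ) (b : ℕ) : Prop where
  sound : 1 ≤ f → b < X ∧ adm b ∧ v = val b
  optimal : ∀ x < X, adm x → 1 ≤ f ∧ v ≤ val x

lemma Best.keep {adm : ℕ → Prop} {val : ℕ → ℝ} {X f b : ℕ} {v : ℝ} (h : Best adm val X f v b)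
    (hX : adm X → 1 ≤ f ∧ v ≤ val X) : Best adm val (X + 1) f v b := by
  refine ⟨fun hf => ⟨(h.sound hf).1.trans (Nat.lt_succ_self _), (h.sound hf).2⟩, fun x hx ha => ?_⟩
  rcases Nat.lt_succ_iff_lt_or_eq.1 hx with h' | rfl
  · exact h.optimal x h' ha
  · exact hX ha

lemma Best.take {adm : ℕ → Prop} {val : ℕ → ℝ} {X f b : ℕ} {v : ℝ} (h : Best adm val X f v b)
    (ha : adm X) (hv : 1 ≤ f → val X ≤ v) : Best adm val (X + 1) 1 (val X) X := by
  refine ⟨fun _ => ⟨Nat.lt_succ_self _, ha, rfl⟩, fun x hx hax => ⟨le_rfl, ?_⟩⟩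
  rcases Nat.lt_succ_iff_lt_or_eq.1 hx with h' | rfl
  · obtain ⟨h1, h2⟩ := h.optimal x h' hax
    exact (hv h1).trans h2
  · exact le_rfl

/-- The tables contain optimal data for the point `y` of layer `k + 1`, given those of layer `k`. -/
def Layer (S : ℕ) (tol : ℝ) (pen cost : ℕ → ℕ → ℕ → ℝ) (fl bp : ℕ → ℕ) (F : ℕ → ℝ) (k y : ℕ) :
    Prop :=
  Best (fun x => 1 ≤ fl (k * S + x) ∧ pen k x y ≤ tol) (fun x => F (k * S + x) + cost k x y) S
    (fl ((k + 1) * S + y)) (F ((k + 1) * S + y)) (bp ((k + 1) * S + y))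

lemma Best.congr {adm adm' : ℕ → Prop} {val val' : ℕ → ℝ} {X f b : ℕ} {v : ℝ}
    (h : Best adm val X f v b) (ha : ∀ x < X, adm' x ↔ adm x) (hv : ∀ x < X, val' x = val x) :
    Best adm' val' X f v b :=
  ⟨fun hf => by
    obtain ⟨h1, h2, h3⟩ := h.sound hf
    exact ⟨h1, (ha b h1).2 h2, by rw [hv b h1, h3]⟩,
  fun x hx hax => by rw [hv x hx]; exact h.optimal x hx ((ha x hx).1 hax)⟩

lemma Layer.congr {S k y : ℕ} {tol : ℝ} {pen cost : ℕ → ℕ → ℕ → ℝ} {fl bp fl' bp' : ℕ → ℕ}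
    {F F' : ℕ → ℝ} (h : Layer S tol pen cost fl bp F k y)
    (h1 : ∀ x < S, fl' (k * S + x) = fl (k * S + x) ∧ F' (k * S + x) = F (k * S + x))
    (h2 : fl' ((k + 1) * S + y) = fl ((k + 1) * S + y))
    (h3 : F' ((k + 1) * S + y) = F ((k + 1) * S + y))
    (h4 : bp' ((k + 1) * S + y) = bp ((k + 1) * S + y)) : Layer S tol pen cost fl' bp' F' k y := by
  rw [Layer, h2, h3, h4]
  exact Best.congr h (fun x hx => by rw [(h1 x hx).1]) (fun x hx => by rw [(h1 x hx).2])

lemma cell_ne {S k y K Y : ℕ} (hy : y < S) (hY : Y < S) (h : k ≠ K ∨ y ≠ Y) :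
    k * S + y ≠ K * S + Y := by
  intro e
  have hS : 0 < S := by omega
  have h1 := congrArg (· / S) e
  have h2 := congrArg (· % S) e
  simp only [Nat.mul_add_mod', Nat.mod_eq_of_lt hy, Nat.mod_eq_of_lt hY] at h2
  subst h2
  have : k * S = K * S := by omega
  have := Nat.eq_of_mul_eq_mul_right hS this
  omega

/-- The tables are correct for the layers up to `K`, and for the first `Y` points of the next. -/
structure Tables (S : ℕ) (tol : ℝ) (pen cost : ℕ → ℕ → ℕ → ℝ) (K Y : ℕ) (s : State) : Prop where
  init : ∀ y < S, s.narr 1 y = 1 ∧ s.rarr 10 y = 0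
  layer : ∀ k y, y < S → (k < K ∨ k = K ∧ y < Y) →
    Layer S tol pen cost (s.narr 1) (s.narr 2) (s.rarr 10) k y

/-- The cells filled so far refer to layers up to `K` and to other points of layer `K + 1`; the cell
being written is none of these. -/
lemma Tables.write {S K Y f b : ℕ} {tol v : ℝ} {pen cost : ℕ → ℕ → ℕ → ℝ} {s s' : State}
    (h : Tables S tol pen cost K Y s) (hY : Y < S)
    (hb : Best (fun x => 1 ≤ s.narr 1 (K * S + x) ∧ pen K x Y ≤ tol)
      (fun x => s.rarr 10 (K * S + x) + cost K x Y) S f v b)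
    (h1 : s'.narr 1 = Function.update (s.narr 1) ((K + 1) * S + Y) f)
    (h2 : s'.narr 2 = Function.update (s.narr 2) ((K + 1) * S + Y) b)
    (h3 : s'.rarr 10 = Function.update (s.rarr 10) ((K + 1) * S + Y) v) :
    Tables S tol pen cost K (Y + 1) s' := by
  have hne : ∀ k y, y < S → (k ≠ K + 1 ∨ y ≠ Y) → k * S + y ≠ (K + 1) * S + Y :=
    fun k y hy h => cell_ne hy hY h
  refine ⟨fun y hy => ?_, fun k y hy hk => ?_⟩
  · have := hne 0 y hy (Or.inl (by omega))
    rw [zero_mul, zero_add] at this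
    rw [h1, h3, Function.update_of_ne this, Function.update_of_ne this]
    exact h.init y hy
  · rw [h1, h2, h3]
    by_cases hkY : k = K ∧ y = Y
    · obtain ⟨rfl, rfl⟩ := hkY
      rw [Layer, Function.update_self, Function.update_self, Function.update_self]
      refine hb.congr (fun x hx => ?_) (fun x hx => ?_) <;>
        rw [Function.update_of_ne (hne k x hx (Or.inl (by omega)))]
    · have hk' : k < K ∨ k = K ∧ y < Y := by omega
      have := hne (k + 1) y hy (by omega)
      refine (h.layer k y hy hk').congr (fun x hx => ?_) ?_ ?_ ?_
      · have := hne k x hx (by omega)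
        rw [Function.update_of_ne this, Function.update_of_ne this]
        exact ⟨rfl, rfl⟩
      all_goals rw [Function.update_of_ne this]

lemma Tables.congr {S K Y K' Y' : ℕ} {tol : ℝ} {pen cost : ℕ → ℕ → ℕ → ℝ} {s s' : State}
    (h : Tables S tol pen cost K Y s) (h1 : s'.narr 1 = s.narr 1) (h2 : s'.narr 2 = s.narr 2)
    (h3 : s'.rarr 10 = s.rarr 10)
    (hK : ∀ k y, y < S → (k < K' ∨ k = K' ∧ y < Y') → (k < K ∨ k = K ∧ y < Y)) :
    Tables S tol pen cost K' Y' s' :=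
  ⟨by rw [h1, h3]; exact h.init, fun k y hy hk => by
    rw [h1, h2, h3]; exact h.layer k y hy (hK k y hy hk)⟩

/-- Replace the current candidate by `x`. -/
def take : Prog :=
  .seq (.setNat 13 (nc 1)) <|
  .seq (.setReal 4 (.add (.get 10 (nv 9 * nv 6 + nv 12)) (.var 1))) (.setNat 14 (nv 12))

/-- Compare the current candidate with `x`. -/
def relax : Prog :=
  .seq weigh <|
  .ite (.natLe (nc 1) (.get 1 (nv 9 * nv 6 + nv 12)))
    (.ite (.realLe (.var 2) (.var 3))
      (.ite (.natLe (nv 13) (nc 0)) take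
        (.ite (.not (.realLe (.var 4) (.add (.get 10 (nv 9 * nv 6 + nv 12)) (.var 1)))) take .skip))
      .skip)
    .skip

lemma runs_take (s : State) : Runs take s 14 fun s' => s'.nvar 13 = 1 ∧
    s'.rvar 4 = s.rarr 10 (s.nvar 9 * s.nvar 6 + s.nvar 12) + s.rvar 1 ∧
    s'.nvar 14 = s.nvar 12 := by
  refine Runs.mono (Runs.seq (R₁ := fun s' => s'.nvar 13 = 1) (Runs.setNat (by simp))
    fun s1 hF1 h1 => Runs.seq (R₁ := fun s' => s'.nvar 13 = 1 ∧
      s'.rvar 4 = s.rarr 10 (s.nvar 9 * s.nvar 6 + s.nvar 12) + s.rvar 1) (Runs.setReal ?_)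
      fun s2 hF2 h2 => Runs.setNat ?_) (by simp [RExp.cost]) (fun _ _ h => h)
  · simp [RExp.eval, h1, hF1.nvar 9 rfl, hF1.nvar 6 rfl, hF1.nvar 12 rfl, hF1.rvar 1 rfl,
      hF1.rarr 10 rfl]
  · simp [h2.1, h2.2, hF2.nvar 12 rfl, hF1.nvar 12 rfl]

/-- Violation of the constraints in step `k + 1`. -/
noncomputable abbrev stepPenalty (d D n P : ℕ) [NeZero D] (net : ℕ → ℝ) (k x y : ℕ) : ℝ :=
  penalty d D n (k + 1) (points P net x) (points P net y)

/-- Energy of step `k + 1`. -/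
noncomputable abbrev stepEnergy (d D n P : ℕ) (net r₀ r₁ : ℕ → ℝ) (k x y : ℕ) : ℝ :=
  stepCost n (termOf d r₀ r₁) D (k + 1) (points P net x) (points P net y)

/-- Registers 13, 4 and 14 hold the flag, value and argument of a running minimum. A candidate takes
part only if its own cell is reachable and the step respects the tolerance in real register 3. -/
lemma runs_relax : ∃ C : ℕ, ∀ {n d D P S k x y R : ℕ} [NeZero D] {net r₀ r₁ : ℕ → ℝ} {s : State},
    Ready n d D P S net r₀ r₁ s → s.nvar 9 = k → s.nvar 10 = k + 1 → s.nvar 12 = x →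
    s.nvar 11 = y → k ≤ n → 1 ≤ n → 0 < d → d + 1 ≤ R → D + 1 ≤ R →
    let adm := fun x => 1 ≤ s.narr 1 (k * S + x) ∧ stepPenalty d D n P net k x y ≤ s.rvar 3
    let val := fun x => s.rarr 10 (k * S + x) + stepEnergy d D n P net r₀ r₁ k x y
    Best adm val x (s.nvar 13) (s.rvar 4) (s.nvar 14) →
    Runs relax s (C * R ^ 10) fun s' =>
      Best adm val (x + 1) (s'.nvar 13) (s'.rvar 4) (s'.nvar 14) := by
  obtain ⟨C, hC⟩ := runs_weigh
  refine ⟨C + 60, fun {n d D P S k x y R} _ {net r₀ r₁ s} hs h9 h10 h12 h11 hk hn hd hdR hDR => ?_⟩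
  intro adm val hB
  refine (Runs.seq (T₂ := 60) (hC hs h10 h12 h11 (by omega) (by omega) hn hd hdR hDR)
    fun s1 hF1 ⟨hp, hv⟩ => ?_).mono ?_ (fun _ _ h => h)
  swap
  · have : 1 ≤ R ^ 10 := Nat.one_le_pow _ _ (by omega)
    nlinarith
  have g9 : s1.nvar 9 = k := (hF1.nvar 9 rfl).trans h9
  have g6 : s1.nvar 6 = S := (hF1.nvar 6 rfl).trans hs.S_eq
  have g12 : s1.nvar 12 = x := (hF1.nvar 12 rfl).trans h12
  have g1 : s1.narr 1 = s.narr 1 := hF1.narr 1 rfl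
  have gF : s1.rarr 10 = s.rarr 10 := hF1.rarr 10 rfl
  have g3 : s1.rvar 3 = s.rvar 3 := hF1.rvar 3 rfl
  have hB1 : Best adm val x (s1.nvar 13) (s1.rvar 4) (s1.nvar 14) := by
    rw [hF1.nvar 13 rfl, hF1.nvar 14 rfl, hF1.rvar 4 rfl]; exact hB
  have hval : s1.rarr 10 (s1.nvar 9 * s1.nvar 6 + s1.nvar 12) + s1.rvar 1 = val x := by
    rw [g9, g6, g12, gF, hv]
  have htake : adm x → (1 ≤ s1.nvar 13 → val x ≤ s1.rvar 4) → Runs take s1 14 fun s' =>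
      Best adm val (x + 1) (s'.nvar 13) (s'.rvar 4) (s'.nvar 14) := fun h1 h2 =>
    (runs_take s1).mono le_rfl fun s' _ ⟨e1, e2, e3⟩ => by
      rw [e1, e2, e3, hval, g12]; exact hB1.take h1 h2
  have hkeep : (adm x → 1 ≤ s1.nvar 13 ∧ s1.rvar 4 ≤ val x) → Runs .skip s1 1 fun s' =>
      Best adm val (x + 1) (s'.nvar 13) (s'.rvar 4) (s'.nvar 14) := fun h => Runs.skip (hB1.keep h)
  refine (Runs.ite (T := 45) (fun hb1 => ?_) (fun hb1 => ?_)).mono (by simp [Test.cost])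
    (fun _ _ h => h)
  · simp only [Test.Holds, eval_const, eval_get, eval_add, eval_mul, eval_var, g9, g6, g12, g1]
      at hb1
    refine (Runs.ite (T := 39) (fun hb2 => ?_) (fun hb2 => ?_)).mono (by simp [Test.cost, RExp.cost])
      (fun _ _ h => h)
    · simp only [Test.Holds, RExp.eval, hp, g3] at hb2
      refine (Runs.ite (T := 32) (fun hb3 => ?_) (fun hb3 => ?_)).mono (by simp [Test.cost])
        (fun _ _ h => h)
      · simp only [Test.Holds, eval_var, eval_const] at hb3
        exact (htake ⟨hb1, hb2⟩ (fun h => by omega)).mono (by norm_num) (fun _ _ h => h)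
      · simp only [Test.Holds, eval_var, eval_const] at hb3
        have hlt : ∀ {b : Prop}, (¬ s1.rvar 4 ≤ val x ↔ b) →
            ((Test.not (.realLe (.var 4)
              (.add (.get 10 (nv 9 * nv 6 + nv 12)) (.var 1)))).Holds s1 ↔ b) := by
          intro b hb
          rw [← hb]
          simp only [Test.Holds, RExp.eval, eval_add, eval_mul, eval_var]
          rw [hval]
        refine (Runs.ite (T := 14) (fun hb4 => ?_) (fun hb4 => ?_)).mono
          (by simp [Test.cost, RExp.cost]) (fun _ _ h => h)
        · rw [hlt Iff.rfl] at hb4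
          exact htake ⟨hb1, hb2⟩ fun _ => (not_le.1 hb4).le
        · rw [hlt Iff.rfl, not_not] at hb4
          exact (hkeep fun _ => ⟨by omega, hb4⟩).mono (by norm_num) (fun _ _ h => h)
    · simp only [Test.Holds, RExp.eval, hp, g3] at hb2
      exact (hkeep fun h => absurd h.2 hb2).mono (by norm_num) (fun _ _ h => h)
  · simp only [Test.Holds, eval_const, eval_get, eval_add, eval_mul, eval_var, g9, g6, g12, g1]
      at hb1
    exact (hkeep fun h => absurd h.1 hb1).mono (by norm_num) (fun _ _ h => h)

/-- One loop raises the exponent of `R` by one; its overhead goes into the constant. -/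
lemma loop_time {c C R e a b : ℕ} (hc : c + 1 ≤ R) :
    (c + 1) * (C * R ^ e + a + b) ≤ (C + (a + b)) * R ^ (e + 1) := by
  have h1 : 1 ≤ R ^ e := Nat.one_le_pow _ _ (by omega)
  calc (c + 1) * (C * R ^ e + a + b) ≤ R * (C * R ^ e + (a + b) * R ^ e) := by
        have := Nat.le_mul_of_pos_right (a + b) h1
        exact Nat.mul_le_mul hc (by omega)
    _ = _ := by ring

/-- Find the best predecessor of the point `y` and enter it into the tables. -/
def fillCell : Prog :=
  .seq (.setNat 13 (nc 0)) <|
  .seq (forLt 12 (nv 6) relax) <|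
  .seq (.putNat 1 (nv 10 * nv 6 + nv 11) (nv 13)) <|
  .seq (.putNat 2 (nv 10 * nv 6 + nv 11) (nv 14))
    (.putReal 10 (nv 10 * nv 6 + nv 11) (.var 4))

lemma runs_fillCell : ∃ C : ℕ, ∀ {n d D P S k y R : ℕ} [NeZero D] {net r₀ r₁ : ℕ → ℝ} {s : State},
    Ready n d D P S net r₀ r₁ s → s.nvar 9 = k → s.nvar 10 = k + 1 →
    s.nvar 11 = y → y < S → k ≤ n → 1 ≤ n → 0 < d → d + 1 ≤ R → D + 1 ≤ R → S + 1 ≤ R →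
    Tables S (s.rvar 3) (stepPenalty d D n P net) (stepEnergy d D n P net r₀ r₁) k y s →
    Runs fillCell s (C * R ^ 11) fun s' => Tables S (s.rvar 3) (stepPenalty d D n P net)
      (stepEnergy d D n P net r₀ r₁) k (y + 1) s' := by
  obtain ⟨C, hC⟩ := runs_relax
  refine ⟨C + 9 + 30,
    fun {n d D P S k y R} _ {net r₀ r₁ s} hs h9 h10 h11 hy hk hn hd hdR hDR hSR hT => ?_⟩
  set adm := fun x => 1 ≤ s.narr 1 (k * S + x) ∧ stepPenalty d D n P net k x y ≤ s.rvar 3 with hadm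
  set val := fun x => s.rarr 10 (k * S + x) + stepEnergy d D n P net r₀ r₁ k x y with hval
  refine (Runs.seq (T₁ := 2) (T₂ := (C + 9) * R ^ 11 + 28) (R₁ := fun s' => s'.nvar 13 = 0)
    (Runs.setNat (by simp)) fun s1 hF1 h1 => ?_).mono ?_ (fun _ _ h => h)
  swap
  · have : 1 ≤ R ^ 11 := Nat.one_le_pow _ _ (by omega)
    nlinarith
  refine Runs.seq (T₂ := 28) (R₁ := fun s' => Best adm val S (s'.nvar 13) (s'.rvar 4) (s'.nvar 14))
    ((Runs.forLt S (C * R ^ 10) (fun x s' => Best adm val x (s'.nvar 13) (s'.rvar 4) (s'.nvar 14))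
      rfl ?_ ?_ ?_).mono (loop_time hSR) (fun _ _ h => h)) fun s2 hF2 hB => ?_
  · intro s' hF
    simp [hF.nvar 6 rfl, hF1.nvar 6 rfl, hs.S_eq]
  -- Registers 4 and 14 still hold data of an earlier cell, which is harmless: with the flag at `0`
  -- nothing is claimed about them.
  · refine ⟨fun h => ?_, fun x hx => by omega⟩
    simp [h1] at h
  · intro x hx s' hF hxx hB
    have e1 : s'.narr 1 = s.narr 1 := (hF.narr 1 rfl).trans (hF1.narr 1 rfl)
    have e2 : s'.rarr 10 = s.rarr 10 := (hF.rarr 10 rfl).trans (hF1.rarr 10 rfl)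
    have e3 : s'.rvar 3 = s.rvar 3 := (hF.rvar 3 rfl).trans (hF1.rvar 3 rfl)
    have := hC (s := s') (k := k) (x := x) (y := y) (R := R) ((hs.frame hF1 rfl).frame hF rfl)
      ((hF.nvar 9 rfl).trans ((hF1.nvar 9 rfl).trans h9))
      ((hF.nvar 10 rfl).trans ((hF1.nvar 10 rfl).trans h10)) hxx
      ((hF.nvar 11 rfl).trans ((hF1.nvar 11 rfl).trans h11)) hk hn hd hdR hDR
    simp only [e1, e2, e3] at this
    refine (this hB).mono le_rfl fun s'' _ h => ?_
    simpa using h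
  · have g10 : s2.nvar 10 = k + 1 := (hF2.nvar 10 rfl).trans ((hF1.nvar 10 rfl).trans h10)
    have g11 : s2.nvar 11 = y := (hF2.nvar 11 rfl).trans ((hF1.nvar 11 rfl).trans h11)
    have g6 : s2.nvar 6 = S := (hF2.nvar 6 rfl).trans ((hF1.nvar 6 rfl).trans hs.S_eq)
    refine Runs.mono (Runs.seq (R₁ := fun s' => s'.narr 1 =
        Function.update (s.narr 1) ((k + 1) * S + y) (s2.nvar 13)) (Runs.putNat ?_) fun s3 hF3 h3 =>
      Runs.seq (R₁ := fun s' => s'.narr 2 =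
        Function.update (s.narr 2) ((k + 1) * S + y) (s2.nvar 14)) (Runs.putNat ?_) fun s4 hF4 h4 =>
      Runs.putReal ?_) (by simp [RExp.cost]) (fun _ _ h => h)
    · simp only [eval_add, eval_mul, eval_var, g10, g11, g6, State.putN, Function.update_self]
      rw [hF2.narr 1 rfl, hF1.narr 1 rfl]
    · have e1 := hF3.nvar 10 rfl
      have e2 := hF3.nvar 11 rfl
      have e3 := hF3.nvar 6 rfl
      have e4 := hF3.nvar 14 rfl
      simp only [eval_add, eval_mul, eval_var, g10, g11, g6, e1, e2, e3, e4, State.putN,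
        Function.update_self]
      rw [hF3.narr 2 rfl, hF2.narr 2 rfl, hF1.narr 2 rfl]
    · have e1 := (hF4.nvar 10 rfl).trans (hF3.nvar 10 rfl)
      have e2 := (hF4.nvar 11 rfl).trans (hF3.nvar 11 rfl)
      have e3 := (hF4.nvar 6 rfl).trans (hF3.nvar 6 rfl)
      have e4 := (hF4.rvar 4 rfl).trans (hF3.rvar 4 rfl)
      refine hT.write hy hB ?_ ?_ ?_
      · simp only [State.putR_narr]; rw [hF4.narr 1 rfl, h3]
      · simp only [State.putR_narr]; rw [h4]
      · simp only [eval_add, eval_mul, eval_var, RExp.eval, g10, g11, g6, e1, e2, e3, e4, State.putR,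
          Function.update_self]
        rw [hF4.rarr 10 rfl, hF3.rarr 10 rfl, hF2.rarr 10 rfl, hF1.rarr 10 rfl]

/-- Fill the tables. -/
def fillTables : Prog :=
  .seq (forLt 11 (nv 6) (.seq (.putNat 1 (nv 11) (nc 1)) (.putReal 10 (nv 11) (.ofNat (nc 0)))))
  (forLt 9 (nv 0 + nc 1) (.seq (.setNat 10 (nv 9 + nc 1)) (forLt 11 (nv 6) fillCell)))

/-- There are `n + 1` steps, fewer than `R` points in each layer, and `O(R ^ 11)` time per cell; the
chain length enters only linearly. -/
lemma runs_fillTables : ∃ C : ℕ, ∀ {n d D P S R : ℕ} [NeZero D] {net r₀ r₁ : ℕ → ℝ} {s : State},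
    Ready n d D P S net r₀ r₁ s → 1 ≤ n → 0 < d → d + 1 ≤ R → D + 1 ≤ R → S + 1 ≤ R →
    Runs fillTables s (C * (n * R ^ 12)) fun s' => Tables S (s.rvar 3) (stepPenalty d D n P net)
      (stepEnergy d D n P net r₀ r₁) (n + 1) 0 s' := by
  obtain ⟨C, hC⟩ := runs_fillCell
  refine ⟨(C + 9 + 15) * 3 + 16, fun {n d D P S R} _ {net r₀ r₁ s} hs hn hd hdR hDR hSR => ?_⟩
  refine (Runs.seq (T₁ := (7 + 9) * R ^ (0 + 1)) (R₁ := fun s' =>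
    ∀ y < S, s'.narr 1 y = 1 ∧ s'.rarr 10 y = 0) (T₂ := (n + 1 + 1) * ((C + 9 + 15) * R ^ 12))
    ((Runs.forLt S (7 * R ^ 0) (fun x s' => ∀ y < x, s'.narr 1 y = 1 ∧ s'.rarr 10 y = 0)
      rfl ?_ ?_ ?_).mono (loop_time hSR) (fun _ _ h => h)) fun s1 hF1 h1 => ?_).mono ?_
        (fun _ _ h => h)
  · intro s' hF
    simp [hF.nvar 6 rfl, hs.S_eq]
  · simp
  · intro x hx s' hF hxx hI
    refine Runs.mono (Runs.seq (R₁ := fun s1 => s1.narr 1 = Function.update (s'.narr 1) x 1)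
      (Runs.putNat (by simp [hxx, State.putN])) fun s1 hF1 h1 => Runs.putReal ?_)
      (by simp [RExp.cost]) (fun _ _ h => h)
    intro y hy
    have e : s1.nvar 11 = x := (hF1.nvar 11 rfl).trans hxx
    simp only [State.setN_narr, State.setN_rarr, State.putR_narr, State.putR_rarr, if_true, eval_var,
      e, RExp.eval, eval_const, h1, hF1.rarr 10 rfl, Function.update_apply, Nat.cast_zero]
    by_cases hyx : y = x
    · simp [hyx]
    · simp [hyx, hI y (by omega)]
  · have hs1 := hs.frame hF1 rfl
    have t3 : s1.rvar 3 = s.rvar 3 := hF1.rvar 3 rfl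
    refine (Runs.forLt (n + 1) (C * R ^ 11 * R + (9 * R ^ 12 + 4)) (fun k s' =>
      Tables S (s.rvar 3) (stepPenalty d D n P net) (stepEnergy d D n P net r₀ r₁) k 0 s')
      rfl ?_ ?_ ?_).mono ?_ (fun _ _ h => h)
    · intro s' hF
      simp [hF.nvar 0 rfl, hs1.n_eq]
    · exact ⟨h1, fun k y _ h => by omega⟩
    · intro k hk s' hF hk9 hT
      have hs' := hs1.frame hF rfl
      refine Runs.mono (Runs.seq (T₁ := 4) (T₂ := (C + 9) * R ^ 12)
        (R₁ := fun s'' => s''.nvar 10 = k + 1)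
        (Runs.setNat (by simp [hk9])) fun s2 hF2 h2 => (Runs.forLt S (C * R ^ 11) (fun y s' =>
          Tables S (s.rvar 3) (stepPenalty d D n P net) (stepEnergy d D n P net r₀ r₁) k y s')
          rfl ?_ ?_ ?_).mono (loop_time hSR) (fun _ _ h => h)) ?_ (fun s'' _ h => ?_)
      · intro s'' hF'
        simp [hF'.nvar 6 rfl, hF2.nvar 6 rfl, hs'.S_eq]
      · exact hT.congr (hF2.narr 1 rfl) (hF2.narr 2 rfl) (hF2.rarr 10 rfl) (fun _ _ _ h => h)
      · intro y hy s'' hF' hyy hT'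
        have t : s''.rvar 3 = s.rvar 3 := ((hF'.rvar 3 rfl).trans (hF2.rvar 3 rfl)).trans
          ((hF.rvar 3 rfl).trans t3)
        have := hC (s := s'') (k := k) (y := y) (R := R) ((hs'.frame hF2 rfl).frame hF' rfl)
          ((hF'.nvar 9 rfl).trans ((hF2.nvar 9 rfl).trans hk9)) ((hF'.nvar 10 rfl).trans h2) hyy hy
          (by omega) hn hd hdR hDR hSR
        rw [t] at this
        exact (this hT').mono le_rfl fun _ _ h => h.congr rfl rfl rfl fun _ _ _ h => h
      · have : 1 ≤ R ^ 12 := Nat.one_le_pow _ _ (by omega)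
        nlinarith [pow_succ R 11]
      · exact h.congr rfl rfl rfl (fun _ _ _ h => by omega)
    · have : 1 ≤ R ^ 12 := Nat.one_le_pow _ _ (by omega)
      refine Nat.mul_le_mul_left _ ?_
      simp only [cost_add, cost_var, cost_const]
      nlinarith [pow_succ R 11]
  · have e1 : R ^ (0 + 1) ≤ n * R ^ 12 := by
      calc R ^ (0 + 1) ≤ R ^ 12 := Nat.pow_le_pow_right (by omega) (by norm_num)
        _ ≤ _ := Nat.le_mul_of_pos_left _ hn
    have e2 : (n + 1 + 1) * ((C + 9 + 15) * R ^ 12) ≤ (C + 9 + 15) * 3 * (n * R ^ 12) := by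
      calc _ ≤ (3 * n) * ((C + 9 + 15) * R ^ 12) := Nat.mul_le_mul_right _ (by omega)
        _ = _ := by ring
    have e3 := Nat.add_mul ((C + 9 + 15) * 3) 16 (n * R ^ 12)
    omega

end MPSAlgorithm

/-! ### Optimality of the path found by backtracking -/

namespace MPSAlgorithm

open RealRAM Transfer Finset

section Optimal

variable {n d D P S : ℕ} [NeZero D] {net r₀ r₁ : ℕ → ℝ} {s : State} {η : ℝ} {p z : ℕ → ℕ}

/-- Following the table of predecessors backwards yields a path of least cost. -/
lemma Tables.optimal (hT : Tables S (η ^ 2) (stepPenalty d D n P net) (stepEnergy d D n P net r₀ r₁)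
    (n + 1) 0 s) (hS : 0 < S) (hp0 : p (n + 1) = 0)
    (hp : ∀ k ≤ n, p k = s.narr 2 ((k + 1) * S + p (k + 1)))
    (hz : Path d D n S η (points P net) z) :
    Path d D n S η (points P net) p ∧
      pathCost n (termOf d r₀ r₁) D (points P net) p ≤
        pathCost n (termOf d r₀ r₁) D (points P net) z := by
  -- Layer `n + 1` exists only to test the final density matrix. Neither penalty nor energy depends
  -- on its point, so the competitor may be made to end at `0`, where backtracking starts.
  set w : ℕ → ℕ := Function.update z (n + 1) 0 with hw
  have hwn : w (n + 1) = 0 := Function.update_self ..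
  have hwk : ∀ k ≤ n, w k = z k := fun k hk => Function.update_of_ne (by omega) ..
  have hwS : ∀ k ≤ n + 1, w k < S := fun k hk => by
    rcases Nat.lt_or_eq_of_le hk with h | rfl
    · rw [hwk k (by omega)]; exact hz.lt k hk
    · rw [hwn]; exact hS
  have hstep : ∀ k ≤ n, stepPenalty d D n P net k (w k) (w (k + 1)) =
      stepPenalty d D n P net k (z k) (z (k + 1)) ∧
      stepEnergy d D n P net r₀ r₁ k (w k) (w (k + 1)) =
      stepEnergy d D n P net r₀ r₁ k (z k) (z (k + 1)) := by
    intro k hk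
    rcases Nat.lt_or_eq_of_le hk with h | rfl
    · rw [hwk k hk, hwk (k + 1) h]; exact ⟨rfl, rfl⟩
    · rw [hwk k hk]
      simp [stepPenalty, stepEnergy, penalty, stepCost]
  -- Forwards: all cells along the competitor are reachable, with values at most its cost so far. In
  -- particular the last cell is reachable.
  have hreach : ∀ k ≤ n + 1, 1 ≤ s.narr 1 (k * S + w k) ∧ s.rarr 10 (k * S + w k) ≤
      ∑ l ∈ range k, stepEnergy d D n P net r₀ r₁ l (w l) (w (l + 1)) := by
    intro k
    induction k with
    | zero =>
      intro _
      have := hT.init (w 0) (hwS 0 (by omega))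
      simp [this.1, this.2]
    | succ k ih =>
      intro hk
      obtain ⟨h1, h2⟩ := ih (by omega)
      have h3 := hT.layer k (w (k + 1)) (hwS _ hk) (Or.inl (by omega))
      obtain ⟨h4, h5⟩ := h3.optimal (w k) (hwS _ (by omega)) ⟨h1, by
        rw [(hstep k (by omega)).1]
        exact hz.ok (k + 1) (by omega) hk⟩
      refine ⟨h4, h5.trans ?_⟩
      rw [sum_range_succ]
      linarith
  -- Backwards: a reachable cell has a reachable predecessor, so backtracking from the last cell
  -- never leaves the reachable part.
  have hback : ∀ j ≤ n + 1, p (n + 1 - j) < S ∧ 1 ≤ s.narr 1 ((n + 1 - j) * S + p (n + 1 - j)) := by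
    intro j
    induction j with
    | zero =>
      intro _
      have := (hreach (n + 1) le_rfl).1
      rw [hwn] at this
      simp only [Nat.sub_zero, hp0]
      exact ⟨hS, this⟩
    | succ j ih =>
      intro hj
      obtain ⟨h1, h2⟩ := ih (by omega)
      have e : n + 1 - j = n - j + 1 := by omega
      have e' : n + 1 - (j + 1) = n - j := by omega
      rw [e] at h1 h2
      obtain ⟨h3, h4, -⟩ := (hT.layer (n - j) _ h1 (Or.inl (by omega))).sound h2
      rw [← hp _ (by omega)] at h3 h4
      rw [e']
      exact ⟨h3, h4.1⟩
  have hall : ∀ k ≤ n, stepPenalty d D n P net k (p k) (p (k + 1)) ≤ η ^ 2 ∧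
      s.rarr 10 ((k + 1) * S + p (k + 1)) = s.rarr 10 (k * S + p k) +
        stepEnergy d D n P net r₀ r₁ k (p k) (p (k + 1)) := by
    intro k hk
    have h := hback (n - k) (by omega)
    rw [show n + 1 - (n - k) = k + 1 by omega] at h
    obtain ⟨-, h4, h5⟩ := (hT.layer k _ h.1 (Or.inl (by omega))).sound h.2
    rw [← hp _ hk] at h4 h5
    exact ⟨h4.2, h5⟩
  have hlt : ∀ k ≤ n + 1, p k < S := fun k hk => by
    have := (hback (n + 1 - k) (by omega)).1
    rwa [show n + 1 - (n + 1 - k) = k by omega] at this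
  -- Along the backtracked path the recursion for the values holds with equality.
  have hsum : ∀ k ≤ n + 1, s.rarr 10 (k * S + p k) =
      ∑ l ∈ range k, stepEnergy d D n P net r₀ r₁ l (p l) (p (l + 1)) := by
    intro k
    induction k with
    | zero =>
      intro _
      simp [(hT.init (p 0) (hlt 0 (by omega))).2]
    | succ k ih =>
      intro hk
      rw [(hall k (by omega)).2, ih (by omega), sum_range_succ]
  refine ⟨⟨hlt, fun k hk1 hk => ?_⟩, ?_⟩
  · have := (hall (k - 1) (by omega)).1
    rwa [stepPenalty, show k - 1 + 1 = k by omega] at this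
  · have h1 := hsum (n + 1) le_rfl
    have h2 := (hreach (n + 1) le_rfl).2
    rw [hwn] at h2
    rw [hp0] at h1
    rw [h1] at h2
    refine h2.trans (le_of_eq (sum_congr rfl fun k hk => ?_))
    exact (hstep k (by rw [mem_range] at hk; omega)).2

end Optimal

/-- Follow the table of predecessors backwards. -/
def backtrack : Prog :=
  .seq (.setNat 15 (nc 0)) <| .seq (.putNat 3 (nv 0 + nc 1) (nc 0)) <|
  forLt 9 (nv 0 + nc 1) (.seq (.setNat 15 (.get 2 ((nv 0 + nc 1 - nv 9) * nv 6 + nv 15)))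
    (.putNat 3 (nv 0 - nv 9) (nv 15)))

lemma runs_backtrack {n S : ℕ} {s : State} (h0 : s.nvar 0 = n) (h6 : s.nvar 6 = S) (hn : 1 ≤ n) :
    Runs backtrack s (100 * n) fun s' => s'.narr 3 (n + 1) = 0 ∧
      ∀ k ≤ n, s'.narr 3 k = s.narr 2 ((k + 1) * S + s'.narr 3 (k + 1)) := by
  refine Runs.mono (Runs.seq (R₁ := fun s' => s'.nvar 15 = 0) (Runs.setNat (by simp)) fun s1 hF1 h1 =>
    Runs.seq (R₁ := fun s' => s'.narr 3 (n + 1) = 0) (Runs.putNat ?_) fun s2 hF2 h2 =>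
    -- After `j` rounds the path is known from layer `n + 1 - j` on, and register 15 holds its point
    -- there.
    Runs.forLt (n + 1) 18 (fun j s' => s'.nvar 15 = s'.narr 3 (n + 1 - j) ∧ s'.narr 3 (n + 1) = 0 ∧
      ∀ k ≤ n, n + 1 ≤ k + j → s'.narr 3 k = s.narr 2 ((k + 1) * S + s'.narr 3 (k + 1)))
      rfl ?_ ?_ ?_) ?_ ?_
  · simp [h0, hF1.nvar 0 rfl]
  · intro s' hF
    simp [hF.nvar 0 rfl, hF2.nvar 0 rfl, hF1.nvar 0 rfl, h0]
  · refine ⟨?_, h2, fun k hk hk' => by omega⟩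
    simp [h2, hF2.nvar 15 rfl, h1]
  · intro j hj s' hF h9 ⟨k1, k2, k3⟩
    have g0 : s'.nvar 0 = n := by rw [hF.nvar 0 rfl, hF2.nvar 0 rfl, hF1.nvar 0 rfl, h0]
    have g6 : s'.nvar 6 = S := by rw [hF.nvar 6 rfl, hF2.nvar 6 rfl, hF1.nvar 6 rfl, h6]
    have ga : s'.narr 2 = s.narr 2 := by rw [hF.narr 2 rfl, hF2.narr 2 rfl, hF1.narr 2 rfl]
    refine Runs.mono (Runs.seq (R₁ := fun s'' => s''.nvar 15 =
      s.narr 2 ((n - j + 1) * S + s'.narr 3 (n - j + 1))) (Runs.setNat ?_) fun s3 hF3 h3 =>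
      Runs.putNat ?_) (by simp) (fun _ _ h => h)
    · simp [g0, g6, ga, h9, k1, show n + 1 - j = n - j + 1 by omega]
    · have e0 : s3.nvar 0 = n := (hF3.nvar 0 rfl).trans g0
      have e9 : s3.nvar 9 = j := (hF3.nvar 9 rfl).trans h9
      have ea : s3.narr 3 = s'.narr 3 := hF3.narr 3 rfl
      simp only [State.setN_nvar, State.setN_narr, State.putN_nvar, State.putN_narr, if_true,
        eval_sub, eval_var, e0, e9, h3, ea, show ¬ (15 = 9) by norm_num, if_false]
      refine ⟨?_, ?_, fun k hk hk' => ?_⟩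
      · rw [if_pos (by omega)]
      · rw [if_neg (by omega), k2]
      · rw [if_neg (show k + 1 ≠ n - j by omega)]
        by_cases hkj : k = n - j
        · rw [if_pos hkj, hkj]
        · rw [if_neg hkj]; exact k3 k hk (by omega)
  · simp
    nlinarith
  · intro s' _ ⟨_, k2, k3⟩
    exact ⟨k2, fun k hk => k3 k hk (by omega)⟩

end MPSAlgorithm

/-! ### Loops that fill arrays with prescribed contents -/

namespace RealRAM

/-- The real arrays change only towards the target contents, which are reached in the cells `W`. -/
structure Writes (tgt : ℕ → ℕ → ℝ) (W : ℕ → ℕ → Prop) (s s' : State) : Prop where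
  keep : ∀ a i, s'.rarr a i = s.rarr a i ∨ s'.rarr a i = tgt a i
  done : ∀ a i, W a i → s'.rarr a i = tgt a i

/-- Every write moves a cell to its prescribed value, so a correct cell stays correct. This spares
all arguments that different index expressions address different cells. -/
lemma Writes.persist {tgt : ℕ → ℕ → ℝ} {W : ℕ → ℕ → Prop} {s s' : State} (h : Writes tgt W s s')
    {a i : ℕ} (hs : s.rarr a i = tgt a i) : s'.rarr a i = tgt a i := by
  rcases h.keep a i with h' | h'
  · rw [h', hs]
  · exact h'

lemma Writes.trans {tgt : ℕ → ℕ → ℝ} {W W' W'' : ℕ → ℕ → Prop} {s s₁ s₂ : State}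
    (h : Writes tgt W s s₁) (h' : Writes tgt W' s₁ s₂) (hW : ∀ a i, W'' a i → W a i ∨ W' a i) :
    Writes tgt W'' s s₂ := by
  refine ⟨fun a i => ?_, fun a i hw => ?_⟩
  · rcases h'.keep a i with e | e
    · rw [e]; exact h.keep a i
    · exact Or.inr e
  · rcases hW a i hw with hw | hw
    · exact h'.persist (h.done a i hw)
    · exact h'.done a i hw

lemma Writes.mono {tgt : ℕ → ℕ → ℝ} {W W' : ℕ → ℕ → Prop} {s s' : State} (h : Writes tgt W s s')
    (hW : ∀ a i, W' a i → W a i) : Writes tgt W' s s' :=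
  ⟨h.keep, fun a i hw => h.done a i (hW a i hw)⟩

lemma Runs.putWrites {tgt : ℕ → ℕ → ℝ} {a k : ℕ} {i : NExp} {e : RExp} {s : State}
    (hi : i.eval s = k) (h : e.eval s = tgt a k) :
    Runs (.putReal a i e) s (i.cost + e.cost + 1)
      (Writes tgt (fun a' j => a' = a ∧ j = k) s) := by
  subst hi
  refine Runs.putReal ⟨fun a' j => ?_, ?_⟩
  · simp only [State.putR_rarr]
    split_ifs with h1 h2
    · subst h1 h2; exact Or.inr h
    · subst h1; exact Or.inl rfl
    · exact Or.inl rfl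
  · rintro a' j ⟨rfl, rfl⟩
    simp [h]

lemma Runs.seqWrites {tgt : ℕ → ℕ → ℝ} {P Q : Prog} {s : State} {T₁ T₂ : ℕ} {W W' : ℕ → ℕ → Prop}
    (h : Runs P s T₁ (Writes tgt W s))
    (h' : ∀ s₁, Frame P s s₁ → Writes tgt W s s₁ → Runs Q s₁ T₂ (Writes tgt W' s₁)) :
    Runs (.seq P Q) s (T₁ + T₂) (Writes tgt (fun a i => W a i ∨ W' a i) s) :=
  Runs.seq h fun s₁ hF hW => (h' s₁ hF hW).mono le_rfl fun _ _ h => hW.trans h fun _ _ h => h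

lemma Runs.forWrites {tgt : ℕ → ℕ → ℝ} {x : ℕ} {b : NExp} {P : Prog} {s : State} (c T : ℕ)
    (W : ℕ → ℕ → ℕ → Prop) (hx : P.modN x = false)
    (hb : ∀ s', Frame (RealRAM.forLt x b P) s s' → b.eval s' = c)
    (hstep : ∀ k < c, ∀ s', Frame (RealRAM.forLt x b P) s s' → s'.nvar x = k →
      Writes tgt (fun a i => ∃ l < k, W l a i) s s' → Runs P s' T (Writes tgt (W k) s')) :
    Runs (RealRAM.forLt x b P) s ((c + 1) * (T + b.cost + 8))
      (Writes tgt (fun a i => ∃ l < c, W l a i) s) := by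
  refine Runs.forLt c T (fun k s' => Writes tgt (fun a i => ∃ l < k, W l a i) s s') hx hb
    ⟨fun a i => Or.inl rfl, fun a i ⟨l, hl, _⟩ => by omega⟩ fun k hk s' hF hk' hI => ?_
  refine (hstep k hk s' hF hk' hI).mono le_rfl fun s'' _ h => ?_
  have := hI.trans h (W'' := fun a i => ∃ l < k + 1, W l a i) fun a i ⟨l, hl, hw⟩ => by
    rcases Nat.lt_succ_iff_lt_or_eq.1 hl with hl | rfl
    · exact Or.inl ⟨l, hl, hw⟩
    · exact Or.inr hw
  exact ⟨this.keep, this.done⟩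

end RealRAM

/-! ### Initialization -/

namespace MPSAlgorithm

open RealRAM Transfer Finset

/-- Contents of the output arrays for a product state. -/
def productOutput (T a i : ℕ) : ℝ :=
  -- By truncated subtraction `1 - i` is `1` at `0` and `0` elsewhere. The bulk tensors repeat with
  -- period `T`, the end tensors have a single nonzero entry, and all bond weights are `1`.
  if a = 4 then ((1 - i % T : ℕ) : ℝ) else if a = 8 then 1 else
    if a = 2 ∨ a = 6 then ((1 - i : ℕ) : ℝ) else 0

/-- Index of the current entry. -/
def entryE : NExp := nv 16 * nv 7 + nv 17

/-- Write an entry of a product state. -/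
def writeProductEntry : Prog :=
  .seq (.putReal 2 entryE (.ofNat (nc 1 - entryE))) <| .seq (.putReal 3 entryE (.ofNat (nc 0))) <|
  .seq (.putReal 4 entryE (.ofNat (nc 1 - nv 17))) <| .seq (.putReal 5 entryE (.ofNat (nc 0))) <|
  .seq (.putReal 6 entryE (.ofNat (nc 1 - entryE))) <| .seq (.putReal 7 entryE (.ofNat (nc 0)))
  (.putReal 8 entryE (.ofNat (nc 1)))

/-- Output a product state. -/
def writeProduct : Prog :=
  .seq (.setNat 7 (nv 1 * nv 2 * nv 2)) (forLt 16 (nv 0) (forLt 17 (nv 7) writeProductEntry))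

lemma runs_writeProductEntry {T j q : ℕ} {s : State} (hT : s.nvar 7 = T) (hj : s.nvar 16 = j)
    (hq : s.nvar 17 = q) (hqT : q < T) :
    Runs writeProductEntry s 100
      (Writes (productOutput T) (fun a i => 2 ≤ a ∧ a ≤ 8 ∧ i = j * T + q) s) := by
  have hmod : (j * T + q) % T = q := by
    rw [Nat.mul_add_mod', Nat.mod_eq_of_lt hqT]
  have key : ∀ s', s'.nvar = s.nvar → entryE.eval s' = j * T + q := fun s' h => by
    simp [entryE, h, hT, hj, hq]
  have hk : ∀ {R : Prog} {s₁ s₂ : State}, (∀ x, R.modN x = false) → Frame R s₁ s₂ →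
      s₁.nvar = s.nvar → s₂.nvar = s.nvar :=
    fun hR hF h => (funext fun x => hF.nvar x (hR x)).trans h
  refine Runs.mono (Runs.seqWrites (Runs.putWrites (key s rfl) ?_) fun s1 hF1 _ =>
    have g1 := hk (fun _ => rfl) hF1 rfl
    Runs.seqWrites (Runs.putWrites (key s1 g1) ?_) fun s2 hF2 _ =>
    have g2 := hk (fun _ => rfl) hF2 g1
    Runs.seqWrites (Runs.putWrites (key s2 g2) ?_) fun s3 hF3 _ =>
    have g3 := hk (fun _ => rfl) hF3 g2
    Runs.seqWrites (Runs.putWrites (key s3 g3) ?_) fun s4 hF4 _ =>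
    have g4 := hk (fun _ => rfl) hF4 g3
    Runs.seqWrites (Runs.putWrites (key s4 g4) ?_) fun s5 hF5 _ =>
    have g5 := hk (fun _ => rfl) hF5 g4
    Runs.seqWrites (Runs.putWrites (key s5 g5) ?_) fun s6 hF6 _ =>
    Runs.putWrites (key s6 (hk (fun _ => rfl) hF6 g5)) ?_)
    (by simp [RExp.cost, entryE]) fun s' hF h => h.mono fun a i ⟨h1, h2, h3⟩ => ?_
  · simp [RExp.eval, key s rfl, productOutput]
  · simp [RExp.eval, productOutput]
  · simp [RExp.eval, productOutput, g2, hq, hmod]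
  · simp [RExp.eval, productOutput]
  · simp [RExp.eval, key _ g4, productOutput]
  · simp [RExp.eval, productOutput]
  · simp [RExp.eval, productOutput]
  · omega

lemma runs_writeProduct {n d D : ℕ} {s : State} (h0 : s.nvar 0 = n) (h1 : s.nvar 1 = d)
    (h2 : s.nvar 2 = D) (hn : 1 ≤ n) (hT : 1 ≤ d * D * D) :
    Runs writeProduct s (600 * (n * (d * D * D))) fun s' => s'.nvar 7 = d * D * D ∧
      ∀ a, 2 ≤ a → a ≤ 8 → ∀ i < n * (d * D * D), s'.rarr a i = productOutput (d * D * D) a i := by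
  set T := d * D * D with hTd
  refine Runs.mono (Runs.seq (R₁ := fun s' => s'.nvar 7 = T) (Runs.setNat (by simp [h1, h2, hTd]))
    fun s1 hF1 h7 => (Runs.forWrites (tgt := productOutput T) n ((T + 1) * (100 + 1 + 8))
      (fun j a i => ∃ q < T, 2 ≤ a ∧ a ≤ 8 ∧ i = j * T + q) rfl ?_ ?_).mono le_rfl
      fun s' hF hW => ⟨?_, ?_⟩) ?_ (fun _ _ h => h)
  · intro s' hF
    simp [hF.nvar 0 rfl, hF1.nvar 0 rfl, h0]
  · intro j hj s' hF hjx _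
    have g7 : s'.nvar 7 = T := (hF.nvar 7 rfl).trans h7
    refine Runs.forWrites T 100 (fun q a i => 2 ≤ a ∧ a ≤ 8 ∧ i = j * T + q) rfl ?_ ?_
    · intro s'' hF'
      simp [hF'.nvar 7 rfl, g7]
    · intro q hq s'' hF' hqx _
      exact runs_writeProductEntry ((hF'.nvar 7 rfl).trans g7) ((hF'.nvar 16 rfl).trans hjx) hqx hq
  · simp only [cost_mul, cost_var]
    nlinarith [Nat.mul_le_mul hn hT]
  · exact (hF.nvar 7 rfl).trans h7
  · intro a ha2 ha8 i hi
    refine hW.done a i ⟨i / T, Nat.div_lt_of_lt_mul (by rwa [mul_comm]), i % T,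
      Nat.mod_lt _ hT, ha2, ha8, ?_⟩
    rw [mul_comm]; exact (Nat.div_add_mod i T).symm

/-- The number of grid cells between `0` and `1`. -/
noncomputable def gridSize (d D : ℕ) (ε : ℝ) : ℕ := ⌈((2240 * d ^ 5 * D ^ 10 : ℕ) : ℝ) / ε⌉₊

/-- The tolerance for violations of the constraints. -/
noncomputable def tolerance (d D : ℕ) (ε : ℝ) : ℝ := ε / (80 * d ^ 4 * D ^ 7)

/-- Powers. -/
def powE (e : NExp) : ℕ → NExp
  | 0 => nc 1
  | k + 1 => powE e k * e

lemma eval_powE (e : NExp) (s : State) : ∀ k, (powE e k).eval s = e.eval s ^ k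
  | 0 => rfl
  | k + 1 => by rw [powE, eval_mul, eval_powE e s k, pow_succ]

/-- Compute the tolerance and the grid size. -/
def chooseGrid : Prog :=
  .seq (.setReal 3 (.div (.var 0) (.ofNat (nc 80 * powE (nv 1) 4 * powE (nv 2) 7)))) <|
  .seq (.setReal 3 (.mul (.var 3) (.var 3))) <|
  .seq (.setNat 8 (nc 2240 * powE (nv 1) 5 * powE (nv 2) 10)) <|
  .seq (.setNat 3 (nc 0))
  (.while (.not (.realLe (.ofNat (nv 8)) (.mul (.ofNat (nv 3)) (.var 0))))
    (.setNat 3 (nv 3 + nc 1)))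

/-- Without a rounding operation the ceiling is found by counting upwards; the time is linear in the
grid size, which is less than the size of the net. The tolerance is kept squared because penalties
are sums of squares. -/
lemma runs_chooseGrid {d D : ℕ} {ε : ℝ} {s : State} (h1 : s.nvar 1 = d) (h2 : s.nvar 2 = D)
    (h0 : s.rvar 0 = ε) (hε : 0 < ε) :
    Runs chooseGrid s (100 * (gridSize d D ε + 1)) fun s' => s'.nvar 3 = gridSize d D ε ∧
      s'.rvar 3 = tolerance d D ε ^ 2 := by
  refine Runs.mono (Runs.seq (R₁ := fun s' => s'.rvar 3 = tolerance d D ε) (Runs.setReal ?_)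
    fun s1 hF1 k1 => Runs.seq (R₁ := fun s' => s'.rvar 3 = tolerance d D ε ^ 2) (Runs.setReal ?_)
    fun s2 hF2 k2 => Runs.seq (R₁ := fun s' => s'.nvar 8 = 2240 * d ^ 5 * D ^ 10) (Runs.setNat ?_)
    fun s3 hF3 k3 => Runs.seq (R₁ := fun s' => s'.nvar 3 = 0) (Runs.setNat (by simp))
    fun s4 hF4 k4 => Runs.whileLoop (gridSize d D ε) 4 (fun k s' => s'.nvar 3 = k ∧
      s'.rvar 3 = tolerance d D ε ^ 2 ∧ s'.nvar 8 = 2240 * d ^ 5 * D ^ 10 ∧ s'.rvar 0 = ε)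
      ?_ ?_ ⟨k4, ?_, ?_, ?_⟩) ?_ (fun _ _ h => ⟨h.1, h.2.1⟩)
  · simp [RExp.eval, eval_powE, h0, h1, h2, tolerance]
  · simp [RExp.eval, k1, sq]
  · simp [eval_powE, hF2.nvar 1 rfl, hF2.nvar 2 rfl, hF1.nvar 1 rfl, hF1.nvar 2 rfl, h1, h2]
  · rintro k hk s' ⟨a1, a2, a3, a4⟩
    refine ⟨?_, Runs.setNat (by simp [a1, a2, a3, a4])⟩
    simp only [Test.Holds, RExp.eval, eval_var, a1, a3, a4, not_le]
    rw [gridSize, Nat.lt_ceil, lt_div_iff₀ hε] at hk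
    exact hk
  · rintro s' ⟨a1, a2, a3, a4⟩
    simp only [Test.Holds, RExp.eval, eval_var, a1, a3, a4, not_not]
    have := Nat.le_ceil (((2240 * d ^ 5 * D ^ 10 : ℕ) : ℝ) / ε)
    rwa [div_le_iff₀ hε] at this
  · rw [hF4.rvar 3 rfl, hF3.rvar 3 rfl, k2]
  · rw [hF4.nvar 8 rfl, k3]
  · rw [hF4.rvar 0 rfl, hF3.rvar 0 rfl, hF2.rvar 0 rfl, hF1.rvar 0 rfl, h0]
  · simp [RExp.cost, Test.cost, powE]
    omega

/-- Count the grid points. -/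
def countPoints : Prog :=
  .seq (.setNat 4 (nc 2 * nv 3 + nc 1)) <| .seq (.setNat 5 (nc 2 * nv 7 + nc 2 * (nv 2 * nv 2))) <|
  .seq (.putNat 0 (nc 0) (nc 1)) <|
  .seq (forLt 16 (nv 5) (.putNat 0 (nv 16 + nc 1) (.get 0 (nv 16) * nv 4)))
  (.setNat 6 (.get 0 (nv 5)))

lemma runs_countPoints {d D M : ℕ} {s : State} (h7 : s.nvar 7 = d * D * D) (h2 : s.nvar 2 = D)
    (h3 : s.nvar 3 = M) :
    Runs countPoints s (100 * (coords d D + 1)) fun s' => s'.nvar 4 = 2 * M + 1 ∧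
      s'.nvar 5 = coords d D ∧ s'.nvar 6 = (2 * M + 1) ^ coords d D ∧
      ∀ q ≤ coords d D, s'.narr 0 q = (2 * M + 1) ^ q := by
  refine Runs.mono (Runs.seq (R₁ := fun s' => s'.nvar 4 = 2 * M + 1) (Runs.setNat (by simp [h3]))
    fun s1 hF1 k1 => Runs.seq (R₁ := fun s' => s'.nvar 5 = coords d D) (Runs.setNat ?_)
    fun s2 hF2 k2 => Runs.seq (R₁ := fun s' => s'.narr 0 0 = 1) (Runs.putNat (by simp))
    fun s3 hF3 k3 => Runs.seq (Runs.forLt (coords d D) 8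
      (fun k s' => ∀ q ≤ k, s'.narr 0 q = (2 * M + 1) ^ q) rfl ?_ ?_ ?_)
    fun s4 hF4 k4 => Runs.setNat ?_) ?_ (fun _ _ h => h)
  · simp [hF1.nvar 7 rfl, hF1.nvar 2 rfl, h7, h2, coords]
  · intro s' hF
    simp [hF.nvar 5 rfl, hF3.nvar 5 rfl, k2]
  · intro q hq
    obtain rfl : q = 0 := by omega
    simpa using k3
  · intro k hk s' hF hx hI
    refine (Runs.putNat ?_).mono (by simp) (fun _ _ h => h)
    intro q hq
    have e4 : s'.nvar 4 = 2 * M + 1 := by rw [hF.nvar 4 rfl, hF3.nvar 4 rfl, hF2.nvar 4 rfl, k1]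
    simp only [State.setN_narr, State.putN_narr, if_true, eval_add, eval_var, eval_const, hx,
      eval_mul, eval_get, e4, hI k le_rfl]
    split_ifs with h
    · rw [h, pow_succ]
    · exact hI q (by omega)
  · have e5 : s4.nvar 5 = coords d D := by rw [hF4.nvar 5 rfl, hF3.nvar 5 rfl, k2]
    have e4 : s4.nvar 4 = 2 * M + 1 := by
      rw [hF4.nvar 4 rfl, hF3.nvar 4 rfl, hF2.nvar 4 rfl, k1]
    simpa [e5, e4, k4 _ le_rfl] using k4
  · simp
    omega

/-- Contents of the array of the net. -/
noncomputable def netEntry (P M i : ℕ) : ℝ :=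
  (((i / P / (2 * M + 1) ^ (i % P) % (2 * M + 1) : ℕ) : ℝ) - M) / M

/-- List the points of the net. -/
def makeNet : Prog :=
  forLt 16 (nv 5) <| forLt 17 (.get 0 (nv 5 - nc 1 - nv 16)) <| forLt 18 (nv 4) <|
  forLt 19 (.get 0 (nv 16)) <|
  .putReal 9 (((nv 17 * nv 4 + nv 18) * .get 0 (nv 16) + nv 19) * nv 5 + nv 16)
    (.div (.sub (.ofNat (nv 18)) (.ofNat (nv 3))) (.ofNat (nv 3)))

/-- The points are numbered by their digits in base `2 * M + 1`. As there is no integer division to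
extract digits, the loops run over the decompositions `x = (hi * b + j) * b ^ q + lo`, in which
digit `q` is `j`. Hence four nested loops. -/
lemma runs_makeNet {P M R : ℕ} {s : State} (h3 : s.nvar 3 = M) (h4 : s.nvar 4 = 2 * M + 1)
    (h5 : s.nvar 5 = P) (hpow : ∀ q ≤ P, s.narr 0 q = (2 * M + 1) ^ q)
    (hM : 1 ≤ M) (hR : (2 * M + 1) ^ P + 1 ≤ R) :
    Runs makeNet s (100 * R ^ 4) fun s' => ∀ x < (2 * M + 1) ^ P, ∀ q < P,
      s'.rarr 9 (x * P + q) = netEntry P M (x * P + q) := by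
  set b := 2 * M + 1 with hb
  have hP : P + 1 ≤ R := by
    have := Nat.lt_pow_self (n := P) (show 1 < b by omega)
    omega
  have hq : ∀ q ≤ P, b ^ q + 1 ≤ R := fun q hq => by
    have := Nat.pow_le_pow_right (show 0 < b by omega) hq
    omega
  have hb0 : 0 < b := by omega
  refine (Runs.forWrites (tgt := fun _ i => netEntry P M i) P ((64 + (6 + 8)) * R ^ 3)
    (fun q a i => ∃ hi < b ^ (P - 1 - q), ∃ j < b, ∃ lo < b ^ q, a = 9 ∧
      i = ((hi * b + j) * b ^ q + lo) * P + q) rfl ?_ ?_).mono ?_ ?_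
  · intro s' hF
    simp [hF.nvar 5 rfl, h5]
  · intro q hqP s1 hF1 hqx _
    have g3 := (hF1.nvar 3 rfl).trans h3
    have g4 := (hF1.nvar 4 rfl).trans h4
    have g5 := (hF1.nvar 5 rfl).trans h5
    have g0 : ∀ q ≤ P, s1.narr 0 q = b ^ q := fun q hq => by rw [hF1.narr 0 rfl]; exact hpow q hq
    refine (Runs.forWrites (tgt := fun _ i => netEntry P M i) (b ^ (P - 1 - q))
      ((55 + (1 + 8)) * R ^ 2) (fun hi a i => ∃ j < b, ∃ lo < b ^ q, a = 9 ∧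
      i = ((hi * b + j) * b ^ q + lo) * P + q) rfl ?_ ?_).mono ?_ (fun _ _ h => h)
    · intro s' hF
      simp [hF.nvar 5 rfl, hF.nvar 16 rfl, hF.narr 0 rfl, g5, hqx, g0 (P - 1 - q) (by omega)]
    · intro hi hhi s2 hF2 hhx _
      refine (Runs.forWrites (tgt := fun _ i => netEntry P M i) b
        ((45 + (2 + 8)) * R ^ 1) (fun j a i => ∃ lo < b ^ q, a = 9 ∧
        i = ((hi * b + j) * b ^ q + lo) * P + q) rfl ?_ ?_).mono ?_ (fun _ _ h => h)
      · intro s' hF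
        simp [hF.nvar 4 rfl, hF2.nvar 4 rfl, g4]
      · intro j hj s3 hF3 hjx _
        refine (Runs.forWrites (tgt := fun _ i => netEntry P M i) (b ^ q)
          (45 * R ^ 0) (fun lo a i => a = 9 ∧
          i = ((hi * b + j) * b ^ q + lo) * P + q) rfl ?_ ?_).mono (loop_time (hq q hqP.le))
            (fun _ _ h => h)
        · intro s' hF
          simp [hF.nvar 16 rfl, hF.narr 0 rfl, hF3.nvar 16 rfl, hF3.narr 0 rfl, hF2.nvar 16 rfl,
            hF2.narr 0 rfl, hqx, g0 q hqP.le]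
        · intro lo hlo s4 hF4 hlx _
          have e3 : s4.nvar 3 = M := by rw [hF4.nvar 3 rfl, hF3.nvar 3 rfl, hF2.nvar 3 rfl, g3]
          have e4 : s4.nvar 4 = b := by rw [hF4.nvar 4 rfl, hF3.nvar 4 rfl, hF2.nvar 4 rfl, g4]
          have e5 : s4.nvar 5 = P := by rw [hF4.nvar 5 rfl, hF3.nvar 5 rfl, hF2.nvar 5 rfl, g5]
          have e16 : s4.nvar 16 = q := by rw [hF4.nvar 16 rfl, hF3.nvar 16 rfl, hF2.nvar 16 rfl, hqx]
          have e17 : s4.nvar 17 = hi := by rw [hF4.nvar 17 rfl, hF3.nvar 17 rfl, hhx]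
          have e18 : s4.nvar 18 = j := by rw [hF4.nvar 18 rfl, hjx]
          have e0 : s4.narr 0 q = b ^ q := by
            rw [hF4.narr 0 rfl, hF3.narr 0 rfl, hF2.narr 0 rfl, g0 q hqP.le]
          have ei : NExp.eval s4 (((nv 17 * nv 4 + nv 18) * .get 0 (nv 16) + nv 19) * nv 5 + nv 16) =
              ((hi * b + j) * b ^ q + lo) * P + q := by
            simp only [eval_add, eval_mul, eval_var, eval_get, e4, e5, e16, e17, e18, e0, hlx]
          refine (Runs.putWrites ei ?_).mono (by simp [RExp.cost]) fun _ _ h => h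
          have h1 : (((hi * b + j) * b ^ q + lo) * P + q) / P = (hi * b + j) * b ^ q + lo := by
            rw [mul_comm, Nat.mul_add_div (by omega), Nat.div_eq_of_lt hqP, add_zero]
          have h2 : (((hi * b + j) * b ^ q + lo) * P + q) % P = q := by
            rw [Nat.mul_add_mod', Nat.mod_eq_of_lt hqP]
          have h3 : ((hi * b + j) * b ^ q + lo) / b ^ q = hi * b + j := by
            rw [mul_comm, Nat.mul_add_div (by positivity), Nat.div_eq_of_lt hlo, add_zero]
          rw [netEntry, h1, h2, ← hb, h3, Nat.mul_add_mod', Nat.mod_eq_of_lt hj]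
          simp [RExp.eval, e18, e3]
      · exact loop_time (by have := hq 1 (by omega); rw [pow_one] at this; exact this)
    · exact loop_time (hq (P - 1 - q) (by omega))
  · have := loop_time (C := 64 + (6 + 8)) (e := 3) (a := 1) (b := 8) hP
    refine this.trans (Nat.mul_le_mul_right _ (by norm_num))
  · intro s' _ h x hx q hqP
    -- Division with remainder shows that each number of a point is reached by one of these
    -- decompositions.
    refine h.done 9 _ ⟨q, hqP, x / b ^ q / b, ?_, x / b ^ q % b, Nat.mod_lt _ hb0, x % b ^ q,
      Nat.mod_lt _ (by positivity), rfl, ?_⟩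
    · rw [Nat.div_div_eq_div_mul, ← pow_succ]
      refine Nat.div_lt_of_lt_mul ?_
      rw [← pow_add, show q + 1 + (P - 1 - q) = P by omega]
      exact hx
    · rw [mul_comm _ b, Nat.div_add_mod, mul_comm _ (b ^ q), Nat.div_add_mod]

lemma exists_digits (b : ℕ) (hb : 0 < b) : ∀ (P : ℕ) (f : ℕ → ℕ), (∀ q, f q < b) →
    ∃ x < b ^ P, ∀ q < P, x / b ^ q % b = f q
  | 0, _, _ => ⟨0, by simp, by simp⟩
  | P + 1, f, hf => by
    obtain ⟨x, hx, h⟩ := exists_digits b hb P (fun q => f (q + 1)) fun q => hf _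
    refine ⟨x * b + f 0, ?_, fun q hq => ?_⟩
    · rw [pow_succ]; exact index_lt hx (hf 0)
    · have e : (x * b + f 0) / b = x := by
        rw [mul_comm, Nat.mul_add_div hb, Nat.div_eq_of_lt (hf 0), add_zero]
      cases q with
      | zero => simp [Nat.mod_eq_of_lt (hf 0)]
      | succ q => rw [pow_succ', ← Nat.div_div_eq_div_mul, e]; exact h q (by omega)

lemma net_of_entries {P M : ℕ} {net : ℕ → ℝ} (hM : 1 ≤ M)
    (h : ∀ x < (2 * M + 1) ^ P, ∀ q < P, net (x * P + q) = netEntry P M (x * P + q)) :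
    Net P M ((2 * M + 1) ^ P) (points P net) := by
  have key : ∀ x < (2 * M + 1) ^ P, ∀ q < P, points P net x q =
      (((x / (2 * M + 1) ^ q % (2 * M + 1) : ℕ) : ℝ) - M) / M := fun x hx q hq => by
    rw [points, h x hx q hq, netEntry, Nat.mul_add_mod', Nat.mod_eq_of_lt hq, mul_comm x,
      Nat.mul_add_div (by omega), Nat.div_eq_of_lt hq, add_zero]
  have hM0 : (0 : ℝ) < M := by exact_mod_cast hM
  refine ⟨fun x hx q hq => ?_, fun f hf => ?_⟩
  · rw [key x hx q hq, abs_div, abs_of_pos hM0, div_le_one hM0, abs_le]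
    have h1 : x / (2 * M + 1) ^ q % (2 * M + 1) ≤ 2 * M :=
      Nat.lt_succ_iff.1 (Nat.mod_lt _ (by omega))
    have h2 : ((x / (2 * M + 1) ^ q % (2 * M + 1) : ℕ) : ℝ) ≤ 2 * M := by exact_mod_cast h1
    constructor
    · have : (0 : ℝ) ≤ ((x / (2 * M + 1) ^ q % (2 * M + 1) : ℕ) : ℝ) := Nat.cast_nonneg _
      linarith
    · linarith
  · obtain ⟨x, hx, hxf⟩ := exists_digits (2 * M + 1) (by omega) P f hf
    exact ⟨x, hx, fun q hq => by rw [key x hx q hq, hxf q hq]⟩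

end MPSAlgorithm

/-! ### Norm and output -/

namespace RealRAM

/-- Fill two real arrays with the real and imaginary parts of a complex array of two indices. -/
def fillPair (x : ℕ) (b : NExp) (y : ℕ) (b' : NExp) (a a' : ℕ) (i : NExp) (e : CExp) : Prog :=
  forLt x b (forLt y b' (.seq (.putReal a i e.re) (.putReal a' i e.im)))

/-- Cost of one round of `fillPair`. -/
def fillCost (i : NExp) (e : CExp) : ℕ := i.cost + e.re.cost + 1 + (i.cost + e.im.cost + 1)

/-- The value of `e` is required in all states that the loops can reach; so it has to be independent
of what the loops write. -/
lemma Runs.fillPair {x y a a' : ℕ} {b b' i : NExp} {e : CExp} {s : State} {c c' : ℕ}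
    (f : ℕ → ℕ → ℂ) (hxy : x ≠ y) (haa : a ≠ a')
    (hb : ∀ s', Frame (RealRAM.fillPair x b y b' a a' i e) s s' → b.eval s' = c)
    (hb' : ∀ s', Frame (RealRAM.fillPair x b y b' a a' i e) s s' → b'.eval s' = c')
    (h : ∀ j < c, ∀ q < c', ∀ s', Frame (RealRAM.fillPair x b y b' a a' i e) s s' →
      s'.nvar x = j → s'.nvar y = q → i.eval s' = j * c' + q ∧ e.ev s' = f j q) :
    Runs (RealRAM.fillPair x b y b' a a' i e) s
      ((c + 1) * ((c' + 1) * (fillCost i e + b'.cost + 8) + b.cost + 8)) fun s' =>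
      ∀ j < c, ∀ q < c', s'.rarr a (j * c' + q) = (f j q).re ∧
        s'.rarr a' (j * c' + q) = (f j q).im := by
  have hyx : Nat.beq x y = false := Bool.eq_false_iff.2 fun h => hxy (Nat.eq_of_beq_eq_true h)
  have hx : ∀ {s₁ s₂}, Frame (RealRAM.forLt y b' (.seq (.putReal a i e.re) (.putReal a' i e.im)))
      s₁ s₂ → s₂.nvar x = s₁.nvar x := fun hF => hF.nvar x (by
    simp [RealRAM.forLt, Prog.modN, hyx])
  have inner : ∀ {s₁ s₂}, Frame (RealRAM.forLt y b'
      (.seq (.putReal a i e.re) (.putReal a' i e.im))) s₁ s₂ →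
      Frame (RealRAM.fillPair x b y b' a a' i e) s₁ s₂ := fun h =>
    (h.seq_left.while_body).seq_right
  have body : ∀ {s₁ s₂}, Frame (.seq (.putReal a i e.re) (.putReal a' i e.im)) s₁ s₂ →
      Frame (RealRAM.forLt y b' (.seq (.putReal a i e.re) (.putReal a' i e.im))) s₁ s₂ := fun h =>
    (h.seq_left.while_body).seq_right
  set tgt : ℕ → ℕ → ℝ := fun α i =>
    if α = a then (f (i / c') (i % c')).re else (f (i / c') (i % c')).im with htgt
  have ht : ∀ j q, q < c' → tgt a (j * c' + q) = (f j q).re ∧ tgt a' (j * c' + q) = (f j q).im := by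
    intro j q hq
    have h1 : (j * c' + q) / c' = j := by
      rw [mul_comm, Nat.mul_add_div (by omega), Nat.div_eq_of_lt hq, add_zero]
    have h2 : (j * c' + q) % c' = q := by rw [Nat.mul_add_mod', Nat.mod_eq_of_lt hq]
    rw [htgt]
    simp [h1, h2, haa.symm]
  refine (Runs.forWrites (tgt := tgt) c ((c' + 1) * (fillCost i e + b'.cost + 8))
    (fun j α k => ∃ q < c', (α = a ∧ k = j * c' + q) ∨ (α = a' ∧ k = j * c' + q)) ?_ hb ?_).mono
    le_rfl fun s' _ hW j hj q hq => ?_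
  · simp [RealRAM.forLt, Prog.modN, hyx]
  · intro j hj s1 hF1 hjx _
    refine Runs.forWrites c' (fillCost i e)
      (fun q α k => (α = a ∧ k = j * c' + q) ∨ (α = a' ∧ k = j * c' + q)) rfl ?_ ?_
    · exact fun s' hF => hb' s' (hF1.trans (inner hF))
    · intro q hq s2 hF2 hqy _
      have h2 := h j hj q hq s2 (hF1.trans (inner hF2)) ((hx hF2).trans hjx) hqy
      refine Runs.seqWrites (Runs.putWrites h2.1 ?_) fun s3 hF3 _ => ?_
      · rw [(ht j q hq).1, CExp.eval_re, h2.2]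
      · have hF3' := hF2.trans (body hF3.seq_left)
        have h3 := h j hj q hq s3 (hF1.trans (inner hF3')) ((hx hF3').trans hjx)
          ((hF3.nvar y rfl).trans hqy)
        refine Runs.putWrites h3.1 ?_
        rw [(ht j q hq).2, CExp.eval_im, h3.2]
  · constructor
    · rw [hW.done a _ ⟨j, hj, q, hq, Or.inl ⟨rfl, rfl⟩⟩, (ht j q hq).1]
    · rw [hW.done a' _ ⟨j, hj, q, hq, Or.inr ⟨rfl, rfl⟩⟩, (ht j q hq).2]

lemma fill_time {c c' R C a b : ℕ} (hc' : c' + 1 ≤ R) :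
    (c + 1) * ((c' + 1) * (C + a + 8) + b + 8) ≤ (C + a + b + 16) * ((c + 1) * R) := by
  calc _ ≤ (c + 1) * (R * (C + a + 8) + R * (b + 8)) := by
        refine Nat.mul_le_mul_left _ ?_
        have h1 := Nat.mul_le_mul_right (C + a + 8) hc'
        have h2 := Nat.mul_le_mul_right (b + 8) (show 1 ≤ R by omega)
        omega
    _ = _ := by ring

end RealRAM

namespace MPSAlgorithm

open RealRAM Transfer Finset

/-- Left environments of the bonds, starting from the vacuum, with natural numbers as indices. -/
noncomputable def gram (d D : ℕ) (v : ℕ → ℕ → ℝ) : ℕ → ℕ → ℕ → ℂ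
  | 0, α, β => (((1 - α) * (1 - β) : ℕ) : ℂ)
  | k + 1, β, β' => ∑ i ∈ range d, ∑ α ∈ range D, ∑ α' ∈ range D,
      star (tensorN d D (v k) i α β) * gram d D v k α α' * tensorN d D (v k) i α' β'

lemma gram_eq {d D : ℕ} [NeZero D] (v : ℕ → ℕ → ℝ) (k : ℕ) (β β' : Fin D) :
    gram d D v k β β' = env (fun k => tensorOf d D (v k)) (vac D) k β β' := by
  induction k generalizing β β' with
  | zero =>
    have h : ∀ γ : Fin D, (1 - (γ : ℕ)) = if γ = 0 then 1 else 0 := fun γ => by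
      split_ifs with h
      · simp [h]
      · have := Fin.val_eq_zero_iff.not.2 h
        omega
    simp only [gram, env, vac_apply, h]
    split_ifs <;> simp_all
  | succ k ih =>
    simp only [gram, env, xfer, Finset.sum_range, Matrix.sum_apply, Matrix.mul_apply, ih, sum_mul,
      Matrix.conjTranspose_apply, tensorOf_apply]
    exact sum_congr rfl fun i _ => sum_comm

/-- Loops for one step of the computation of the norm. -/
def gramLoops : List (ℕ × NExp) := [(20, nv 1), (21, nv 2), (22, nv 2)]

/-- Summand of an entry of the next environment. -/
def gramE : CExp :=
  (tensorE (.get 3 (nv 9 + nc 1)) (nv 20) (nv 21) (nv 16)).conj *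
    .get 11 12 (nv 9 * (nv 2 * nv 2) + (nv 21 * nv 2 + nv 22)) *
    tensorE (.get 3 (nv 9 + nc 1)) (nv 20) (nv 22) (nv 17)

/-- Address of an entry of the next environment. -/
def gramIndex : NExp := (nv 9 + nc 1) * (nv 2 * nv 2) + (nv 16 * nv 2 + nv 17)

/-- Compute an entry of the next environment. -/
def gramEntry : Prog :=
  .seq (.setReal 6 (.ofNat (nc 0))) <| .seq (.setReal 7 (.ofNat (nc 0))) <|
  .seq (sumLoop 6 gramLoops gramE.re) <| .seq (sumLoop 7 gramLoops gramE.im) <|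
  .seq (.putReal 11 gramIndex (.var 6)) (.putReal 12 gramIndex (.var 7))

/-- Compute all environments. -/
def gramSweep : Prog :=
  .seq (fillPair 16 (nv 2) 17 (nv 2) 11 12 (nv 16 * nv 2 + nv 17)
    (.ofNat ((nc 1 - nv 16) * (nc 1 - nv 17)))) <|
  forLt 9 (nv 0) <| forLt 16 (nv 2) <| forLt 17 (nv 2) gramEntry

/-- Target contents of the arrays of environments. -/
noncomputable def gramTarget (d D : ℕ) (v : ℕ → ℕ → ℝ) (a i : ℕ) : ℝ :=
  if a = 11 then (gram d D v (i / (D * D)) (i % (D * D) / D) (i % (D * D) % D)).re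
  else (gram d D v (i / (D * D)) (i % (D * D) / D) (i % (D * D) % D)).im

lemma gramTarget_eq {d D : ℕ} (v : ℕ → ℕ → ℝ) {k β β' : ℕ} (hβ : β < D) (hβ' : β' < D) :
    gramTarget d D v 11 (k * (D * D) + (β * D + β')) = (gram d D v k β β').re ∧
    gramTarget d D v 12 (k * (D * D) + (β * D + β')) = (gram d D v k β β').im := by
  have h0 := index_lt hβ hβ'
  have h1 : (k * (D * D) + (β * D + β')) / (D * D) = k := by
    rw [mul_comm k, Nat.mul_add_div (by omega), Nat.div_eq_of_lt h0, add_zero]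
  have h2 : (k * (D * D) + (β * D + β')) % (D * D) = β * D + β' := by
    rw [Nat.mul_add_mod', Nat.mod_eq_of_lt h0]
  have h3 : (β * D + β') / D = β := by
    rw [mul_comm, Nat.mul_add_div (by omega), Nat.div_eq_of_lt hβ', add_zero]
  have h4 : (β * D + β') % D = β' := by rw [Nat.mul_add_mod', Nat.mod_eq_of_lt hβ']
  simp [gramTarget, h1, h2, h3, h4]

section Gram

variable {n d D P S k : ℕ} {net r₀ r₁ : ℕ → ℝ} {s : State} {v : ℕ → ℕ → ℝ}

lemma ev_gramE (hs : Ready n d D P S net r₀ r₁ s) {β β' : ℕ} (h9 : s.nvar 9 = k)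
    (h16 : s.nvar 16 = β) (h17 : s.nvar 17 = β')
    (hv : v k = points P net (s.narr 3 (k + 1)))
    (hG : ∀ α < D, ∀ α' < D, s.rarr 11 (k * (D * D) + (α * D + α')) = (gram d D v k α α').re ∧
      s.rarr 12 (k * (D * D) + (α * D + α')) = (gram d D v k α α').im) :
    sumVal s gramLoops gramE.re = (gram d D v (k + 1) β β').re ∧
    sumVal s gramLoops gramE.im = (gram d D v (k + 1) β β').im := by
  have key : ∀ i, ∀ α < D, ∀ α' < D,
      gramE.ev (((s.setN 20 i).setN 21 α).setN 22 α') =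
      star (tensorN d D (v k) i α β) * gram d D v k α α' * tensorN d D (v k) i α' β' := by
    intro i α hα α' hα'
    have hs' := ((hs.setN (x := 20) (by norm_num) i).setN (x := 21) (by norm_num) α).setN
      (x := 22) (by norm_num) α'
    have hG' : (CExp.get 11 12 (nv 9 * (nv 2 * nv 2) + (nv 21 * nv 2 + nv 22))).ev
        (((s.setN 20 i).setN 21 α).setN 22 α') = gram d D v k α α' := by
      rw [CExp.ev_get]
      simp [h9, hs.D_eq, hG α hα α' hα']
    rw [gramE, ev_hmul, ev_hmul, CExp.ev_conj, hG', ev_tensorE hs', ev_tensorE hs', hv]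
    simp [h9, h16, h17]
  constructor
  · simp only [gramLoops, sumVal, gram, Complex.re_sum]
    refine sum_congr (by simp [hs.d_eq]) fun i _ => sum_congr (by simp [hs.D_eq]) fun α hα =>
      sum_congr (by simp [hs.D_eq]) fun α' hα' => ?_
    simp at hα hα'
    rw [CExp.eval_re, key i α hα α' hα']
  · simp only [gramLoops, sumVal, gram, Complex.im_sum]
    refine sum_congr (by simp [hs.d_eq]) fun i _ => sum_congr (by simp [hs.D_eq]) fun α hα =>
      sum_congr (by simp [hs.D_eq]) fun α' hα' => ?_
    simp at hα hα'
    rw [CExp.eval_im, key i α hα α' hα']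

end Gram

lemma Writes.of_rarr_eq {tgt : ℕ → ℕ → ℝ} {W : ℕ → ℕ → Prop} {s s₁ s₂ : State}
    (h : Writes tgt W s₁ s₂) (he : s₁.rarr = s.rarr) : Writes tgt W s s₂ :=
  ⟨fun a i => by rw [← he]; exact h.keep a i, h.done⟩

lemma runs_gramEntry : ∃ C : ℕ, ∀ {n d D P S k β β' R : ℕ} {net r₀ r₁ : ℕ → ℝ} {s : State}
    {v : ℕ → ℕ → ℝ},
    Ready n d D P S net r₀ r₁ s → s.nvar 9 = k → s.nvar 16 = β → s.nvar 17 = β' → β < D → β' < D →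
    v k = points P net (s.narr 3 (k + 1)) →
    (∀ α < D, ∀ α' < D, s.rarr 11 (k * (D * D) + (α * D + α')) = (gram d D v k α α').re ∧
      s.rarr 12 (k * (D * D) + (α * D + α')) = (gram d D v k α α').im) →
    d + 1 ≤ R → D + 1 ≤ R →
    Runs gramEntry s (C * R ^ 3) (Writes (gramTarget d D v)
      (fun a i => (a = 11 ∧ i = (k + 1) * (D * D) + (β * D + β')) ∨
        (a = 12 ∧ i = (k + 1) * (D * D) + (β * D + β'))) s) := by
  refine ⟨sumCost gramLoops gramE.re + sumCost gramLoops gramE.im + 40, ?_⟩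
  intro n d D P S k β β' R net r₀ r₁ s v hs h9 h16 h17 hβ hβ' hv hG hdR hDR
  have bound : ∀ {s' : State}, Ready n d D P S net r₀ r₁ s' → ∀ p ∈ gramLoops,
      p.2.eval s' + 1 ≤ R := by
    intro s' hs' p hp
    simp only [gramLoops, List.mem_cons, List.not_mem_nil, or_false] at hp
    rcases hp with rfl | rfl | rfl <;> simpa [hs'.d_eq, hs'.D_eq]
  refine Runs.mono (Runs.seq (R₁ := fun s' => s'.rvar 6 = 0) (Runs.setReal (by simp [RExp.eval]))
    fun s1 hF1 k1 => Runs.seq (R₁ := fun s' => s'.rvar 7 = 0) (Runs.setReal (by simp [RExp.eval]))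
    fun s2 hF2 k2 =>
    have hs2 := (hs.frame hF1 rfl).frame hF2 rfl
    Runs.seq (Runs.sumLoop (R := R) rfl gramLoops rfl s2 (bound hs2)) fun s3 hF3 k3 =>
    have hs3 := hs2.frame hF3 rfl
    Runs.seq (Runs.sumLoop (R := R) rfl gramLoops rfl s3 (bound hs3)) fun s4 hF4 k4 =>
    (Runs.mono (Runs.seqWrites (tgt := gramTarget d D v)
      (W := fun a i => a = 11 ∧ i = (k + 1) * (D * D) + (β * D + β'))
      (W' := fun a i => a = 12 ∧ i = (k + 1) * (D * D) + (β * D + β')) (T₁ := 15) (T₂ := 15)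
      (Runs.mono (Runs.putWrites ?_ ?_) (by simp [gramIndex, RExp.cost]) (fun _ _ h => h))
      fun s5 hF5 _ => Runs.mono (Runs.putWrites ?_ ?_) (by simp [gramIndex, RExp.cost])
        (fun _ _ h => h)) le_rfl fun s' _ hW => ?_)) ?_ (fun _ _ h => h)
  · simp only [gramIndex, eval_add, eval_mul, eval_var, eval_const]
    rw [hF4.nvar 9 rfl, hF4.nvar 16 rfl, hF4.nvar 17 rfl, hF4.nvar 2 rfl, hF3.nvar 9 rfl,
      hF3.nvar 16 rfl, hF3.nvar 17 rfl, hF3.nvar 2 rfl, hF2.nvar 9 rfl, hF2.nvar 16 rfl,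
      hF2.nvar 17 rfl, hF2.nvar 2 rfl, hF1.nvar 9 rfl, hF1.nvar 16 rfl, hF1.nvar 17 rfl,
      hF1.nvar 2 rfl, h9, h16, h17, hs.D_eq]
  · have := (ev_gramE hs2 (v := v) ((hF2.nvar 9 rfl).trans ((hF1.nvar 9 rfl).trans h9))
      ((hF2.nvar 16 rfl).trans ((hF1.nvar 16 rfl).trans h16))
      ((hF2.nvar 17 rfl).trans ((hF1.nvar 17 rfl).trans h17))
      (by rw [hF2.narr 3 rfl, hF1.narr 3 rfl]; exact hv)
      (by rw [hF2.rarr 11 rfl, hF1.rarr 11 rfl, hF2.rarr 12 rfl, hF1.rarr 12 rfl]; exact hG)).1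
    rw [(gramTarget_eq v hβ hβ').1, RExp.eval, hF4.rvar 6 rfl, k3, hF2.rvar 6 rfl, k1, zero_add, this]
  · simp only [gramIndex, eval_add, eval_mul, eval_var, eval_const]
    rw [hF5.nvar 9 rfl, hF5.nvar 16 rfl, hF5.nvar 17 rfl, hF5.nvar 2 rfl,
      hF4.nvar 9 rfl, hF4.nvar 16 rfl, hF4.nvar 17 rfl, hF4.nvar 2 rfl, hF3.nvar 9 rfl,
      hF3.nvar 16 rfl, hF3.nvar 17 rfl, hF3.nvar 2 rfl, hF2.nvar 9 rfl, hF2.nvar 16 rfl,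
      hF2.nvar 17 rfl, hF2.nvar 2 rfl, hF1.nvar 9 rfl, hF1.nvar 16 rfl, hF1.nvar 17 rfl,
      hF1.nvar 2 rfl, h9, h16, h17, hs.D_eq]
  · have := (ev_gramE hs3 (v := v)
      ((hF3.nvar 9 rfl).trans ((hF2.nvar 9 rfl).trans ((hF1.nvar 9 rfl).trans h9)))
      ((hF3.nvar 16 rfl).trans ((hF2.nvar 16 rfl).trans ((hF1.nvar 16 rfl).trans h16)))
      ((hF3.nvar 17 rfl).trans ((hF2.nvar 17 rfl).trans ((hF1.nvar 17 rfl).trans h17)))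
      (by rw [hF3.narr 3 rfl, hF2.narr 3 rfl, hF1.narr 3 rfl]; exact hv)
      (by
        rw [hF3.rarr 11 rfl, hF2.rarr 11 rfl, hF1.rarr 11 rfl, hF3.rarr 12 rfl, hF2.rarr 12 rfl,
          hF1.rarr 12 rfl]
        exact hG)).2
    rw [(gramTarget_eq v hβ hβ').2, RExp.eval, hF5.rvar 7 rfl, k4, hF3.rvar 7 rfl, k2, zero_add, this]
  · refine Writes.of_rarr_eq hW (funext fun x => ?_)
    rw [hF4.rarr x rfl, hF3.rarr x rfl, hF2.rarr x rfl, hF1.rarr x rfl]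
  · have : 1 ≤ R ^ 3 := Nat.one_le_pow _ _ (by omega)
    simp only [gramLoops, List.length_cons, List.length_nil, RExp.cost, cost_const,
      zero_add, Nat.reduceAdd]
    nlinarith

/-- The squared norm of the state, in time linear in the length. The environments of all bonds are
stored side by side, so no cell is overwritten with a different value and `Writes` applies. -/
lemma runs_gramSweep : ∃ C : ℕ, ∀ {n d D P S R : ℕ} {net r₀ r₁ : ℕ → ℝ} {s : State}
    {v : ℕ → ℕ → ℝ}, Ready n d D P S net r₀ r₁ s → 1 ≤ n → 0 < D →
    (∀ k < n, v k = points P net (s.narr 3 (k + 1))) → d + 1 ≤ R → D + 1 ≤ R →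
    Runs gramSweep s (C * (n * R ^ 5)) fun s' =>
      s'.rarr 11 (n * (D * D)) = (gram d D v n 0 0).re := by
  obtain ⟨C, hC⟩ := runs_gramEntry
  refine ⟨(C + (1 + 8) + (1 + 8) + 9) * 2 + 100, fun {n d D P S R net r₀ r₁ s v} hs hn hD hv hdR hDR => ?_⟩
  refine Runs.mono (Runs.seq (Runs.mono (Runs.fillPair (c := D) (c' := D) (gram d D v 0) (by norm_num)
    (by norm_num) ?_ ?_ ?_) (fill_time hDR) (fun _ _ h => h)) fun s1 hF1 k1 =>
    Runs.mono (Runs.forWrites (tgt := gramTarget d D v) n ((C + (1 + 8) + (1 + 8)) * R ^ 5)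
      (fun k a i => ∃ β < D, ∃ β' < D, (a = 11 ∧ i = (k + 1) * (D * D) + (β * D + β')) ∨
        (a = 12 ∧ i = (k + 1) * (D * D) + (β * D + β'))) rfl ?_ ?_) le_rfl fun s' _ hW => ?_) ?_
      (fun _ _ h => h)
  · intro s' hF
    simp [hF.nvar 2 rfl, hs.D_eq]
  · intro s' hF
    simp [hF.nvar 2 rfl, hs.D_eq]
  · intro j hj q hq s' hF h16 h17
    simp [hF.nvar 2 rfl, hs.D_eq, h16, h17, CExp.ev_ofNat, gram]
  · intro s' hF
    simp [hF.nvar 0 rfl, hF1.nvar 0 rfl, hs.n_eq]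
  · intro k hk s2 hF2 h9 hW2
    have hs2 := (hs.frame hF1 rfl).frame hF2 rfl
    have hG : ∀ α < D, ∀ α' < D,
        s2.rarr 11 (k * (D * D) + (α * D + α')) = (gram d D v k α α').re ∧
        s2.rarr 12 (k * (D * D) + (α * D + α')) = (gram d D v k α α').im := by
      intro α hα α' hα'
      rw [← (gramTarget_eq v hα hα').1, ← (gramTarget_eq v hα hα').2]
      cases k with
      | zero =>
        have h1 := k1 α hα α' hα'
        have h2 := gramTarget_eq (k := 0) (d := d) v hα hα'
        rw [← h2.1, ← h2.2] at h1
        simp only [zero_mul, zero_add] at h1 ⊢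
        exact ⟨hW2.persist h1.1, hW2.persist h1.2⟩
      | succ k =>
        exact ⟨hW2.done _ _ ⟨k, by omega, α, hα, α', hα', Or.inl ⟨rfl, rfl⟩⟩,
          hW2.done _ _ ⟨k, by omega, α, hα, α', hα', Or.inr ⟨rfl, rfl⟩⟩⟩
    have hv2 : v k = points P net (s2.narr 3 (k + 1)) := by
      rw [hF2.narr 3 rfl, hF1.narr 3 rfl]; exact hv k hk
    refine Runs.mono (Runs.forWrites D ((C + (1 + 8)) * R ^ 4)
      (fun β a i => ∃ β' < D, (a = 11 ∧ i = (k + 1) * (D * D) + (β * D + β')) ∨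
        (a = 12 ∧ i = (k + 1) * (D * D) + (β * D + β'))) rfl ?_ ?_) (loop_time hDR) (fun _ _ h => h)
    · intro s' hF
      simp [hF.nvar 2 rfl, hs2.D_eq]
    · intro β hβ s3 hF3 h16 hW3
      refine Runs.mono (Runs.forWrites D (C * R ^ 3)
        (fun β' a i => (a = 11 ∧ i = (k + 1) * (D * D) + (β * D + β')) ∨
          (a = 12 ∧ i = (k + 1) * (D * D) + (β * D + β'))) rfl ?_ ?_) (loop_time hDR)
          (fun _ _ h => h)
      · intro s' hF
        simp [hF.nvar 2 rfl, hF3.nvar 2 rfl, hs2.D_eq]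
      · intro β' hβ' s4 hF4 h17 hW4
        refine hC ((hs2.frame hF3 rfl).frame hF4 rfl) ?_ ?_ h17 hβ hβ' ?_ ?_ hdR hDR
        · rw [hF4.nvar 9 rfl, hF3.nvar 9 rfl, h9]
        · rw [hF4.nvar 16 rfl, h16]
        · rw [hF4.narr 3 rfl, hF3.narr 3 rfl]; exact hv2
        · intro α hα α' hα'
          have := hG α hα α' hα'
          rw [← (gramTarget_eq v hα hα').1, ← (gramTarget_eq v hα hα').2] at this ⊢
          exact ⟨hW4.persist (hW3.persist this.1), hW4.persist (hW3.persist this.2)⟩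
  · have h1 := (gramTarget_eq v (k := n) (d := d) hD hD).1
    simp only [zero_mul, add_zero] at h1
    rw [← h1]
    obtain ⟨l, rfl⟩ : ∃ l, n = l + 1 := ⟨n - 1, by omega⟩
    exact hW.done 11 _ ⟨l, by omega, 0, hD, 0, hD, Or.inl ⟨rfl, by simp⟩⟩
  · have h1 : 1 ≤ R := by omega
    have e1 : (fillCost (nv 16 * nv 2 + nv 17) (.ofNat ((nc 1 - nv 16) * (nc 1 - nv 17))) + (nv 2).cost
        + (nv 2).cost + 16) * ((D + 1) * R) ≤ 100 * (n * R ^ 5) := by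
      have e2 : (D + 1) * R ≤ n * R ^ 5 := by
        calc (D + 1) * R ≤ R * R := Nat.mul_le_mul_right _ hDR
          _ = R ^ 2 := (sq R).symm
          _ ≤ R ^ 5 := Nat.pow_le_pow_right h1 (by norm_num)
          _ ≤ _ := Nat.le_mul_of_pos_left _ hn
      refine Nat.mul_le_mul ?_ e2
      simp [fillCost, CExp.ofNat, RExp.cost]
    have e3 : (n + 1) * ((C + (1 + 8) + (1 + 8)) * R ^ 5 + (nv 0).cost + 8) ≤
        (C + (1 + 8) + (1 + 8) + 9) * 2 * (n * R ^ 5) := by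
      have e4 : 1 ≤ R ^ 5 := Nat.one_le_pow _ _ h1
      calc _ ≤ (2 * n) * ((C + (1 + 8) + (1 + 8) + 9) * R ^ 5) := by
            refine Nat.mul_le_mul (by omega) ?_
            simp only [cost_var]
            nlinarith
        _ = _ := by ring
    have e5 := Nat.add_mul ((C + (1 + 8) + (1 + 8) + 9) * 2) 100 (n * R ^ 5)
    omega

end MPSAlgorithm

/-! ### Output and the complete search -/

namespace MPSAlgorithm

open RealRAM Transfer Finset

/-- Multiplication by the real register `5`. -/
def scaled (z : CExp) : CExp := ⟨.mul (.var 5) z.re, .mul (.var 5) z.im⟩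

lemma ev_scaled (s : State) (z : CExp) : (scaled z).ev s = (s.rvar 5 : ℂ) * z.ev s := by
  apply Complex.ext <;> simp [CExp.ev, scaled, RExp.eval]

/-- Output the normalized state of the path. -/
def writeState : Prog :=
  .seq (.setReal 5 (.div (.ofNat (nc 1)) (.sqrt (.get 11 (nv 0 * (nv 2 * nv 2)))))) <|
  .seq (fillPair 16 (nv 1) 17 (nv 2) 2 3 (nv 16 * nv 2 + nv 17)
    (scaled (tensorE (.get 3 (nc 1)) (nv 16) (nc 0) (nv 17)))) <|
  -- Bulk tensor `j` belongs to site `j + 1`, whose data sit in layer `j + 2`. The net stores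
  -- tensors in the order of the output, so a bulk tensor is copied with a single running index.
  .seq (fillPair 9 (nv 0 - nc 2) 16 (nv 7) 4 5 (nv 9 * nv 7 + nv 16)
    (.get₂ 9 (.get 3 (nv 9 + nc 2) * nv 5 + nv 16)
      (.get 3 (nv 9 + nc 2) * nv 5 + (nv 7 + nv 16))))
  (fillPair 16 (nv 1) 17 (nv 2) 6 7 (nv 16 * nv 2 + nv 17)
    (tensorE (.get 3 (nv 0)) (nv 16) (nv 17) (nc 0)))

/-- The output arrays hold the state given by the tensors `v 0, …, v (n - 1)`, scaled by `c`. -/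
structure Stored (n d D : ℕ) (c : ℝ) (v : ℕ → ℕ → ℝ) (s : State) : Prop where
  first : ∀ i < d, ∀ β < D, s.rarr 2 (i * D + β) = (c * tensorN d D (v 0) i 0 β).re ∧
    s.rarr 3 (i * D + β) = (c * tensorN d D (v 0) i 0 β).im
  bulk : ∀ j < n - 2, ∀ q < d * D * D, s.rarr 4 (j * (d * D * D) + q) = v (j + 1) q ∧
    s.rarr 5 (j * (d * D * D) + q) = v (j + 1) (d * D * D + q)
  last : ∀ i < d, ∀ α < D, s.rarr 6 (i * D + α) = (tensorN d D (v (n - 1)) i α 0).re ∧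
    s.rarr 7 (i * D + α) = (tensorN d D (v (n - 1)) i α 0).im

/-- Only the first tensor carries the factor that normalizes the state. Array 8 is left alone, since
the bond weights written for the product state remain valid. -/
lemma runs_writeState : ∃ C : ℕ, ∀ {n d D P S R : ℕ} {net r₀ r₁ : ℕ → ℝ} {s : State} {g : ℝ},
    Ready n d D P S net r₀ r₁ s → 1 ≤ n → s.rarr 11 (n * (D * D)) = g →
    d + 1 ≤ R → D + 1 ≤ R → d * D * D + 1 ≤ R →
    Runs writeState s (C * (n * R ^ 2)) (Stored n d D (1 / Real.sqrt g)
      (fun k => points P net (s.narr 3 (k + 1)))) := by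
  refine ⟨20 +
    (fillCost (nv 16 * nv 2 + nv 17) (scaled (tensorE (.get 3 (nc 1)) (nv 16) (nc 0) (nv 17))) + 18) +
    (fillCost (nv 9 * nv 7 + nv 16) (.get₂ 9 (.get 3 (nv 9 + nc 2) * nv 5 + nv 16)
      (.get 3 (nv 9 + nc 2) * nv 5 + (nv 7 + nv 16))) + 20) +
    (fillCost (nv 16 * nv 2 + nv 17) (tensorE (.get 3 (nv 0)) (nv 16) (nv 17) (nc 0)) + 18), ?_⟩
  intro n d D P S R net r₀ r₁ s g hs hn hg hdR hDR hTR
  set v : ℕ → ℕ → ℝ := fun k => points P net (s.narr 3 (k + 1)) with hv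
  set c := 1 / Real.sqrt g with hc
  refine Runs.mono (Runs.seq (R₁ := fun s' => s'.rvar 5 = c) (T₁ := 20)
    (Runs.mono (Runs.setReal ?_) (by simp [RExp.cost]) (fun _ _ h => h)) fun s1 hF1 k1 =>
    have hs1 := hs.frame hF1 rfl
    Runs.seq (Runs.mono (Runs.fillPair (c := d) (c' := D) (fun i β => c * tensorN d D (v 0) i 0 β)
      (by norm_num) (by norm_num) ?_ ?_ ?_) (fill_time hDR) (fun _ _ h => h)) fun s2 hF2 k2 =>
    have hs2 := hs1.frame hF2 rfl
    Runs.seq (Runs.mono (Runs.fillPair (c := n - 2) (c' := d * D * D)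
      (fun j q => ⟨v (j + 1) q, v (j + 1) (d * D * D + q)⟩)
      (by norm_num) (by norm_num) ?_ ?_ ?_) (fill_time hTR) (fun _ _ h => h)) fun s3 hF3 k3 =>
    have hs3 := hs2.frame hF3 rfl
    Runs.mono (Runs.fillPair (c := d) (c' := D) (fun i α => tensorN d D (v (n - 1)) i α 0)
      (by norm_num) (by norm_num) ?_ ?_ ?_) (fill_time hDR) fun s' hF4 k4 => ⟨?_, ?_, k4⟩) ?_
      (fun _ _ h => h)
  · simp [RExp.eval, hs.n_eq, hs.D_eq, hg, hc]
  · intro s' hF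
    exact (hs1.frame hF rfl).d_eq
  · intro s' hF
    exact (hs1.frame hF rfl).D_eq
  · intro i _ β _ s' hF h16 h17
    have hs' := hs1.frame hF rfl
    refine ⟨by simp [hs'.D_eq, h16, h17], ?_⟩
    rw [ev_scaled, ev_tensorE hs', hF.rvar 5 rfl, k1]
    simp [h16, h17, hF.narr 3 rfl, hF1.narr 3 rfl, hv]
  · intro s' hF
    simp [(hs2.frame hF rfl).n_eq]
  · intro s' hF
    exact (hs2.frame hF rfl).T_eq
  · intro j _ q _ s' hF h9 h16
    have hs' := hs2.frame hF rfl
    refine ⟨by simp [hs'.T_eq, h9, h16], ?_⟩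
    rw [CExp.ev_get₂, hs'.net_eq]
    simp [h16, h9, hs'.P_eq, hs'.T_eq, hF.narr 3 rfl, hF2.narr 3 rfl, hF1.narr 3 rfl, hv, points]
  · intro s' hF
    exact (hs3.frame hF rfl).d_eq
  · intro s' hF
    exact (hs3.frame hF rfl).D_eq
  · intro i _ β _ s' hF h16 h17
    have hs' := hs3.frame hF rfl
    refine ⟨by simp [hs'.D_eq, h16, h17], ?_⟩
    rw [ev_tensorE hs']
    simp [h16, h17, hF.narr 3 rfl, hF3.narr 3 rfl, hF2.narr 3 rfl, hF1.narr 3 rfl, hv, hs'.n_eq,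
      show n - 1 + 1 = n by omega]
  · have h1 : 1 ≤ R := by omega
    have e1 : (d + 1) * R ≤ n * R ^ 2 := by
      calc (d + 1) * R ≤ R * R := Nat.mul_le_mul_right _ hdR
        _ = R ^ 2 := (sq R).symm
        _ ≤ _ := Nat.le_mul_of_pos_left _ hn
    have e2 : (n - 2 + 1) * R ≤ n * R ^ 2 :=
      Nat.mul_le_mul (by omega) (Nat.le_self_pow (by norm_num) R)
    have e0 : 1 ≤ n * R ^ 2 := by nlinarith
    simp only [cost_var, cost_sub, cost_const]
    nlinarith [Nat.mul_le_mul_left (fillCost (nv 16 * nv 2 + nv 17)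
      (scaled (tensorE (.get 3 (nc 1)) (nv 16) (nc 0) (nv 17))) + 18) e1,
      Nat.mul_le_mul_left (fillCost (nv 16 * nv 2 + nv 17)
        (tensorE (.get 3 (nv 0)) (nv 16) (nv 17) (nc 0)) + 18) e1,
      Nat.mul_le_mul_left (fillCost (nv 9 * nv 7 + nv 16)
        (.get₂ 9 (.get 3 (nv 9 + nc 2) * nv 5 + nv 16)
        (.get 3 (nv 9 + nc 2) * nv 5 + (nv 7 + nv 16))) + 20) e2]
  · rw [hF4.rarr 2 rfl, hF4.rarr 3 rfl, hF3.rarr 2 rfl, hF3.rarr 3 rfl]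
    exact k2
  · rw [hF4.rarr 4 rfl, hF4.rarr 5 rfl]
    exact k3

/-- Find a path of least cost, and output its state. -/
def search : Prog :=
  .seq chooseGrid <| .seq countPoints <| .seq makeNet <| .seq fillTables <| .seq backtrack <|
  .seq gramSweep
  -- If the data found have no positive norm, which happens only for coarse accuracy, the product
  -- state already in the output arrays stays there. So the output is normalized in all cases.
  (.ite (.not (.realLe (.get 11 (nv 0 * (nv 2 * nv 2))) (.ofNat (nc 0)))) writeState .skip)

/-- The whole algorithm. -/
def algorithm : Prog :=
  -- For `ε ≥ 1` any normalized state is good enough; moreover `N` may then be tiny, so that the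
  -- time bound could not pay for a search.
  .seq writeProduct (.ite (.not (.realLe (.ofNat (nc 1)) (.var 0))) search .skip)

/-- Number of points of the net. -/
noncomputable def netPoints (d D : ℕ) (ε : ℝ) : ℕ := (2 * gridSize d D ε + 1) ^ coords d D

/-- Result of the search. -/
def Found (n d D : ℕ) [NeZero D] (ε : ℝ) (r₀ r₁ : ℕ → ℝ) (s s' : State) : Prop :=
  ∃ (pts : ℕ → ℕ → ℝ) (p : ℕ → ℕ), Net (coords d D) (gridSize d D ε) (netPoints d D ε) pts ∧
    (∀ z, Path d D n (netPoints d D ε) (tolerance d D ε) pts z →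
      Path d D n (netPoints d D ε) (tolerance d D ε) pts p ∧
      pathCost n (termOf d r₀ r₁) D pts p ≤ pathCost n (termOf d r₀ r₁) D pts z) ∧
    ∃ g : ℝ, g = (env (fun k => tensorOf d D (pts (p (k + 1)))) (vac D) n 0 0).re ∧
      (0 < g ∧ s'.rarr 8 = s.rarr 8 ∧ Stored n d D (1 / Real.sqrt g) (fun k => pts (p (k + 1))) s' ∨
        g ≤ 0 ∧ ∀ a, 2 ≤ a → a ≤ 8 → s'.rarr a = s.rarr a)

/-- The size of the net exceeds `d`, `D`, `d * D * D` and the number of coordinates, and is at least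
the grid size. So powers of the single quantity `netPoints d D ε + 1` measure the time of all
stages. -/
lemma runs_search : ∃ C : ℕ, ∀ {n d D : ℕ} [NeZero D] {ε : ℝ} {s : State}, s.nvar 0 = n →
    s.nvar 1 = d → s.nvar 2 = D → s.nvar 7 = d * D * D → s.rvar 0 = ε → 1 ≤ n → 0 < d → 0 < ε →
    Runs search s (C * (n * (netPoints d D ε + 1) ^ 12)) (Found n d D ε (s.rarr 0) (s.rarr 1) s) := by
  obtain ⟨C₁, hC₁⟩ := runs_fillTables
  obtain ⟨C₂, hC₂⟩ := runs_gramSweep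
  obtain ⟨C₃, hC₃⟩ := runs_writeState
  refine ⟨C₁ + C₂ + C₃ + 500, ?_⟩
  intro n d D _ ε s h0 h1 h2 h7 hε hn hd hε0
  have hD : 0 < D := NeZero.pos D
  set M := gridSize d D ε with hM
  set P := coords d D with hP
  set S := netPoints d D ε with hS
  have hS' : S = (2 * M + 1) ^ P := rfl
  set R := S + 1 with hR
  have hM1 : 1 ≤ M := Nat.ceil_pos.2 (by positivity)
  have hT1 : d ≤ d * D * D := by
    rw [mul_assoc]; exact Nat.le_mul_of_pos_right _ (by positivity)
  have hT2 : D ≤ d * D * D := by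
    rw [mul_comm]; exact Nat.le_mul_of_pos_right _ (by positivity)
  have hP1 : d * D * D ≤ P := by rw [hP, coords]; omega
  have hPS : P < S := Nat.lt_pow_self (by omega)
  have hMS : M ≤ S := by
    have : (2 * M + 1) ^ 1 ≤ S := Nat.pow_le_pow_right (by omega) (by omega)
    rw [pow_one] at this
    omega
  have hS0 : 0 < S := by omega
  refine Runs.mono (Runs.seq (runs_chooseGrid h1 h2 hε hε0) fun s1 hF1 ⟨a1, a2⟩ =>
    Runs.seq (runs_countPoints ((hF1.nvar 7 rfl).trans h7) ((hF1.nvar 2 rfl).trans h2) a1)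
      fun s2 hF2 ⟨b1, b2, b3, b4⟩ =>
    Runs.seq (runs_makeNet (R := R) ((hF2.nvar 3 rfl).trans a1) b1 b2 b4 hM1 le_rfl)
      fun s3 hF3 c1 =>
    have hs3 : Ready n d D P S (s3.rarr 9) (s.rarr 0) (s.rarr 1) s3 := ?_
    have ht3 : s3.rvar 3 = tolerance d D ε ^ 2 := ?_
    Runs.seq (hC₁ (R := R) hs3 hn hd ?_ ?_ le_rfl) fun s4 hF4 hT =>
    have hs4 := hs3.frame hF4 rfl
    Runs.seq (runs_backtrack hs4.n_eq hs4.S_eq hn) fun s5 hF5 ⟨d1, d2⟩ =>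
    have hs5 := hs4.frame hF5 rfl
    Runs.seq (hC₂ (R := R) (v := fun k => points P (s3.rarr 9) (s5.narr 3 (k + 1))) hs5 hn hD
      (fun _ _ => rfl) ?_ ?_) fun s6 hF6 e1 =>
    have hs6 := hs5.frame hF6 rfl
    have hg : s6.rarr 11 (n * (D * D)) = (env (fun k => tensorOf d D
      (points P (s3.rarr 9) (s5.narr 3 (k + 1)))) (vac D) n 0 0).re := ?_
    have hkeep : ∀ a, 2 ≤ a → a ≤ 8 → s6.rarr a = s.rarr a := ?_
    have hfound : ∀ s', (0 < s6.rarr 11 (n * (D * D)) ∧ s'.rarr 8 = s.rarr 8 ∧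
        Stored n d D (1 / Real.sqrt (s6.rarr 11 (n * (D * D))))
          (fun k => points P (s3.rarr 9) (s5.narr 3 (k + 1))) s' ∨
        s6.rarr 11 (n * (D * D)) ≤ 0 ∧ ∀ a, 2 ≤ a → a ≤ 8 → s'.rarr a = s.rarr a) →
      Found n d D ε (s.rarr 0) (s.rarr 1) s s' := fun s' h =>
        ⟨points P (s3.rarr 9), s5.narr 3, net_of_entries hM1 c1, ?_, _, hg, h⟩
    Runs.ite (T := C₃ * (n * R ^ 2) + 1) (fun hb => Runs.mono (hC₃ (R := R) hs6 hn rfl ?_ ?_ ?_)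
      (Nat.le_succ _) fun s' hF hW => hfound s' (Or.inl ⟨?_, ?_, ?_⟩)) (fun hb => Runs.mono
      (Runs.skip (Q := fun s' => s' = s6) rfl) (Nat.le_add_left _ _) fun s' _ hW =>
        hfound s' (Or.inr ⟨?_, ?_⟩))) ?_ (fun _ _ h => h)
  · refine ⟨?_, ?_, ?_, ?_, ?_, ?_, rfl, ?_, ?_⟩
    · rw [hF3.nvar 0 rfl, hF2.nvar 0 rfl, hF1.nvar 0 rfl, h0]
    · rw [hF3.nvar 1 rfl, hF2.nvar 1 rfl, hF1.nvar 1 rfl, h1]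
    · rw [hF3.nvar 2 rfl, hF2.nvar 2 rfl, hF1.nvar 2 rfl, h2]
    · rw [hF3.nvar 5 rfl, b2]
    · rw [hF3.nvar 6 rfl, b3]; rfl
    · rw [hF3.nvar 7 rfl, hF2.nvar 7 rfl, hF1.nvar 7 rfl, h7]
    · rw [hF3.rarr 0 rfl, hF2.rarr 0 rfl, hF1.rarr 0 rfl]
    · rw [hF3.rarr 1 rfl, hF2.rarr 1 rfl, hF1.rarr 1 rfl]
  · rw [hF3.rvar 3 rfl, hF2.rvar 3 rfl, a2]
  · omega
  · omega
  · omega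
  · omega
  · rw [e1]
    have := gram_eq (d := d) (fun k => points P (s3.rarr 9) (s5.narr 3 (k + 1))) n (0 : Fin D) 0
    simp only [Fin.val_zero] at this
    rw [this]
  · intro a ha ha'
    interval_cases a <;>
      rw [hF6.rarr _ rfl, hF5.rarr _ rfl, hF4.rarr _ rfl, hF3.rarr _ rfl, hF2.rarr _ rfl,
        hF1.rarr _ rfl]
  · intro z hz
    rw [ht3] at hT
    exact hT.optimal hS0 d1 d2 hz
  · omega
  · omega
  · omega
  · simpa [Test.Holds, RExp.eval, hs6.n_eq, hs6.D_eq] using hb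
  · rw [hF.rarr 8 rfl]; exact hkeep 8 (by norm_num) (by norm_num)
  · rw [hF6.narr 3 rfl] at hW; exact hW
  · simpa [Test.Holds, RExp.eval, hs6.n_eq, hs6.D_eq] using hb
  · rw [hW]; exact hkeep
  · have hR1 : 1 ≤ R := by omega
    have f : ∀ e, e ≤ 12 → R ^ e ≤ n * R ^ 12 := fun e he =>
      (Nat.pow_le_pow_right hR1 he).trans (Nat.le_mul_of_pos_left _ hn)
    have f' : ∀ C e, e ≤ 12 → C * (n * R ^ e) ≤ C * (n * R ^ 12) := fun C e he =>
      Nat.mul_le_mul_left _ (Nat.mul_le_mul_left _ (Nat.pow_le_pow_right hR1 he))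
    have t1 := f 1 (by norm_num)
    have t4 := f 4 (by norm_num)
    have t0 := f 0 (by norm_num)
    have u0 : n ≤ n * R ^ 12 := Nat.le_mul_of_pos_right _ (by positivity)
    have t2 := f' C₂ 5 (by norm_num)
    have t3 := f' C₃ 2 (by norm_num)
    rw [pow_one] at t1
    simp only [Test.cost, RExp.cost, cost_mul, cost_var, cost_const]
    have e1 : (C₁ + C₂ + C₃ + 500) * (n * R ^ 12) = C₁ * (n * R ^ 12) + C₂ * (n * R ^ 12) +
      C₃ * (n * R ^ 12) + 500 * (n * R ^ 12) := by ring
    rw [e1]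
    omega

end MPSAlgorithm

/-! ### Correctness and running time of the algorithm -/

namespace MPSAlgorithm

open RealRAM Transfer Finset Matrix

lemma runs_algorithm : ∃ C : ℕ, ∀ {n d D : ℕ} [NeZero D] {ε : ℝ} {s : State}, s.nvar 0 = n →
    s.nvar 1 = d → s.nvar 2 = D → s.rvar 0 = ε → 1 ≤ n → 0 < d → 0 < ε →
    Runs algorithm s (620 * (n * (d * D * D)) +
      if ε < 1 then C * (n * (netPoints d D ε + 1) ^ 12) else 0) fun s' =>
      ∃ s₁ : State, (∀ a, 2 ≤ a → a ≤ 8 → ∀ i < n * (d * D * D),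
        s₁.rarr a i = productOutput (d * D * D) a i) ∧
        (1 ≤ ε ∧ s' = s₁ ∨ ε < 1 ∧ Found n d D ε (s.rarr 0) (s.rarr 1) s₁ s') := by
  obtain ⟨C, hC⟩ := runs_search
  refine ⟨C, fun {n d D} _ {ε s} h0 h1 h2 hε hn hd hε0 => ?_⟩
  have hT : 1 ≤ d * D * D := Nat.mul_pos (Nat.mul_pos hd (NeZero.pos D)) (NeZero.pos D)
  have hnT : 1 ≤ n * (d * D * D) := Nat.mul_pos hn hT
  refine Runs.mono (Runs.seq (runs_writeProduct h0 h1 h2 hn hT) (T₂ := 15 +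
      if ε < 1 then C * (n * (netPoints d D ε + 1) ^ 12) else 0) fun s1 hF1 ⟨h7, hp⟩ => ?_)
    (by omega) (fun _ _ h => h)
  have g0 : s1.rvar 0 = ε := (hF1.rvar 0 rfl).trans hε
  have hb : (Test.not (.realLe (.ofNat (nc 1)) (.var 0))).Holds s1 ↔ ε < 1 := by
    simp [Test.Holds, RExp.eval, g0]
  by_cases hε1 : ε < 1
  · rw [if_pos hε1]
    refine Runs.mono (Runs.ite (T := C * (n * (netPoints d D ε + 1) ^ 12)) (fun _ => Runs.mono
      (hC ((hF1.nvar 0 rfl).trans h0) ((hF1.nvar 1 rfl).trans h1) ((hF1.nvar 2 rfl).trans h2) h7 g0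
        hn hd hε0) le_rfl fun s' _ h => ⟨s1, hp, Or.inr ⟨hε1, ?_⟩⟩) (fun h => absurd (hb.2 hε1) h))
      (by simp [Test.cost, RExp.cost]) (fun _ _ h => h)
    rwa [hF1.rarr 0 rfl, hF1.rarr 1 rfl] at h
  · rw [if_neg hε1]
    exact Runs.mono (Runs.ite (T := 1) (fun h => absurd (hb.1 h) hε1)
      (fun _ => Runs.skip ⟨s1, hp, Or.inl ⟨not_lt.1 hε1, rfl⟩⟩)) (by simp [Test.cost, RExp.cost])
      (fun _ _ h => h)

/-- The matrix product state stored in the output arrays, with trivial diagonal tensors. -/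
def readMPS (m d D : ℕ) (s : State) : MPS m d D where
  first i α := ⟨s.rarr 2 (i * D + α), s.rarr 3 (i * D + α)⟩
  bulk j i α β := ⟨s.rarr 4 (((j * d + i) * D + α) * D + β), s.rarr 5 (((j * d + i) * D + α) * D + β)⟩
  last i α := ⟨s.rarr 6 (i * D + α), s.rarr 7 (i * D + α)⟩
  lam _ _ := 1
  lam_nonneg _ _ := zero_le_one

lemma holdsOutput_readMPS {m d D : ℕ} {s : State}
    (h : ∀ (k : Fin (m + 1)) (α : Fin D), s.rarr 8 (k * D + α) = 1) :
    s.HoldsOutput (readMPS m d D s) :=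
  ⟨fun _ _ => ⟨rfl, rfl⟩, fun _ _ _ _ => ⟨rfl, rfl⟩, fun _ _ => ⟨rfl, rfl⟩, h⟩

lemma bulk_index (d D j i α β : ℕ) :
    ((j * d + i) * D + α) * D + β = j * (d * D * D) + ((i * D + α) * D + β) := by ring

section States

variable {m d D : ℕ} [NeZero D]

lemma toState_eq_smul (Ω : MPS m d D) (A : ℕ → Tensor d D) (c : ℂ)
    (h1 : ∀ i β, Ω.first i β = c * A 0 i 0 β) (h2 : ∀ j i α β, Ω.bulk j i α β = A (j + 1) i α β)
    (h3 : ∀ i α, Ω.last i α = A (m + 1) i α 0) (h4 : ∀ k α, Ω.lam k α = 1) :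
    Ω.toState = c • state m A := by
  funext i
  rw [MPS.toState, Pi.smul_apply, state_apply_eq_sum, smul_eq_mul, mul_sum]
  refine sum_congr rfl fun α _ => ?_
  simp only [h1, h2, h3, h4, Complex.ofReal_one, prod_const_one]
  ring

lemma Stored.toState_readMPS {c : ℝ} {v : ℕ → ℕ → ℝ} {s : State} (h : Stored (m + 2) d D c v s) :
    (readMPS m d D s).toState = (c : ℂ) • state m (fun k => tensorOf d D (v k)) := by
  refine toState_eq_smul _ _ _ (fun i β => ?_) (fun j i α β => ?_) (fun i α => ?_) fun _ _ => rfl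
  · obtain ⟨h1, h2⟩ := h.first i i.2 β β.2
    exact Complex.ext h1 h2
  · obtain ⟨h1, h2⟩ := h.bulk j (by omega) _ (tensor_index_lt i α β)
    rw [← bulk_index] at h1 h2
    exact Complex.ext h1 h2
  · obtain ⟨h1, h2⟩ := h.last i i.2 α α.2
    exact Complex.ext h1 h2

/-- The tensor of a product state. -/
noncomputable def productTensor (d D : ℕ) [NeZero D] : Tensor d D := fun i =>
  if (i : ℕ) = 0 then vac D else 0

lemma productTensor_apply (i : Fin d) (α β : Fin D) :
    productTensor d D i α β = ((1 - ((i * D + α) * D + β) : ℕ) : ℂ) := by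
  have hD := NeZero.pos D
  by_cases hi : (i : ℕ) = 0
  · simp only [productTensor, hi, if_true, vac_apply, zero_mul, zero_add]
    by_cases hα : α = 0
    · by_cases hβ : β = 0
      · simp [hα, hβ]
      · have := Fin.val_eq_zero_iff.not.2 hβ
        rw [if_neg (fun h => hβ h.2), show 1 - ((α : ℕ) * D + β) = 0 by omega, Nat.cast_zero]
    · have := Nat.mul_pos (Nat.pos_of_ne_zero (Fin.val_eq_zero_iff.not.2 hα)) hD
      rw [if_neg (fun h => hα h.1), show 1 - ((α : ℕ) * D + β) = 0 by omega, Nat.cast_zero]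
  · have h1 := Nat.mul_pos (Nat.pos_of_ne_zero hi) hD
    have h2 : 0 < ((i : ℕ) * D + α) * D := Nat.mul_pos (by omega) hD
    rw [show 1 - (((i : ℕ) * D + α) * D + β) = 0 by omega]
    simp [productTensor, hi]

lemma xfer_productTensor (hd : 0 < d) : xfer (productTensor d D) (vac D) = vac D := by
  rw [xfer, sum_eq_single (⟨0, hd⟩ : Fin d)]
  · simp [productTensor, vac]
  · intro i _ hi
    have : (i : ℕ) ≠ 0 := fun h => hi (Fin.ext h)
    simp [productTensor, this]
  · simp

lemma env_productTensor (hd : 0 < d) : ∀ k, env (fun _ => productTensor d D) (vac D) k = vac D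
  | 0 => rfl
  | k + 1 => by rw [env, env_productTensor hd k, xfer_productTensor hd]

lemma toState_readMPS_product {s : State} (h : ∀ a, 2 ≤ a → a ≤ 8 →
    ∀ i < (m + 2) * (d * D * D), s.rarr a i = productOutput (d * D * D) a i) :
    (readMPS m d D s).toState = (1 : ℂ) • state m (fun _ => productTensor d D) := by
  have hD := NeZero.pos D
  have hlt : ∀ i : Fin d, ∀ α : Fin D, (i : ℕ) * D + α < (m + 2) * (d * D * D) := fun i α => by
    have h1 := index_lt i.2 α.2
    have h2 : d * D ≤ d * D * D := Nat.le_mul_of_pos_right _ hD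
    have h3 : d * D * D ≤ (m + 2) * (d * D * D) := Nat.le_mul_of_pos_left _ (by omega)
    omega
  refine toState_eq_smul _ _ _ (fun i β => ?_) (fun j i α β => ?_) (fun i α => ?_) fun _ _ => rfl
  · rw [one_mul, productTensor_apply]
    have e : 1 - ((i : ℕ) * D + β) = 1 - (((i : ℕ) * D + ((0 : Fin D) : ℕ)) * D + β) := by
      rcases Nat.eq_zero_or_pos (i : ℕ) with hi | hi
      · simp [hi]
      · have h1 := Nat.mul_pos hi hD
        have h2 := Nat.mul_pos h1 hD
        simp only [Fin.val_zero, add_zero]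
        omega
    rw [← e]
    apply Complex.ext
    · simpa [readMPS, productOutput] using h 2 (by norm_num) (by norm_num) _ (hlt i β)
    · simpa [readMPS, productOutput] using h 3 (by norm_num) (by norm_num) _ (hlt i β)
  · have h0 := tensor_index_lt i α β
    have h1 : (j : ℕ) * (d * D * D) + (((i : ℕ) * D + α) * D + β) < (m + 2) * (d * D * D) :=
      index_lt (by omega) h0
    have h2 : ((j : ℕ) * (d * D * D) + (((i : ℕ) * D + α) * D + β)) % (d * D * D) =
        ((i : ℕ) * D + α) * D + β := by rw [Nat.mul_add_mod', Nat.mod_eq_of_lt h0]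
    rw [productTensor_apply]
    apply Complex.ext
    · have := h 4 (by norm_num) (by norm_num) _ h1
      simp only [readMPS, bulk_index]
      rw [this, productOutput, if_pos rfl, h2]
      simp
    · have := h 5 (by norm_num) (by norm_num) _ h1
      simp only [readMPS, bulk_index]
      rw [this]
      simp [productOutput]
  · rw [productTensor_apply]
    have e : 1 - ((i : ℕ) * D + α) = 1 - (((i : ℕ) * D + α) * D + ((0 : Fin D) : ℕ)) := by
      rcases Nat.eq_zero_or_pos ((i : ℕ) * D + α) with hi | hi
      · simp [hi]
      · have h2 := Nat.mul_pos hi hD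
        simp only [Fin.val_zero, add_zero]
        omega
    rw [← e]
    apply Complex.ext
    · simpa [readMPS, productOutput] using h 6 (by norm_num) (by norm_num) _ (hlt i α)
    · simpa [readMPS, productOutput] using h 7 (by norm_num) (by norm_num) _ (hlt i α)

lemma abs_energy_le {H : NNHamiltonian m d} {J : ℝ} (hJ : H.TermsBoundedBy J) {ψ : MPS m d D}
    (hψ : ψ.Normalized) : |H.energy ψ.toState| ≤ (m + 1) * J := by
  have h := abs_energy_state_le hJ (absorbed ψ)
  rw [← state_dotProduct_self, state_absorbed, hψ] at h
  simpa using h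

lemma normalized_of_toState {Ω : MPS m d D} {A : ℕ → Tensor d D} {c g : ℝ}
    (h : Ω.toState = (c : ℂ) • state m A) (hg : env A (vac D) (m + 2) 0 0 = g) (hc : c ^ 2 * g = 1) :
    Ω.Normalized := by
  rw [MPS.Normalized, h, star_smul, smul_dotProduct, dotProduct_smul, state_dotProduct_self, hg]
  simp only [smul_eq_mul, Complex.star_def, Complex.conj_ofReal]
  rw [← mul_assoc, ← sq]
  exact_mod_cast hc

end States

lemma termOf_eq {m d D : ℕ} {ε : ℝ} {H : NNHamiltonian m d} {s : State} (hs : s.HoldsInput D ε H) (j : Fin (m + 1)) :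
    termOf d (s.rarr 0) (s.rarr 1) j = H.term j := by
  ext ⟨a, b⟩ ⟨a', b'⟩
  obtain ⟨h1, h2⟩ := hs.2.2.2.2 j a b a' b'
  exact Complex.ext h1 h2

/-! ### Accuracy of the output and size of the net -/

section Final

variable {m d D : ℕ} [NeZero D] {ε : ℝ}

lemma tolerance_mul (hd : 0 < d) : tolerance d D ε * (80 * d ^ 4 * D ^ 7) = ε := by
  have hD : (D : ℝ) ≠ 0 := by exact_mod_cast NeZero.ne D
  have hd' : (d : ℝ) ≠ 0 := by exact_mod_cast hd.ne'
  rw [tolerance, div_mul_cancel₀]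
  positivity

lemma gridSize_pos (hd : 0 < d) (hε : 0 < ε) : 0 < gridSize d D ε := by
  have := NeZero.pos D
  exact Nat.ceil_pos.2 (by positivity)

lemma inv_gridSize_le (hd : 0 < d) (hε : 0 < ε) :
    28 * d * D ^ 3 * (1 / (gridSize d D ε : ℝ)) ≤ tolerance d D ε := by
  have hD : (0 : ℝ) < D := by exact_mod_cast NeZero.pos D
  have hd' : (0 : ℝ) < d := by exact_mod_cast hd
  have hM : (0 : ℝ) < gridSize d D ε := by exact_mod_cast gridSize_pos hd hε
  have h := Nat.le_ceil (((2240 * d ^ 5 * D ^ 10 : ℕ) : ℝ) / ε)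
  rw [div_le_iff₀ hε] at h
  change _ ≤ (gridSize d D ε : ℝ) * ε at h
  push_cast at h
  rw [tolerance, mul_one_div, div_le_div_iff₀ hM (by positivity)]
  calc _ = 2240 * (d : ℝ) ^ 5 * D ^ 10 := by ring
    _ ≤ _ := by linarith

/-- If the accuracy is coarse, all energies are close enough. -/
lemma energy_le_of_coarse {H : NNHamiltonian m d} {J : ℝ} (hJ : H.TermsBoundedBy J)
    {Ω ψ : MPS m d D} (hΩ : Ω.Normalized) (hψ : ψ.Normalized)
    (h : 1 ≤ ((m + 2 : ℕ) : ℝ) * D ^ 2 * ε) :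
    H.energy Ω.toState ≤ H.energy ψ.toState + 2 * J * D ^ 2 * ((m + 2 : ℕ) : ℝ) ^ 2 * ε := by
  have hJ0 : 0 ≤ J := (norm_nonneg _).trans (hJ 0)
  have h1 := (abs_le.1 (abs_energy_le hJ hΩ)).2
  have h2 := (abs_le.1 (abs_energy_le hJ hψ)).1
  have h3 : 2 * J * ((m + 2 : ℕ) : ℝ) * 1 ≤ 2 * J * ((m + 2 : ℕ) : ℝ) * (((m + 2 : ℕ) : ℝ) * D ^ 2 * ε) :=
    mul_le_mul_of_nonneg_left h (by positivity)
  push_cast at h3 ⊢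
  linarith

/-- The search promises a best path only if some admissible path exists; rounding any normalized
competitor provides one. -/
lemma Found.correct {H : NNHamiltonian m d} {s s₁ s' : State} (hd : 0 < d) (hε : 0 < ε)
    (hs : s.HoldsInput D ε H) (h : Found (m + 2) d D ε (s.rarr 0) (s.rarr 1) s₁ s')
    (hp : ∀ a, 2 ≤ a → a ≤ 8 → ∀ i < (m + 2) * (d * D * D),
      s₁.rarr a i = productOutput (d * D * D) a i) :
    (∀ i < (m + 2) * (d * D * D), s'.rarr 8 i = productOutput (d * D * D) 8 i) ∧
      (readMPS m d D s').Normalized ∧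
      ((((m + 2 : ℕ) : ℝ) * D ^ 2 * ε < 1) → ∀ J : ℝ, H.TermsBoundedBy J → ∀ ψ : MPS m d D,
        ψ.Normalized → H.energy (readMPS m d D s').toState ≤
          H.energy ψ.toState + 2 * J * D ^ 2 * ((m + 2 : ℕ) : ℝ) ^ 2 * ε) := by
  obtain ⟨pts, p, hnet, hopt, g, hg, hcase⟩ := h
  have hmain : (((m + 2 : ℕ) : ℝ) * D ^ 2 * ε < 1) → ∀ J : ℝ, H.TermsBoundedBy J →
      ∀ ψ : MPS m d D, ψ.Normalized → 0 < g ∧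
        H.energy (state m fun k => tensorOf d D (pts (p (k + 1)))) / g ≤
        H.energy ψ.toState + 2 * J * D ^ 2 * ((m + 2 : ℕ) : ℝ) ^ 2 * ε := by
    intro hn J hJ ψ hψ
    obtain ⟨B, ρ, hE, -⟩ := exists_exact hd H hJ ψ hψ
    obtain ⟨z, hz, -⟩ := hE.exists_path hd (gridSize_pos hd hε) hnet (inv_gridSize_le hd hε)
      ((norm_nonneg _).trans (hJ 0)) (termOf d (s.rarr 0) (s.rarr 1)) (fun j hj a b => by
        have := termOf_eq hs ⟨j, by omega⟩
        simp only at this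
        rw [this]
        exact (formBound_of_termsBoundedBy hJ _).apply a b)
    obtain ⟨h1, h2⟩ := Path.energy_le hd (gridSize_pos hd hε) hnet hε (tolerance_mul hd)
      (inv_gridSize_le hd hε) H _ (termOf_eq hs) (hopt z hz).1 (fun z hz => (hopt z hz).2) hn hg
    exact ⟨h1, h2 J hJ ψ hψ⟩
  rcases hcase with ⟨hg0, h8, hst⟩ | ⟨hg0, hkeep⟩
  · have hΩ := hst.toState_readMPS
    have hc : (1 / Real.sqrt g) ^ 2 * g = 1 := by
      rw [div_pow, Real.sq_sqrt hg0.le, one_pow, one_div_mul_cancel hg0.ne']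
    -- The program computes only the real part of the squared norm; the imaginary part vanishes
    -- because the number is a sum of squared moduli.
    have hreal : env (fun k => tensorOf d D (pts (p (k + 1)))) (vac D) (m + 2) 0 0 = (g : ℂ) := by
      have h1 := state_dotProduct_self (m := m) (fun k => tensorOf d D (pts (p (k + 1))))
      have h2 : (star (state m fun k => tensorOf d D (pts (p (k + 1)))) ⬝ᵥ
          state m fun k => tensorOf d D (pts (p (k + 1)))).im = 0 := by
        rw [dotProduct, Complex.im_sum]
        refine sum_eq_zero fun i _ => ?_
        rw [Pi.star_apply, mul_comm, Complex.star_def, Complex.mul_conj, Complex.ofReal_im]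
      rw [h1] at h2
      exact Complex.ext (by rw [hg, Complex.ofReal_re]) (by rw [h2, Complex.ofReal_im])
    refine ⟨by rw [h8]; exact hp 8 (by norm_num) le_rfl, normalized_of_toState hΩ hreal hc,
      fun hn J hJ ψ hψ => ?_⟩
    have := (hmain hn J hJ ψ hψ).2
    rw [hΩ, energy_smul, Complex.norm_real, Real.norm_eq_abs, sq_abs, div_pow, one_pow,
      Real.sq_sqrt hg0.le, one_div_mul_eq_div]
    exact this
  · have hp' : ∀ a, 2 ≤ a → a ≤ 8 → ∀ i < (m + 2) * (d * D * D),
        s'.rarr a i = productOutput (d * D * D) a i := fun a h1 h2 i hi => by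
      rw [hkeep a h1 h2]; exact hp a h1 h2 i hi
    refine ⟨hp' 8 (by norm_num) le_rfl, normalized_of_toState (c := 1) (g := 1)
      (by simpa using toState_readMPS_product hp') (by simp [env_productTensor hd, vac_apply])
      (by norm_num), fun hn J hJ ψ hψ => ?_⟩
    -- For fine accuracy the norm is positive, so the fallback cannot have been taken.
    exact absurd (hmain hn J hJ ψ hψ).1 (not_lt.2 hg0)

/-- The number of grid values per coordinate is at most `(144 d D / ε) ^ 10`, and the number of
coordinates is at most twice the exponent `D + 2 d D²`. Comparing powers of `1 / ε` requires `ε <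
1`. -/
lemma netPoints_le (hd : 0 < d) (hε : 0 < ε) (hε1 : ε < 1) :
    (netPoints d D ε : ℝ) ≤ netSize d D ε ^ 20 := by
  have hD := NeZero.pos D
  have hd1 : (1 : ℝ) ≤ d := by exact_mod_cast hd
  have hD1 : (1 : ℝ) ≤ D := by exact_mod_cast hD
  set x : ℝ := 1 / ε with hx
  have hx1 : 1 ≤ x := by rw [hx, le_div_iff₀ hε]; linarith
  have hX : 144 * d * D / ε = 144 * d * D * x := by rw [hx]; ring
  have hM : ((2 * gridSize d D ε + 1 : ℕ) : ℝ) ≤ (144 * d * D * x) ^ 10 := by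
    have h1 : (gridSize d D ε : ℝ) < 2240 * (d : ℝ) ^ 5 * D ^ 10 * x + 1 := by
      have := Nat.ceil_lt_add_one (a := ((2240 * d ^ 5 * D ^ 10 : ℕ) : ℝ) / ε) (by positivity)
      have e : ((2240 * d ^ 5 * D ^ 10 : ℕ) : ℝ) / ε = 2240 * (d : ℝ) ^ 5 * D ^ 10 * x := by
        rw [hx]; push_cast; ring
      rw [e] at this
      rwa [gridSize, e]
    have h2 : (d : ℝ) ^ 5 * D ^ 10 * x ≤ d ^ 10 * D ^ 10 * x ^ 10 := by
      have e1 : (d : ℝ) ^ 5 ≤ d ^ 10 := pow_le_pow_right₀ hd1 (by norm_num)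
      have e2 : x ≤ x ^ 10 := le_self_pow₀ hx1 (by norm_num)
      gcongr
    have h3 : (1 : ℝ) ≤ d ^ 10 * D ^ 10 * x ^ 10 :=
      one_le_mul_of_one_le_of_one_le (one_le_mul_of_one_le_of_one_le (one_le_pow₀ hd1)
        (one_le_pow₀ hD1)) (one_le_pow₀ hx1)
    have e : (144 * d * D * x) ^ 10 = 144 ^ 10 * ((d : ℝ) ^ 10 * D ^ 10 * x ^ 10) := by ring
    rw [e]
    push_cast
    linarith
  have hP : coords d D ≤ 2 * (D + 2 * d * D ^ 2) := by
    rw [coords]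
    have : D * D ≤ d * (D * D) := Nat.le_mul_of_pos_left _ hd
    nlinarith
  have hbase : 1 ≤ (144 * d * D * x) ^ 10 := by
    refine one_le_pow₀ (one_le_mul_of_one_le_of_one_le (one_le_mul_of_one_le_of_one_le ?_ hD1) hx1)
    linarith
  calc (netPoints d D ε : ℝ) = ((2 * gridSize d D ε + 1 : ℕ) : ℝ) ^ coords d D := by
        rw [netPoints]; push_cast; rfl
    _ ≤ ((144 * d * D * x) ^ 10) ^ coords d D := by gcongr
    _ ≤ ((144 * d * D * x) ^ 10) ^ (2 * (D + 2 * d * D ^ 2)) := pow_le_pow_right₀ hbase hP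
    _ = netSize d D ε ^ 20 := by
        rw [netSize, hX, ← pow_mul, ← pow_mul]
        congr 1
        ring

end Final

end MPSAlgorithm

open MPSAlgorithm Transfer in
theorem theorem1 :
    ∃ (P : RealRAM.Prog) (p : MvPolynomial (Fin 3) ℕ),
      ∀ (m d D : ℕ) (ε : ℝ) (H : NNHamiltonian m d) (s : RealRAM.State),
        0 < d → 0 < D → 0 < ε → s.HoldsInput D ε H →
        ∃ (s' : RealRAM.State) (t : ℕ) (Ω : MPS m d D),
          RealRAM.Exec P s s' t ∧
          (t : ℝ) ≤ ((m + 2 : ℕ) : ℝ) *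
            MvPolynomial.aeval ![(d : ℝ), (D : ℝ), netSize d D ε] p ∧
          s'.HoldsOutput Ω ∧
          Ω.Normalized ∧
          ∀ J : ℝ, H.TermsBoundedBy J →
            ∀ ψ : MPS m d D, ψ.Normalized → 12 ≤ (m + 2) * D ^ 2 →
              H.energy Ω.toState ≤
                H.energy ψ.toState + 2 * J * D ^ 2 * ((m + 2 : ℕ) : ℝ) ^ 2 * ε := by
  obtain ⟨C, hC⟩ := runs_algorithm
  -- The first summand pays for writing the product state. The second bounds `(S + 1) ^ 12 ≤ (2 * N
  -- ^ 20) ^ 12` for a net of `S` points.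
  refine ⟨algorithm, MvPolynomial.C 620 * MvPolynomial.X 0 * MvPolynomial.X 1 ^ 2 +
    MvPolynomial.C (C * 2 ^ 12) * MvPolynomial.X 2 ^ 240, ?_⟩
  intro m d D ε H s hd hD hε hs
  have : NeZero D := ⟨hD.ne'⟩
  obtain ⟨s', t, hexec, ht, s₁, hp, hcase⟩ :=
    hC (n := m + 2) hs.1 hs.2.1 hs.2.2.1 hs.2.2.2.1 (by omega) hd hε
  have hout : (∀ i < (m + 2) * (d * D * D), s'.rarr 8 i = productOutput (d * D * D) 8 i) ∧
      (readMPS m d D s').Normalized ∧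
      ((((m + 2 : ℕ) : ℝ) * D ^ 2 * ε < 1) → ∀ J : ℝ, H.TermsBoundedBy J → ∀ ψ : MPS m d D,
        ψ.Normalized → H.energy (readMPS m d D s').toState ≤
          H.energy ψ.toState + 2 * J * D ^ 2 * ((m + 2 : ℕ) : ℝ) ^ 2 * ε) := by
    rcases hcase with ⟨hε1, rfl⟩ | ⟨-, hF⟩
    · refine ⟨hp 8 (by norm_num) le_rfl, normalized_of_toState (c := 1) (g := 1)
        (by simpa using toState_readMPS_product hp) (by simp [env_productTensor hd, vac_apply])
        (by norm_num), fun hn => ?_⟩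
      have h1 : (1 : ℝ) ≤ ((m + 2 : ℕ) : ℝ) := by exact_mod_cast (by omega : 1 ≤ m + 2)
      have h2 : (1 : ℝ) ≤ (D : ℝ) ^ 2 := one_le_pow₀ (by exact_mod_cast hD)
      exact absurd hn (not_lt.2 (one_le_mul_of_one_le_of_one_le
        (one_le_mul_of_one_le_of_one_le h1 h2) hε1))
    · exact hF.correct hd hε hs hp
  refine ⟨s', t, readMPS m d D s', hexec, ?_, holdsOutput_readMPS fun k α => ?_, hout.2.1,
    fun J hJ ψ hψ _ => ?_⟩
  · have haev : MvPolynomial.aeval ![(d : ℝ), (D : ℝ), netSize d D ε]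
        (MvPolynomial.C 620 * MvPolynomial.X 0 * MvPolynomial.X 1 ^ 2 +
          MvPolynomial.C (C * 2 ^ 12) * MvPolynomial.X 2 ^ 240 : MvPolynomial (Fin 3) ℕ) =
        620 * (d : ℝ) * D ^ 2 + (C * 2 ^ 12) * netSize d D ε ^ 240 := by
      simp
      norm_num
    rw [haev]
    have hN : 0 ≤ netSize d D ε := by rw [netSize]; positivity
    have ht' : (t : ℝ) ≤ ((620 * ((m + 2) * (d * D * D)) +
      if ε < 1 then C * ((m + 2) * (netPoints d D ε + 1) ^ 12) else 0 : ℕ) : ℝ) := by exact_mod_cast ht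
    refine ht'.trans ?_
    have e : ((m + 2 : ℕ) : ℝ) * (620 * (d : ℝ) * D ^ 2 + (C * 2 ^ 12) * netSize d D ε ^ 240) =
        620 * (((m + 2 : ℕ) : ℝ) * (d * D * D)) +
          ((m + 2 : ℕ) : ℝ) * ((C * 2 ^ 12) * netSize d D ε ^ 240) := by ring
    rw [e]
    split_ifs with hε1
    · have h1 := netPoints_le (D := D) hd hε hε1
      have h2 : (1 : ℝ) ≤ netPoints d D ε := by
        exact_mod_cast Nat.one_le_pow _ _ (Nat.succ_pos _)
      have h3 : ((netPoints d D ε : ℝ) + 1) ^ 12 ≤ 2 ^ 12 * netSize d D ε ^ 240 := by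
        calc ((netPoints d D ε : ℝ) + 1) ^ 12 ≤ (2 * netSize d D ε ^ 20) ^ 12 := by
              gcongr
              linarith
          _ = _ := by ring
      push_cast
      have h4 : (C : ℝ) * (((m : ℝ) + 2) * ((netPoints d D ε : ℝ) + 1) ^ 12) ≤
          C * (((m : ℝ) + 2) * (2 ^ 12 * netSize d D ε ^ 240)) := by gcongr
      linarith
    · push_cast
      have : 0 ≤ ((m : ℝ) + 2) * (C * 2 ^ 12 * netSize d D ε ^ 240) := by positivity
      linarith
  · have hT : D ≤ d * D * D := by
      rw [mul_comm]; exact Nat.le_mul_of_pos_right _ (by positivity)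
    have hk : (k : ℕ) * D + α < (m + 2) * (d * D * D) := by
      have h1 := index_lt k.2 α.2
      have h2 : (m + 1) * D ≤ (m + 2) * (d * D * D) := Nat.mul_le_mul (by omega) hT
      omega
    rw [hout.1 _ hk]
    simp [productOutput]
  -- Either the accuracy is fine enough for the stability estimates, or the error allowed exceeds
  -- the spread of all possible energies.
  · rcases lt_or_ge (((m + 2 : ℕ) : ℝ) * D ^ 2 * ε) 1 with h | h
    · exact hout.2.2 h J hJ ψ hψ
    · exact energy_le_of_coarse hJ hout.2.1 hψ h
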